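/- Let $d\ge 2$, $\mathbb T^d=\mathbb R^d/\mathbb Z^d$, $T\in(0,+\infty]$ and $p\in(2,\infty)$, and let $b\in L^\infty([0,T],W^{1,p}(\mathbb T^d,\mathbb R^d))$ satisfy $\operatorname{div} b_t=0$ in the sense of distributions for a.e. $t$. (For $T=+\infty$, $[0,T]$ stands for $[0,\infty)$.) Let $u_0\in L^\infty(\mathbb T^d)$. For every $\nu>0$ let $u^\nu$ be a mean-free distributional solution of $$\partial_t u^\nu+b\cdot\nabla u^\nu-\nu\Delta u^\nu=0\ \text{ on } \mathbb T^d\times(0,T],\qquad u^\nu(0,\cdot)=u_0,$$ in the class $L^\infty([0,T]\times\mathbb T^d)\cap C([0,T],L^2(\mathbb T^d))\cap L^1([0,T],W^{1,2}(\mathbb T^d))$, and let $u^0$ be a mean-free distributional solution of $$\partial_t u^0+b\cdot\nabla u^0=0\ \text{ on } \mathbb T^d\times(0,T],\qquad u^0(0,\cdot)=u_0,$$ in the class $C([0,T],(L^\infty(\mathbb T^d),w^*))$, where $w^*$ is the weak-$*$ topology. Let $0<t\le T$, $t<\infty$. If there is $q>0$ such that $$\limsup_{\nu\downarrow0}\ \log(1/\nu)^q\,\nu\int_0^t\|\nabla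 u^\nu_s\|_{L^2}^2\,ds<\infty,$$ then $u^0_t\in H^{\log,r}$ for every $r$ with $0<r<q\,\frac{p-2}{p-1}$. Here $H^{\log,r}$ is the set of $u\in L^2(\mathbb T^d)$ such that $$\|u\|_{L^2}^2+\int_{\{|h|<1/3\}}\int_{\mathbb T^d}\frac{|u(x+h)-u(x)|^2}{|h|^d}\,\frac{1}{\log(1/|h|)^{1-r}}\,dx\,dh<\infty .$$ -/

import Mathlib

open MeasureTheory Filter Topology
open scoped ENNReal ContDiff

noncomputable section

namespace AdvDiff

/-- The flat torus `ℝ^d / ℤ^d`; its `volume` is the product of the Lebesgue probability measures. -/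
abbrev Torus (d : ℕ) : Type := UnitAddTorus (Fin d)

/-- `ℝ^d` with the Euclidean norm and Lebesgue measure. -/
abbrev Euc (d : ℕ) : Type := EuclideanSpace ℝ (Fin d)

/-- The projection `ℝ^d → ℝ^d / ℤ^d`. -/
def proj {d : ℕ} (y : Euc d) : Torus d := fun i => ((y i : ℝ) : UnitAddCircle)

/-- Smooth functions on the torus: the periodic lift to `ℝ^d` is `C^∞`. -/
def SmoothOnTorus {d : ℕ} (φ : Torus d → ℝ) : Prop :=
  ContDiff ℝ ∞ (fun y : Euc d => φ (proj y))

/-- The classical partial derivative `∂_i φ` of a function on the torus. -/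
def pderiv {d : ℕ} (i : Fin d) (φ : Torus d → ℝ) (x : Torus d) : ℝ :=
  deriv (fun s : ℝ => φ (x + Pi.single i ((s : ℝ) : UnitAddCircle))) 0

/-- The classical Laplacian `Δ φ` of a function on the torus. -/
def laplace {d : ℕ} (φ : Torus d → ℝ) (x : Torus d) : ℝ :=
  ∑ i, pderiv i (pderiv i φ) x

/-- `G = (∂_1 f, …, ∂_d f)` is the weak gradient of `f` (scalar or vector valued) on the torus,
tested against smooth functions. -/
def IsWeakGrad {d : ℕ} {F : Type*} [NormedAddCommGroup F] [NormedSpace ℝ F]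
    (f : Torus d → F) (G : Fin d → Torus d → F) : Prop :=
  Integrable f ∧ (∀ i, Integrable (G i)) ∧
    ∀ φ : Torus d → ℝ, SmoothOnTorus φ →
      ∀ i, ∫ x, pderiv i φ x • f x = - ∫ x, φ x • G i x

/-- `‖∇ f‖²_{L²}` for the weak gradient; it is `∞` when `f` has no integrable weak gradient.
(The weak gradient is unique almost everywhere, so the infimum runs over equal values.) -/
def gradL2Sq {d : ℕ} (f : Torus d → ℝ) : ℝ≥0∞ :=
  ⨅ (G : Fin d → Torus d → ℝ) (_ : IsWeakGrad f G), ∫⁻ x, ∑ i, ‖G i x‖ₑ ^ 2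

/-- The time interval `[0, T]` for `T ≤ ∞`; it is `[0, ∞)` for `T = ∞`. -/
def timeInterval (T : ℝ≥0∞) : Set ℝ := {t : ℝ | 0 ≤ t ∧ ENNReal.ofReal t ≤ T}

/-- The measure `dt ⊗ dx` on `[0, T] × 𝕋^d`. -/
def spacetime (d : ℕ) (T : ℝ≥0∞) : Measure (ℝ × Torus d) :=
  (volume.restrict (timeInterval T)).prod volume

/-- The Bochner space `L^m([0,T], W^{1,p}(𝕋^d, F))`, for `1 ≤ m ≤ ∞` and `1 ≤ p < ∞`. -/
def MemLpTimeW1p {d : ℕ} {F : Type*} [NormedAddCommGroup F] [NormedSpace ℝ F]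
    (m p T : ℝ≥0∞) (f : ℝ → Torus d → F) : Prop :=
  AEStronglyMeasurable (fun z : ℝ × Torus d => f z.1 z.2) (spacetime d T) ∧
    ∃ G : ℝ → Fin d → Torus d → F,
      (∀ i, AEStronglyMeasurable (fun z : ℝ × Torus d => G z.1 i z.2) (spacetime d T)) ∧
      (∀ᵐ t ∂(volume.restrict (timeInterval T)), IsWeakGrad (f t) (G t)) ∧
      eLpNorm (fun t => eLpNorm (f t) p volume + ∑ i, eLpNorm (G t i) p volume) m
        (volume.restrict (timeInterval T)) < (⊤ : ℝ≥0∞)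

/-- `div b(t, ·) = 0` in the sense of distributions on the torus, for almost every time. -/
def DivFree {d : ℕ} (T : ℝ≥0∞) (b : ℝ → Torus d → Euc d) : Prop :=
  ∀ᵐ t ∂(volume.restrict (timeInterval T)), ∀ φ : Torus d → ℝ, SmoothOnTorus φ →
    ∫ x, ∑ i, b t x i * pderiv i φ x = 0

/-- Test functions in `C^∞_c((0, T) × 𝕋^d)`. -/
def IsTestFunction {d : ℕ} (T : ℝ≥0∞) (φ : ℝ → Torus d → ℝ) : Prop :=
  ContDiff ℝ ∞ (fun z : ℝ × Euc d => φ z.1 (proj z.2)) ∧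
    ∃ α β : ℝ, 0 < α ∧ ENNReal.ofReal β < T ∧ ∀ t, t ∉ Set.Icc α β → ∀ x, φ t x = 0

/-- `∂_t u + b · ∇u - ν Δu = 0` in the sense of distributions on `(0, T) × 𝕋^d` (for divergence
free `b`), together with the initial condition `u(0, ·) = u₀`. It is used for functions `u` that are
continuous in time in a weak sense, so that `u(0, ·)` is meaningful. -/
def SolvesCauchy {d : ℕ} (T : ℝ≥0∞) (b : ℝ → Torus d → Euc d) (ν : ℝ)
    (u₀ : Torus d → ℝ) (u : ℝ → Torus d → ℝ) : Prop :=
  (∀ φ : ℝ → Torus d → ℝ, IsTestFunction T φ →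
    ∫ t in timeInterval T, ∫ x, u t x *
      (deriv (fun s => φ s x) t + ∑ i, b t x i * pderiv i (φ t) x + ν * laplace (φ t) x) = 0) ∧
  u 0 =ᵐ[volume] u₀

/-- Every `u(t, ·)`, `t ∈ [0, T]`, has zero mean. -/
def MeanFree {d : ℕ} (T : ℝ≥0∞) (u : ℝ → Torus d → ℝ) : Prop :=
  ∀ t ∈ timeInterval T, ∫ x, u t x = 0

/-- `u ∈ C([0, T], L²(𝕋^d))`. -/
def ContTimeL2 {d : ℕ} (T : ℝ≥0∞) (u : ℝ → Torus d → ℝ) : Prop :=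
  (∀ t ∈ timeInterval T, MemLp (u t) 2 volume) ∧
  ∀ t ∈ timeInterval T,
    Tendsto (fun s => eLpNorm (fun x => u s x - u t x) 2 volume) (𝓝[timeInterval T] t) (𝓝 0)

/-- `u ∈ C([0, T], (L^∞(𝕋^d), w*))`. -/
def ContTimeWeakStar {d : ℕ} (T : ℝ≥0∞) (u : ℝ → Torus d → ℝ) : Prop :=
  (∀ t ∈ timeInterval T, MemLp (u t) (⊤ : ℝ≥0∞) volume) ∧
  ∀ g : Torus d → ℝ, Integrable g →
    ContinuousOn (fun t => ∫ x, u t x * g x) (timeInterval T)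

/-- Solutions of the advection-diffusion equation with diffusivity `ν`, in the class
`L^∞([0,T] × 𝕋^d) ∩ C([0,T], L²) ∩ L¹([0,T], W^{1,2})`. -/
structure IsAdvDiffSolution {d : ℕ} (T : ℝ≥0∞) (b : ℝ → Torus d → Euc d) (ν : ℝ)
    (u₀ : Torus d → ℝ) (u : ℝ → Torus d → ℝ) : Prop where
  bounded : MemLp (fun z : ℝ × Torus d => u z.1 z.2) (⊤ : ℝ≥0∞) (spacetime d T)
  cont : ContTimeL2 T u
  sobolev : MemLpTimeW1p 1 2 T u
  meanFree : MeanFree T u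
  solves : SolvesCauchy T b ν u₀ u

/-- Solutions of the transport equation, in the class `C([0,T], (L^∞, w*))`. -/
structure IsTransportSolution {d : ℕ} (T : ℝ≥0∞) (b : ℝ → Torus d → Euc d)
    (u₀ : Torus d → ℝ) (u : ℝ → Torus d → ℝ) : Prop where
  cont : ContTimeWeakStar T u
  meanFree : MeanFree T u
  solves : SolvesCauchy T b 0 u₀ u

/-- The square of the log-Sobolev seminorm,
`∫_{|h| < 1/3} ∫_{𝕋^d} |u(x+h) - u(x)|² |h|^{-d} log(1/|h|)^{α-1} dx dh`. -/
def logSeminormSq {d : ℕ} (α : ℝ) (u : Torus d → ℝ) : ℝ≥0∞ :=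
  ∫⁻ h in Metric.ball (0 : Euc d) (1 / 3), ∫⁻ x : Torus d,
    ENNReal.ofReal (|u (x + proj h) - u x| ^ 2 / ‖h‖ ^ d * (1 / Real.log (1 / ‖h‖) ^ (1 - α)))

/-- The log-Sobolev class `H^{log,α}`. -/
def MemHlog {d : ℕ} (α : ℝ) (u : Torus d → ℝ) : Prop :=
  MemLp u 2 volume ∧ eLpNorm u 2 volume ^ 2 + logSeminormSq α u < (⊤ : ℝ≥0∞)

end AdvDiff

end

namespace AdvDiff

/-! Write v for the transport solution, w for the diffusive solution with viscosity ν, L = log(1/ν)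
and G = ∫‖∇w‖², so that G ≲ L^{-q}/ν. Mollify w by a kernel R_n at scale 1/√n. The function R_n * w
solves the transport equation with a source, namely the commutator of b·∇ with the mollification
plus ν Δ(R_n * w). Pairing this source with v - R_n * w in L² controls the growth of the distance
between v and R_n * w.

In the commutator, the increment of b over z costs |z| in L^p, which compensates the derivative of
the kernel. The increment of w is bounded in L^∞ and small in L², and Hölder with exponents 2, p,
2p/(p-2) leaves ‖w(·-z) - w‖_2^{(p-2)/p}. Hence the commutator contributes (G/n)^{(p-2)/(2p)}
(`lintegral_triple_le`, `commBound_le_of_grad`). In the Laplacian one derivative falls on the kernel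
and the other on w, which contributes ν√(nG) (`enorm_integral_mul_laplace_le`). With νn ≈ L^κ the
squares of the two are L^{-(q+κ)(p-2)/p} and L^{κ-q}. They balance at κ = q/(p-1), and both equal
L^{-r'} with r' = q(p-2)/(p-1). This gives `WeakSol.integral_sub_conv_sq_le`.

The distance at time zero is ‖u₀ - R_n * u₀‖², and u₀ is only bounded. Its regularity also comes
from the dissipation bound: little energy is lost on a short initial layer, while inside the layer
there is a time with a controlled gradient, and the pairing ⟨w, R_n * w⟩ changes slowly
(`WeakSol.integral_conv_sub_sq_initial_le`). This step is run at the larger viscosity ν^{1/4}, which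
costs only constants on the logarithmic scale, and yields O(L^{-q}).

So v at the final time is within O(L^{-r'}), in squared L² distance, of a function with Lipschitz
constant of order √n. Increments over |h| = ν therefore have squared L² norm O(log(1/|h|)^{-r'})
(`LogDissipation.exists_integral_shift_le`), and integration in h gives the log-Sobolev class for
every r < r' (`memHlog_of_shift_le`).

The kernels are products of powers of cosines, so that R_n(x-y) is a finite sum of products a_j(x)
a_j(y). A mollified solution is then a finite sum of absolutely continuous functions of time times
fixed smooth functions, and the chain and product rules in time become elementary. The same
commutators, used qualitatively as in DiPerna and Lions, give the maximum principle
(`WeakSol.mono_bound`) and the energy inequality (`WeakSol.integral_sq_ge`). -/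

/-! ### Smooth functions on the torus and their partial derivatives. -/

lemma proj_add {d : ℕ} (x y : Euc d) : proj (x + y) = proj x + proj y := by
  funext i; simp [proj]

lemma proj_surjective {d : ℕ} : Function.Surjective (proj (d := d)) := by
  intro x
  choose y hy using fun i => QuotientAddGroup.mk_surjective (x i)
  exact ⟨WithLp.toLp 2 y, funext hy⟩

lemma proj_smul_single {d : ℕ} (i : Fin d) (s : ℝ) :
    proj (s • EuclideanSpace.single i (1 : ℝ)) = Pi.single i ((s : ℝ) : UnitAddCircle) := by
  funext j
  rcases eq_or_ne j i with rfl | h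
  · simp [proj]
  · simp [proj, h]

lemma continuous_proj {d : ℕ} : Continuous (proj (d := d)) := by
  refine continuous_pi fun i => ?_
  exact (AddCircle.continuous_mk' 1).comp (by fun_prop)

/-- Lets continuity descend from the periodic lift, on which smoothness is defined. -/
lemma isQuotientMap_proj {d : ℕ} : IsQuotientMap (proj (d := d)) := by
  have h1 : IsOpenQuotientMap (Pi.map fun (_ : Fin d) => fun y : ℝ => (y : UnitAddCircle)) :=
    IsOpenQuotientMap.piMap fun _ => QuotientAddGroup.isOpenQuotientMap_mk
  exact h1.isQuotientMap.comp (EuclideanSpace.equiv (Fin d) ℝ).toHomeomorph.isQuotientMap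

lemma SmoothOnTorus.continuous {d : ℕ} {φ : Torus d → ℝ} (h : SmoothOnTorus φ) :
    Continuous φ :=
  isQuotientMap_proj.continuous_iff.2 (ContDiff.continuous h)

lemma SmoothOnTorus.const {d : ℕ} (c : ℝ) : SmoothOnTorus (fun _ : Torus d => c) :=
  contDiff_const

lemma SmoothOnTorus.add {d : ℕ} {φ ψ : Torus d → ℝ} (h : SmoothOnTorus φ)
    (h' : SmoothOnTorus ψ) : SmoothOnTorus (fun x => φ x + ψ x) :=
  ContDiff.add h h'

lemma SmoothOnTorus.mul {d : ℕ} {φ ψ : Torus d → ℝ} (h : SmoothOnTorus φ)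
    (h' : SmoothOnTorus ψ) : SmoothOnTorus (fun x => φ x * ψ x) :=
  ContDiff.mul h h'

lemma SmoothOnTorus.const_mul {d : ℕ} {φ : Torus d → ℝ} (h : SmoothOnTorus φ) (c : ℝ) :
    SmoothOnTorus (fun x => c * φ x) :=
  (SmoothOnTorus.const c).mul h

lemma SmoothOnTorus.pow {d : ℕ} {φ : Torus d → ℝ} (h : SmoothOnTorus φ) (m : ℕ) :
    SmoothOnTorus (fun x => φ x ^ m) :=
  ContDiff.pow h m

lemma SmoothOnTorus.sum {d : ℕ} {ι : Type*} {s : Finset ι} {φ : ι → Torus d → ℝ}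
    (h : ∀ j ∈ s, SmoothOnTorus (φ j)) : SmoothOnTorus (fun x => ∑ j ∈ s, φ j x) :=
  ContDiff.sum h

lemma SmoothOnTorus.prod {d : ℕ} {ι : Type*} {s : Finset ι} {φ : ι → Torus d → ℝ}
    (h : ∀ j ∈ s, SmoothOnTorus (φ j)) : SmoothOnTorus (fun x => ∏ j ∈ s, φ j x) :=
  contDiff_prod h

lemma SmoothOnTorus.comp_const_sub {d : ℕ} {φ : Torus d → ℝ} (h : SmoothOnTorus φ)
    (a : Torus d) : SmoothOnTorus (fun x => φ (a - x)) := by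
  obtain ⟨y, rfl⟩ := proj_surjective a
  have h1 : ∀ x : Euc d, proj y - proj x = proj (y - x) := by
    intro x; rw [sub_eq_iff_eq_add, ← proj_add]; simp
  unfold SmoothOnTorus at *
  simp only [h1]
  exact h.comp (contDiff_const.sub contDiff_id)

lemma SmoothOnTorus.differentiable {d : ℕ} {φ : Torus d → ℝ} (h : SmoothOnTorus φ) :
    Differentiable ℝ (fun y : Euc d => φ (proj y)) :=
  ContDiff.differentiable h (by simp)

lemma SmoothOnTorus.pderiv_proj {d : ℕ} {φ : Torus d → ℝ} (h : SmoothOnTorus φ) (i : Fin d)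
    (y : Euc d) :
    pderiv i φ (proj y) =
      fderiv ℝ (fun y : Euc d => φ (proj y)) y (EuclideanSpace.single i (1 : ℝ)) := by
  have h1 : HasDerivAt (fun s : ℝ => y + s • EuclideanSpace.single i (1 : ℝ))
      (EuclideanSpace.single i (1 : ℝ)) 0 := by
    simpa using ((hasDerivAt_id (0 : ℝ)).smul_const (EuclideanSpace.single i (1 : ℝ))).const_add y
  have h2 := (h.differentiable (y + (0 : ℝ) • EuclideanSpace.single i (1 : ℝ))).hasFDerivAt
  have h3 := h2.comp_hasDerivAt (0 : ℝ) h1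
  simp only [zero_smul, add_zero] at h3
  unfold pderiv
  rw [← h3.deriv]
  congr 1
  funext s
  simp [proj_add, proj_smul_single]

lemma SmoothOnTorus.pderiv {d : ℕ} {φ : Torus d → ℝ} (h : SmoothOnTorus φ) (i : Fin d) :
    SmoothOnTorus (pderiv i φ) := by
  unfold SmoothOnTorus
  simp only [h.pderiv_proj]
  have : ContDiff ℝ ∞ (fderiv ℝ (fun y : Euc d => φ (proj y))) :=
    ContDiff.fderiv_right (m := ∞) h (by simp)
  exact this.clm_apply contDiff_const

lemma SmoothOnTorus.hasDerivAt_line {d : ℕ} {φ : Torus d → ℝ} (h : SmoothOnTorus φ)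
    (x : Torus d) (y : Euc d) (s : ℝ) :
    HasDerivAt (fun s : ℝ => φ (x + proj (s • y)))
      (∑ i, y i * AdvDiff.pderiv i φ (x + proj (s • y))) s := by
  obtain ⟨x, rfl⟩ := proj_surjective x
  have h1 : HasDerivAt (fun s : ℝ => x + s • y) y s := by
    simpa using ((hasDerivAt_id s).smul_const y).const_add x
  have h3 := (h.differentiable (x + s • y)).hasFDerivAt.comp_hasDerivAt s h1
  simp only [← proj_add]
  refine h3.congr_deriv ?_
  symm
  simp only [h.pderiv_proj]
  generalize fderiv ℝ (fun y : Euc d => φ (proj y)) (x + s • y) = l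
  conv_rhs => rw [← (EuclideanSpace.basisFun (Fin d) ℝ).sum_repr y]
  simp [map_sum]

lemma SmoothOnTorus.hasDerivAt {d : ℕ} {φ : Torus d → ℝ} (h : SmoothOnTorus φ)
    (i : Fin d) (x : Torus d) (s : ℝ) :
    HasDerivAt (fun s : ℝ => φ (x + Pi.single i (s : UnitAddCircle)))
      (AdvDiff.pderiv i φ (x + Pi.single i (s : UnitAddCircle))) s := by
  have := h.hasDerivAt_line x (EuclideanSpace.single i (1 : ℝ)) s
  simpa [proj_smul_single, Pi.single_apply] using this

lemma SmoothOnTorus.hasDerivAt_zero {d : ℕ} {φ : Torus d → ℝ} (h : SmoothOnTorus φ)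
    (i : Fin d) (x : Torus d) :
    HasDerivAt (fun s : ℝ => φ (x + Pi.single i (s : UnitAddCircle)))
      (AdvDiff.pderiv i φ x) 0 := by
  simpa using h.hasDerivAt i x 0

lemma pderiv_mul {d : ℕ} {φ ψ : Torus d → ℝ} (h : SmoothOnTorus φ) (h' : SmoothOnTorus ψ)
    (i : Fin d) (x : Torus d) :
    pderiv i (fun x => φ x * ψ x) x = pderiv i φ x * ψ x + φ x * pderiv i ψ x := by
  have := ((h.hasDerivAt_zero i x).fun_mul (h'.hasDerivAt_zero i x)).deriv
  simpa [pderiv] using this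

lemma pderiv_const_mul {d : ℕ} {φ : Torus d → ℝ} (h : SmoothOnTorus φ) (c : ℝ)
    (i : Fin d) (x : Torus d) :
    pderiv i (fun x => c * φ x) x = c * pderiv i φ x :=
  ((h.hasDerivAt_zero i x).const_mul c).deriv

lemma pderiv_sum {d : ℕ} {ι : Type*} {s : Finset ι} {φ : ι → Torus d → ℝ}
    (h : ∀ j ∈ s, SmoothOnTorus (φ j)) (i : Fin d) (x : Torus d) :
    pderiv i (fun x => ∑ j ∈ s, φ j x) x = ∑ j ∈ s, pderiv i (φ j) x :=
  (HasDerivAt.fun_sum fun j hj => (h j hj).hasDerivAt_zero i x).deriv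

lemma pderiv_pow {d : ℕ} {φ : Torus d → ℝ} (h : SmoothOnTorus φ) (m : ℕ)
    (i : Fin d) (x : Torus d) :
    pderiv i (fun x => φ x ^ m) x = m * φ x ^ (m - 1) * pderiv i φ x := by
  have := ((h.hasDerivAt_zero i x).fun_pow m).deriv
  simpa [pderiv] using this

lemma pderiv_comp_sub_const {d : ℕ} {φ : Torus d → ℝ} (a : Torus d)
    (i : Fin d) (x : Torus d) :
    pderiv i (fun x => φ (x - a)) x = pderiv i φ (x - a) := by
  simp only [pderiv]
  congr 1
  funext s
  congr 1
  abel

lemma pderiv_comp_const_sub {d : ℕ} {φ : Torus d → ℝ} (h : SmoothOnTorus φ) (a : Torus d)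
    (i : Fin d) (x : Torus d) :
    pderiv i (fun x => φ (a - x)) x = - pderiv i φ (a - x) := by
  have h1 : HasDerivAt (fun s : ℝ => -s) (-1) 0 := hasDerivAt_neg 0
  have h2 := (h.hasDerivAt i (a - x) (-0)).comp (0 : ℝ) h1
  have h3 := h2.deriv
  simp only [pderiv] at *
  rw [neg_zero] at h3
  simp only [AddCircle.coe_zero, Pi.single_zero, add_zero, mul_neg, mul_one] at h3
  rw [← h3]
  congr 1
  funext s
  simp only [Function.comp]
  congr 1
  have : (Pi.single i ((-s : ℝ) : UnitAddCircle) : Torus d) = - Pi.single i (s : UnitAddCircle) := by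
    rw [← Pi.single_neg]; simp
  rw [this]
  abel

lemma SmoothOnTorus.bounded {d : ℕ} {φ : Torus d → ℝ} (h : SmoothOnTorus φ) :
    ∃ C, 0 ≤ C ∧ ∀ x, |φ x| ≤ C := by
  obtain ⟨C, hC⟩ := isCompact_univ.exists_bound_of_continuousOn h.continuous.continuousOn
  exact ⟨C, (norm_nonneg _).trans (hC 0 trivial), fun x => hC x trivial⟩

instance : IsProbabilityMeasure (volume : Measure UnitAddCircle) := ⟨UnitAddCircle.measure_univ⟩

lemma integral_comp_add_const {d : ℕ} {E : Type*} [NormedAddCommGroup E] [NormedSpace ℝ E]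
    (f : Torus d → E) (a : Torus d) : ∫ x, f (x + a) = ∫ x, f x :=
  integral_add_right_eq_self f a

/-- By translation invariance the integral of the shifted function does not depend on the shift.
Differentiating under the integral sign at shift zero gives the claim without charts. -/
lemma SmoothOnTorus.integral_pderiv {d : ℕ} {φ : Torus d → ℝ} (h : SmoothOnTorus φ)
    (i : Fin d) : ∫ x, AdvDiff.pderiv i φ x = 0 := by
  obtain ⟨C, -, hC⟩ := (h.pderiv i).bounded
  let e : ℝ → Torus d := fun s => Pi.single i (s : UnitAddCircle)
  have hc : ∀ s : ℝ, Continuous fun x : Torus d => φ (x + e s) :=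
    fun s => h.continuous.comp (continuous_add_const _)
  have hc' : Continuous fun x : Torus d => AdvDiff.pderiv i φ (x + e 0) :=
    (h.pderiv i).continuous.comp (continuous_add_const _)
  have hd : ∀ᵐ x : Torus d, ∀ s ∈ (Set.univ : Set ℝ),
      HasDerivAt (fun s : ℝ => φ (x + e s)) (AdvDiff.pderiv i φ (x + e s)) s :=
    Filter.Eventually.of_forall fun x s _ => h.hasDerivAt i x s
  have hb : ∀ᵐ x : Torus d, ∀ s ∈ (Set.univ : Set ℝ),
      ‖AdvDiff.pderiv i φ (x + e s)‖ ≤ C :=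
    Filter.Eventually.of_forall fun x s _ => hC _
  have hi : Integrable fun x : Torus d => φ (x + e 0) :=
    (hc 0).integrable_of_hasCompactSupport (HasCompactSupport.of_compactSpace _)
  clear_value e
  have h1 := (hasDerivAt_integral_of_dominated_loc_of_deriv_le (x₀ := (0 : ℝ))
    (F := fun (s : ℝ) (x : Torus d) => φ (x + e s))
    (F' := fun (s : ℝ) (x : Torus d) => AdvDiff.pderiv i φ (x + e s))
    Filter.univ_mem (Filter.Eventually.of_forall fun s => (hc s).aestronglyMeasurable) hi
    hc'.aestronglyMeasurable hb (integrable_const C) hd).2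
  simp only [integral_comp_add_const] at h1
  exact h1.unique (hasDerivAt_const (0 : ℝ) _)

lemma SmoothOnTorus.integrable {d : ℕ} {φ : Torus d → ℝ} (h : SmoothOnTorus φ) :
    Integrable φ :=
  h.continuous.integrable_of_hasCompactSupport (HasCompactSupport.of_compactSpace _)

lemma SmoothOnTorus.integral_mul_pderiv {d : ℕ} {φ ψ : Torus d → ℝ} (h : SmoothOnTorus φ)
    (h' : SmoothOnTorus ψ) (i : Fin d) :
    ∫ x, φ x * AdvDiff.pderiv i ψ x = - ∫ x, AdvDiff.pderiv i φ x * ψ x := by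
  have h1 := (h.mul h').integral_pderiv i
  simp only [pderiv_mul h h'] at h1
  rw [integral_add ((h.pderiv i).mul h').integrable (h.mul (h'.pderiv i)).integrable] at h1
  linarith

lemma SmoothOnTorus.laplace {d : ℕ} {φ : Torus d → ℝ} (h : SmoothOnTorus φ) :
    SmoothOnTorus (laplace φ) :=
  SmoothOnTorus.sum fun i _ => (h.pderiv i).pderiv i

end AdvDiff

/-! ### Powers of cosine on the circle: Gaussian bounds and moments. -/

noncomputable section

namespace AdvDiff

/-- The trigonometric function `cos (2π s)` on the circle. -/
def circleCos : UnitAddCircle → ℝ :=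
  Function.Periodic.lift (f := fun s : ℝ => Real.cos (2 * Real.pi * s)) (by
    intro s
    simp only [mul_add, mul_one]
    exact Real.cos_add_two_pi _)

/-- The trigonometric function `sin (2π s)` on the circle. -/
def circleSin : UnitAddCircle → ℝ :=
  Function.Periodic.lift (f := fun s : ℝ => Real.sin (2 * Real.pi * s)) (by
    intro s
    simp only [mul_add, mul_one]
    exact Real.sin_add_two_pi _)

@[simp] lemma circleCos_coe (s : ℝ) : circleCos (s : UnitAddCircle) = Real.cos (2 * Real.pi * s) :=
  rfl

@[simp] lemma circleSin_coe (s : ℝ) : circleSin (s : UnitAddCircle) = Real.sin (2 * Real.pi * s) :=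
  rfl

lemma circleCos_sub (x y : UnitAddCircle) :
    circleCos (x - y) = circleCos x * circleCos y + circleSin x * circleSin y := by
  obtain ⟨x, rfl⟩ := QuotientAddGroup.mk_surjective x
  obtain ⟨y, rfl⟩ := QuotientAddGroup.mk_surjective y
  change Real.cos (2 * Real.pi * (x - y)) = Real.cos (2 * Real.pi * x) * Real.cos (2 * Real.pi * y)
    + Real.sin (2 * Real.pi * x) * Real.sin (2 * Real.pi * y)
  rw [mul_sub, Real.cos_sub]

lemma circleCos_neg (x : UnitAddCircle) : circleCos (-x) = circleCos x := by
  obtain ⟨x, rfl⟩ := QuotientAddGroup.mk_surjective x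
  change Real.cos (2 * Real.pi * (-x)) = Real.cos (2 * Real.pi * x)
  rw [mul_neg, Real.cos_neg]

lemma continuous_circleCos : Continuous circleCos :=
  QuotientAddGroup.isOpenQuotientMap_mk.isQuotientMap.continuous_iff.2
    (show Continuous fun s : ℝ => Real.cos (2 * Real.pi * s) by fun_prop)

lemma continuous_circleSin : Continuous circleSin :=
  QuotientAddGroup.isOpenQuotientMap_mk.isQuotientMap.continuous_iff.2
    (show Continuous fun s : ℝ => Real.sin (2 * Real.pi * s) by fun_prop)

/-- The kernel `cos (π s) ^ (2 n)` on the circle. -/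
def cosPow (n : ℕ) (x : UnitAddCircle) : ℝ := ((1 + circleCos x) / 2) ^ n

/-- The derivative of `cosPow n`. -/
def cosPowDeriv (n : ℕ) (x : UnitAddCircle) : ℝ :=
  n * ((1 + circleCos x) / 2) ^ (n - 1) * (-Real.pi * circleSin x)

lemma continuous_cosPow (n : ℕ) : Continuous (cosPow n) := by
  have := continuous_circleCos
  unfold cosPow; fun_prop

lemma continuous_cosPowDeriv (n : ℕ) : Continuous (cosPowDeriv n) := by
  have := continuous_circleCos
  have := continuous_circleSin
  unfold cosPowDeriv; fun_prop

lemma half_one_add_cos (s : ℝ) : (1 + Real.cos (2 * Real.pi * s)) / 2 = Real.cos (Real.pi * s) ^ 2 := by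
  rw [Real.cos_sq, ← mul_assoc]; ring

lemma half_one_add_circleCos_nonneg (x : UnitAddCircle) : 0 ≤ (1 + circleCos x) / 2 := by
  obtain ⟨s, rfl⟩ := QuotientAddGroup.mk_surjective x
  change 0 ≤ (1 + Real.cos (2 * Real.pi * s)) / 2
  rw [half_one_add_cos]; positivity

lemma cosPow_nonneg (n : ℕ) (x : UnitAddCircle) : 0 ≤ cosPow n x :=
  pow_nonneg (half_one_add_circleCos_nonneg x) n

/-- Jordan's inequality gives sin²(πs) ≥ 4s² on a period, and 1 - x ≤ exp(-x) then compares with a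
Gaussian. The n-th power has width 1/√n. -/
lemma cos_pi_mul_sq_le {s : ℝ} (hs : |s| ≤ 1 / 2) :
    Real.cos (Real.pi * s) ^ 2 ≤ Real.exp (-(4 * s ^ 2)) := by
  have h1 : 2 * |s| ≤ Real.sin (Real.pi * |s|) := by
    have := Real.mul_le_sin (x := Real.pi * |s|) (by positivity) (by nlinarith [Real.pi_pos])
    calc 2 * |s| = 2 / Real.pi * (Real.pi * |s|) := by field_simp
      _ ≤ _ := this
  have h2 : Real.sin (Real.pi * |s|) ^ 2 = Real.sin (Real.pi * s) ^ 2 := by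
    rcases abs_choice s with h | h <;> rw [h]
    rw [mul_neg, Real.sin_neg, neg_sq]
  have h3 : (2 * |s|) ^ 2 ≤ Real.sin (Real.pi * |s|) ^ 2 := pow_le_pow_left₀ (by positivity) h1 2
  rw [h2, mul_pow, sq_abs] at h3
  have h4 := Real.add_one_le_exp (-(4 * s ^ 2))
  have h5 := Real.sin_sq_add_cos_sq (Real.pi * s)
  linarith

lemma pow_mul_one_add_sq_le_exp {y : ℝ} (hy : 0 ≤ y) {a : ℕ} (ha : a ≤ 4) :
    y ^ a * (1 + y ^ 2) ≤ Real.exp (4 * y ^ 2) := by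
  have h1 : y ^ a ≤ (1 + y ^ 2) ^ 2 := by
    rcases le_total y 1 with h | h
    · exact (pow_le_one₀ hy h).trans (one_le_pow₀ (by nlinarith [sq_nonneg y]))
    · calc y ^ a ≤ y ^ 4 := pow_le_pow_right₀ h ha
        _ = (y ^ 2) ^ 2 := by ring
        _ ≤ _ := pow_le_pow_left₀ (by positivity) (by linarith) 2
  calc y ^ a * (1 + y ^ 2) ≤ (1 + y ^ 2) ^ 2 * (1 + y ^ 2) := by gcongr
    _ = (1 + y ^ 2) ^ 3 := by ring
    _ ≤ (1 + y ^ 2) ^ 4 := pow_le_pow_right₀ (by nlinarith [sq_nonneg y]) (by norm_num)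
    _ ≤ (Real.exp (y ^ 2)) ^ 4 := by
      gcongr
      linarith [Real.add_one_le_exp (y ^ 2)]
    _ = Real.exp (4 * y ^ 2) := by rw [← Real.exp_nat_mul]; norm_num

/-- Trades every Gaussian moment for one Cauchy weight, whose integral is explicit. The range up to
4 covers third moments of the derivative, which carries an additional factor |s|. -/
lemma pow_mul_exp_neg_le {n : ℝ} (hn : 0 ≤ n) (s : ℝ) {a : ℕ} (ha : a ≤ 4) :
    (√n * |s|) ^ a * Real.exp (-(4 * n * s ^ 2)) ≤ (1 + (√n * s) ^ 2)⁻¹ := by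
  have h1 := pow_mul_one_add_sq_le_exp (y := √n * |s|) (by positivity) ha
  have h2 : (√n * |s|) ^ 2 = n * s ^ 2 := by rw [mul_pow, Real.sq_sqrt hn, sq_abs]
  have h3 : (√n * s) ^ 2 = n * s ^ 2 := by rw [mul_pow, Real.sq_sqrt hn]
  have h4 : 0 < 1 + n * s ^ 2 := by positivity
  rw [h2] at h1
  rw [h3, Real.exp_neg, ← div_eq_mul_inv, div_le_iff₀ (Real.exp_pos _), inv_mul_eq_div,
    le_div_iff₀ h4]
  rwa [← mul_assoc] at h1

lemma cosPow_le {n : ℕ} {s : ℝ} (hs : |s| ≤ 1 / 2) :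
    cosPow n (s : UnitAddCircle) ≤ Real.exp (-(4 * n * s ^ 2)) := by
  unfold cosPow
  rw [circleCos_coe, half_one_add_cos]
  calc (Real.cos (Real.pi * s) ^ 2) ^ n ≤ (Real.exp (-(4 * s ^ 2))) ^ n :=
        pow_le_pow_left₀ (by positivity) (cos_pi_mul_sq_le hs) n
    _ = _ := by rw [← Real.exp_nat_mul]; congr 1; ring

lemma abs_cosPowDeriv_le {n : ℕ} (hn : 1 ≤ n) {s : ℝ} (hs : |s| ≤ 1 / 2) :
    |cosPowDeriv n (s : UnitAddCircle)| ≤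
      60 * n * |s| * Real.exp (-(4 * n * s ^ 2)) := by
  have h1 := cosPow_le (n := n - 1) hs
  have h0 := cosPow_nonneg (n - 1) (s : UnitAddCircle)
  -- Differentiation lowers the power by one; restoring the exponent n costs exp(4s²) ≤ e ≤ 3.
  -- Together with 2π² ≤ 20 this produces the constant 60.
  have h2 : Real.exp (-(4 * (n - 1 : ℕ) * s ^ 2)) ≤ 3 * Real.exp (-(4 * n * s ^ 2)) := by
    have : -(4 * ((n - 1 : ℕ) : ℝ) * s ^ 2) = 4 * s ^ 2 + -(4 * n * s ^ 2) := by
      push_cast [hn]; ring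
    rw [this, Real.exp_add]
    gcongr
    calc Real.exp (4 * s ^ 2) ≤ Real.exp 1 := by
          gcongr
          have : s ^ 2 ≤ (1 / 2) ^ 2 := by rw [← sq_abs]; gcongr
          linarith
      _ ≤ 3 := by linarith [Real.exp_one_lt_d9]
  have h3 : |Real.sin (2 * Real.pi * s)| ≤ 2 * Real.pi * |s| := by
    calc _ ≤ |2 * Real.pi * s| := Real.abs_sin_le_abs
      _ = _ := by rw [abs_mul, abs_of_pos (by positivity)]
  have hpi : Real.pi ^ 2 ≤ 10 := by nlinarith [Real.pi_lt_d2, Real.pi_pos]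
  change |(n : ℝ) * cosPow (n - 1) (s : UnitAddCircle) * (-Real.pi * circleSin s)| ≤ _
  rw [abs_mul, abs_mul, abs_of_nonneg h0, abs_mul, abs_neg, abs_of_pos Real.pi_pos,
    circleSin_coe, Nat.abs_cast]
  calc (n : ℝ) * cosPow (n - 1) (s : UnitAddCircle) * (Real.pi * |Real.sin (2 * Real.pi * s)|)
      ≤ n * (3 * Real.exp (-(4 * n * s ^ 2))) * (Real.pi * (2 * Real.pi * |s|)) := by
        have := Real.pi_pos
        gcongr
        exact h1.trans h2
    _ = (6 * Real.pi ^ 2) * (n * |s| * Real.exp (-(4 * n * s ^ 2))) := by ring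
    _ ≤ 60 * (n * |s| * Real.exp (-(4 * n * s ^ 2))) := by gcongr; linarith
    _ = _ := by ring

lemma norm_coe_circle {s : ℝ} (hs : |s| ≤ 1 / 2) : ‖(s : UnitAddCircle)‖ = |s| :=
  (AddCircle.norm_coe_eq_abs_iff (p := (1 : ℝ)) (by norm_num)).2 (by simpa using hs)

lemma integral_circle_eq (f : UnitAddCircle → ℝ) :
    ∫ x, f x = ∫ s in (-(1 / 2) : ℝ)..(1 / 2), f s := by
  rw [← UnitAddCircle.intervalIntegral_preimage (-(1 / 2)) f]
  norm_num

lemma integral_le_of_le_cauchy {n : ℕ} (hn : 1 ≤ n) {c : ℝ} (hc : 0 ≤ c) {f : UnitAddCircle → ℝ}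
    (hf : Continuous f)
    (h : ∀ s : ℝ, |s| ≤ 1 / 2 → f s ≤ c * (1 + (√n * s) ^ 2)⁻¹) :
    ∫ x, f x ≤ c * (Real.pi / √n) := by
  have hn' : (0 : ℝ) < √n := Real.sqrt_pos.2 (by exact_mod_cast hn)
  have hint : Integrable fun s : ℝ => (1 + (√n * s) ^ 2)⁻¹ :=
    integrable_inv_one_add_sq.comp_mul_left' hn'.ne'
  have htot : ∫ s : ℝ, (1 + (√n * s) ^ 2)⁻¹ = Real.pi / √n := by
    rw [Measure.integral_comp_mul_left (fun s : ℝ => (1 + s ^ 2)⁻¹), integral_univ_inv_one_add_sq,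
      abs_of_pos (inv_pos.2 hn'), smul_eq_mul, inv_mul_eq_div]
  rw [integral_circle_eq, ← htot, ← integral_const_mul]
  calc ∫ s in (-(1 / 2) : ℝ)..(1 / 2), f s
      ≤ ∫ s in (-(1 / 2) : ℝ)..(1 / 2), c * (1 + (√n * s) ^ 2)⁻¹ := by
        refine intervalIntegral.integral_mono_on (by norm_num) ?_ ?_ fun s hs => h s ?_
        · exact (hf.comp (AddCircle.continuous_mk' 1)).intervalIntegrable _ _
        · exact (hint.const_mul c).intervalIntegrable
        · rw [abs_le]; exact ⟨hs.1, hs.2⟩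
    _ ≤ _ := by
        rw [intervalIntegral.integral_of_le (by norm_num)]
        exact setIntegral_le_integral (hint.const_mul c)
          (Eventually.of_forall fun s => by positivity)

lemma cosPow_moment {n : ℕ} (hn : 1 ≤ n) {a : ℕ} (ha : a ≤ 4) :
    ∫ x, (√n * ‖x‖) ^ a * cosPow n x ≤ 1 * (Real.pi / √n) := by
  have := continuous_cosPow n
  refine integral_le_of_le_cauchy hn zero_le_one (by fun_prop) fun s hs => ?_
  rw [norm_coe_circle hs, one_mul]
  refine le_trans ?_ (pow_mul_exp_neg_le (n := n) (by positivity) s ha)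
  gcongr
  exact cosPow_le hs

lemma cosPowDeriv_moment {n : ℕ} (hn : 1 ≤ n) {a : ℕ} (ha : a ≤ 3) :
    ∫ x, (√n * ‖x‖) ^ a * |cosPowDeriv n x| ≤ (60 * √n) * (Real.pi / √n) := by
  have := continuous_cosPowDeriv n
  refine integral_le_of_le_cauchy hn (by positivity) (by fun_prop) fun s hs => ?_
  rw [norm_coe_circle hs]
  have h1 := pow_mul_exp_neg_le (n := n) (by positivity) s (a := a + 1) (by omega)
  calc (√n * |s|) ^ a * |cosPowDeriv n s|
      ≤ (√n * |s|) ^ a * (60 * n * |s| * Real.exp (-(4 * n * s ^ 2))) := by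
        gcongr; exact abs_cosPowDeriv_le hn hs
    _ = (60 * √n) * ((√n * |s|) ^ (a + 1) * Real.exp (-(4 * n * s ^ 2))) := by
        have h2 : (n : ℝ) = √n * √n := (Real.mul_self_sqrt (Nat.cast_nonneg (α := ℝ) n)).symm
        generalize Real.exp (-(4 * n * s ^ 2)) = e
        generalize √(n : ℝ) = r at h2
        rw [h2]
        ring
    _ ≤ _ := by gcongr

lemma cosPow_integral_ge {n : ℕ} (hn : 1 ≤ n) : 1 / (6 * √n) ≤ ∫ x, cosPow n x := by
  have hn1 : (1 : ℝ) ≤ n := by exact_mod_cast hn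
  have hn' : (1 : ℝ) ≤ √n := Real.one_le_sqrt.2 hn1
  -- On |s| ≤ δ Bernoulli's inequality gives at least 1 - 10 n δ² = 3/8. The interval has length
  -- 1/(2√n), so the integral is at least 3/(16√n).
  set δ : ℝ := 1 / (4 * √n) with hδ
  have hδ0 : 0 < δ := by positivity
  have hδ1 : δ ≤ 1 / 2 := by
    rw [hδ, div_le_div_iff₀ (by positivity) (by norm_num)]; linarith
  have hδ2 : n * δ ^ 2 = 1 / 16 := by
    rw [hδ, div_pow, mul_pow, Real.sq_sqrt (by positivity)]; field_simp; norm_num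
  have hcont : Continuous fun s : ℝ => cosPow n (s : UnitAddCircle) :=
    (continuous_cosPow n).comp (AddCircle.continuous_mk' 1)
  rw [integral_circle_eq]
  calc 1 / (6 * √n) ≤ ∫ s in (-δ)..δ, (3 / 8 : ℝ) := by
        rw [intervalIntegral.integral_const, hδ, smul_eq_mul]
        rw [show 1 / (6 * √n) = (1 / 6) * (1 / √n) by field_simp,
          show (1 / (4 * √n) - -(1 / (4 * √n))) * (3 / 8) = (3 / 16) * (1 / √n) by field_simp; ring]
        exact mul_le_mul_of_nonneg_right (by norm_num) (by positivity)
    _ ≤ ∫ s in (-δ)..δ, cosPow n (s : UnitAddCircle) := by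
        refine intervalIntegral.integral_mono_on (by linarith) (by simp)
          (hcont.intervalIntegrable _ _) fun s hs => ?_
        unfold cosPow
        rw [circleCos_coe, half_one_add_cos]
        have hs2 : s ^ 2 ≤ δ ^ 2 := sq_le_sq' hs.1 hs.2
        have hpi : Real.pi ^ 2 ≤ 10 := by nlinarith [Real.pi_lt_d2, Real.pi_pos]
        have h1 : 1 - 10 * s ^ 2 ≤ Real.cos (Real.pi * s) ^ 2 := by
          have h2 : Real.sin (Real.pi * s) ^ 2 ≤ (Real.pi * s) ^ 2 :=
            sq_le_sq.2 Real.abs_sin_le_abs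
          have h3 := Real.sin_sq_add_cos_sq (Real.pi * s)
          nlinarith [sq_nonneg s]
        have h4 : (0 : ℝ) ≤ 1 - 10 * s ^ 2 := by nlinarith
        calc (3 / 8 : ℝ) ≤ 1 + n * (-(10 * s ^ 2)) := by nlinarith
          _ ≤ (1 + -(10 * s ^ 2)) ^ n := one_add_mul_le_pow (by linarith) n
          _ ≤ _ := by
            rw [← sub_eq_add_neg]
            exact pow_le_pow_left₀ h4 h1 n
    _ ≤ _ := by
        refine intervalIntegral.integral_mono_interval (by linarith) (by linarith) hδ1
          (Eventually.of_forall fun s => cosPow_nonneg n _) (hcont.intervalIntegrable _ _)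

end AdvDiff

end

/-! ### Finite-rank product kernels on the torus. -/

noncomputable section

namespace AdvDiff

/-- A function `R` such that `R (x - y)` is a finite sum of squares `a_j x * a_j y` of smooth
functions. -/
def FiniteRank {d : ℕ} (R : Torus d → ℝ) : Prop :=
  ∃ (ι : Type) (_ : Fintype ι) (a : ι → Torus d → ℝ), (∀ j, SmoothOnTorus (a j)) ∧
    ∀ x y, R (x - y) = ∑ j, a j x * a j y

lemma FiniteRank.const {d : ℕ} {c : ℝ} (hc : 0 ≤ c) : FiniteRank (fun _ : Torus d => c) :=
  ⟨Unit, inferInstance, fun _ _ => √c, fun _ => SmoothOnTorus.const _, fun x y => by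
    simp [Real.mul_self_sqrt hc]⟩

lemma FiniteRank.mul {d : ℕ} {R S : Torus d → ℝ} (hR : FiniteRank R) (hS : FiniteRank S) :
    FiniteRank (fun x => R x * S x) := by
  obtain ⟨ι, _, a, ha, ha'⟩ := hR
  obtain ⟨κ, _, c, hc, hc'⟩ := hS
  refine ⟨ι × κ, inferInstance, fun j x => a j.1 x * c j.2 x, fun j => (ha _).mul (hc _),
    fun x y => ?_⟩
  simp only [ha', hc']
  rw [Finset.sum_mul_sum, ← Finset.univ_product_univ, Finset.sum_product]
  refine Finset.sum_congr rfl fun j _ => Finset.sum_congr rfl fun k _ => by ring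

lemma FiniteRank.pow {d : ℕ} {R : Torus d → ℝ} (hR : FiniteRank R) (n : ℕ) :
    FiniteRank (fun x => R x ^ n) := by
  induction n with
  | zero => simpa using FiniteRank.const (d := d) zero_le_one
  | succ n ih => simpa only [pow_succ] using ih.mul hR

lemma FiniteRank.prod {d : ℕ} {κ : Type*} {s : Finset κ} {R : κ → Torus d → ℝ}
    (hR : ∀ k, FiniteRank (R k)) : FiniteRank (fun x => ∏ k ∈ s, R k x) := by
  classical
  induction s using Finset.induction_on with
  | empty => simpa using FiniteRank.const (d := d) zero_le_one
  | insert k s hk ih =>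
    simp only [Finset.prod_insert hk]
    exact (hR k).mul ih

lemma smooth_circleCos {d : ℕ} (i : Fin d) : SmoothOnTorus (fun z : Torus d => circleCos (z i)) :=
  show ContDiff ℝ ∞ fun y : Euc d => Real.cos (2 * Real.pi * y i) by fun_prop

lemma smooth_circleSin {d : ℕ} (i : Fin d) : SmoothOnTorus (fun z : Torus d => circleSin (z i)) :=
  show ContDiff ℝ ∞ fun y : Euc d => Real.sin (2 * Real.pi * y i) by fun_prop

/-- The addition theorem with positive coefficients, as a sum of squares of 1, cos and sin. This is
the reason for choosing powers of cosine: finite rank with positive sign survives products, hence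
holds for the whole kernel. -/
lemma finiteRank_circleCos {d : ℕ} (i : Fin d) :
    FiniteRank (fun z : Torus d => (1 + circleCos (z i)) / 2) := by
  refine ⟨Fin 3, inferInstance, fun j z => √(1 / 2) * ![1, circleCos (z i), circleSin (z i)] j,
    fun j => ?_, fun x y => ?_⟩
  · fin_cases j
    · exact (SmoothOnTorus.const _).const_mul _
    · exact (smooth_circleCos i).const_mul _
    · exact (smooth_circleSin i).const_mul _
  · have h : √(1 / 2) * √(1 / 2) = (1 / 2 : ℝ) := Real.mul_self_sqrt (by norm_num)
    simp only [Fin.sum_univ_three, Matrix.cons_val_zero, Matrix.cons_val_one, Matrix.cons_val_two,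
      Matrix.head_cons, Matrix.tail_cons, Pi.sub_apply, circleCos_sub]
    linear_combination (-(1 + circleCos (x i) * circleCos (y i)
      + circleSin (x i) * circleSin (y i))) * h

/-- The normalized kernel on the circle. -/
def circleKernel (n : ℕ) (x : UnitAddCircle) : ℝ := cosPow n x / ∫ y, cosPow n y

/-- The derivative of `circleKernel n`. -/
def circleKernelDeriv (n : ℕ) (x : UnitAddCircle) : ℝ := cosPowDeriv n x / ∫ y, cosPow n y

/-- The product kernel on the torus. -/
def torusKernel {d : ℕ} (n : ℕ) (z : Torus d) : ℝ := ∏ i, circleKernel n (z i)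

lemma hasDerivAt_cosPow (n : ℕ) (x : UnitAddCircle) :
    HasDerivAt (fun s : ℝ => cosPow n (x + s)) (cosPowDeriv n x) 0 := by
  obtain ⟨y, rfl⟩ := QuotientAddGroup.mk_surjective x
  have h0 : HasDerivAt (fun s : ℝ => 2 * Real.pi * (y + s)) (2 * Real.pi) 0 := by
    simpa using ((hasDerivAt_id (0 : ℝ)).const_add y).const_mul (2 * Real.pi)
  have h1 := ((h0.cos.const_add 1).div_const 2).fun_pow n
  simp only [add_zero] at h1
  refine h1.congr_deriv ?_
  change _ = (n : ℝ) * ((1 + Real.cos (2 * Real.pi * y)) / 2) ^ (n - 1) *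
    (-Real.pi * Real.sin (2 * Real.pi * y))
  ring

lemma pderiv_torusKernel {d : ℕ} (n : ℕ) (i : Fin d) (z : Torus d) :
    pderiv i (torusKernel n) z =
      ∏ j, if j = i then circleKernelDeriv n (z j) else circleKernel n (z j) := by
  have h1 : ∀ s : ℝ, torusKernel n (z + Pi.single i (s : UnitAddCircle)) =
      circleKernel n (z i + s) * ∏ j ∈ Finset.univ.erase i, circleKernel n (z j) := by
    intro s
    rw [torusKernel, ← Finset.mul_prod_erase _ _ (Finset.mem_univ i)]
    congr 1
    · simp
    · refine Finset.prod_congr rfl fun j hj => ?_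
      rw [Pi.add_apply, Pi.single_eq_of_ne (Finset.ne_of_mem_erase hj), add_zero]
  have h2 := (((hasDerivAt_cosPow n (z i)).div_const (∫ y, cosPow n y)).mul_const
    (∏ j ∈ Finset.univ.erase i, circleKernel n (z j))).deriv
  simp only [pderiv, h1]
  refine h2.trans ?_
  rw [← Finset.mul_prod_erase _ _ (Finset.mem_univ i)]
  congr 1
  · simp [circleKernelDeriv]
  · refine Finset.prod_congr rfl fun j hj => ?_
    rw [if_neg (Finset.ne_of_mem_erase hj)]

lemma smooth_torusKernel {d : ℕ} (n : ℕ) : SmoothOnTorus (torusKernel (d := d) n) := by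
  have h : ∀ i, SmoothOnTorus fun z : Torus d => circleKernel n (z i) := by
    intro i
    have h1 := (((SmoothOnTorus.const (d := d) 1).add (smooth_circleCos i)).const_mul
      (1 / 2)).pow n |>.const_mul (∫ y, cosPow n y)⁻¹
    convert h1 using 2 with z
    simp only [circleKernel, cosPow]
    rw [div_eq_inv_mul]
    congr 2
    ring
  exact SmoothOnTorus.prod fun i _ => h i

lemma circleKernel_nonneg (n : ℕ) (x : UnitAddCircle) : 0 ≤ circleKernel n x :=
  div_nonneg (cosPow_nonneg n x) (integral_nonneg (cosPow_nonneg n))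

lemma continuous_circleKernel (n : ℕ) : Continuous (circleKernel n) :=
  (continuous_cosPow n).div_const _

lemma continuous_circleKernelDeriv (n : ℕ) : Continuous (circleKernelDeriv n) :=
  (continuous_cosPowDeriv n).div_const _

lemma cosPow_integral_pos {n : ℕ} (hn : 1 ≤ n) : 0 < ∫ x, cosPow n x := by
  have : (0 : ℝ) < √n := Real.sqrt_pos.2 (by exact_mod_cast hn)
  exact lt_of_lt_of_le (by positivity) (cosPow_integral_ge hn)

lemma inv_cosPow_integral_le {n : ℕ} (hn : 1 ≤ n) : (∫ x, cosPow n x)⁻¹ ≤ 6 * √n := by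
  have : (0 : ℝ) < √n := Real.sqrt_pos.2 (by exact_mod_cast hn)
  have h := inv_anti₀ (by positivity) (cosPow_integral_ge hn)
  simpa using h

lemma integral_circleKernel {n : ℕ} (hn : 1 ≤ n) : ∫ x, circleKernel n x = 1 := by
  simp only [circleKernel]
  rw [integral_div, div_self (cosPow_integral_pos hn).ne']

lemma circleKernel_moment {n : ℕ} (hn : 1 ≤ n) {a : ℕ} (ha : a ≤ 3) :
    ∫ x, (√n * ‖x‖) ^ a * circleKernel n x ≤ 24 := by
  have h0 : (0 : ℝ) < √n := Real.sqrt_pos.2 (by exact_mod_cast hn)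
  simp only [circleKernel, ← mul_div_assoc]
  rw [integral_div, div_eq_mul_inv]
  calc _ ≤ (1 * (Real.pi / √n)) * (6 * √n) :=
        mul_le_mul (cosPow_moment hn (by omega)) (inv_cosPow_integral_le hn)
          (inv_nonneg.2 (cosPow_integral_pos hn).le) (by positivity)
    _ = 6 * Real.pi := by field_simp
    _ ≤ 24 := by linarith [Real.pi_le_four]

lemma circleKernelDeriv_moment {n : ℕ} (hn : 1 ≤ n) {a : ℕ} (ha : a ≤ 3) :
    ∫ x, (√n * ‖x‖) ^ a * |circleKernelDeriv n x| ≤ 1440 * √n := by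
  have h0 : (0 : ℝ) < √n := Real.sqrt_pos.2 (by exact_mod_cast hn)
  simp only [circleKernelDeriv, abs_div, abs_of_pos (cosPow_integral_pos hn), ← mul_div_assoc]
  rw [integral_div, div_eq_mul_inv]
  calc _ ≤ ((60 * √n) * (Real.pi / √n)) * (6 * √n) :=
        mul_le_mul (cosPowDeriv_moment hn ha) (inv_cosPow_integral_le hn)
          (inv_nonneg.2 (cosPow_integral_pos hn).le) (by positivity)
    _ = 360 * √n * Real.pi := by field_simp; norm_num
    _ ≤ 360 * √n * 4 := by gcongr; exact Real.pi_le_four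
    _ = _ := by ring

/-- The properties of the approximate identities at scale `1 / √n` that are used below. -/
structure IsKernel {d : ℕ} (n : ℕ) (K : ℝ) (R : Torus d → ℝ) : Prop where
  smooth : SmoothOnTorus R
  nonneg : ∀ z, 0 ≤ R z
  integral_eq_one : ∫ z, R z = 1
  even : ∀ z, R (-z) = R z
  finiteRank : FiniteRank R
  moment : ∀ a : ℕ, a ≤ 3 → ∫ z, (√n * ‖z‖) ^ a * R z ≤ K
  pderiv_moment : ∀ i, ∀ a : ℕ, a ≤ 3 → ∫ z, (√n * ‖z‖) ^ a * |pderiv i R z| ≤ K * √n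

lemma norm_pow_le_sum {d : ℕ} (hd : 0 < d) (c : ℝ) (hc : 0 ≤ c) (z : Torus d) (a : ℕ) :
    (c * ‖z‖) ^ a ≤ ∑ l, (c * ‖z l‖) ^ a := by
  have : Nonempty (Fin d) := ⟨⟨0, hd⟩⟩
  obtain ⟨l, hl⟩ : ∃ l, ‖z‖ = ‖z l‖ := by
    obtain ⟨l, -, hl⟩ := Finset.exists_max_image Finset.univ (fun l => ‖z l‖)
      Finset.univ_nonempty
    exact ⟨l, le_antisymm ((pi_norm_le_iff_of_nonneg (norm_nonneg _)).2 fun j =>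
      hl j (Finset.mem_univ j)) (norm_le_pi_norm z l)⟩
  rw [hl]
  exact Finset.single_le_sum (f := fun l => (c * ‖z l‖) ^ a)
    (fun l _ => by positivity) (Finset.mem_univ l)

/-- The torus carries the sup norm, so a moment in ‖z‖ is at most the sum of the moments in the
coordinates, and each of these factors over the product structure. -/
lemma moment_le_of_coord {d : ℕ} (hd : 0 < d) {c C : ℝ} (hc : 0 ≤ c) {F : Torus d → ℝ}
    (hF : Continuous F) (hF0 : ∀ z, 0 ≤ F z) {a : ℕ}
    (h : ∀ l, ∫ z, (c * ‖z l‖) ^ a * F z ≤ C) : ∫ z, (c * ‖z‖) ^ a * F z ≤ d * C := by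
  have hint : ∀ G : Torus d → ℝ, Continuous G → Integrable G := fun G hG =>
    hG.integrable_of_hasCompactSupport (HasCompactSupport.of_compactSpace _)
  calc ∫ z, (c * ‖z‖) ^ a * F z ≤ ∫ z, ∑ l, (c * ‖z l‖) ^ a * F z := by
        refine integral_mono (hint _ (by fun_prop)) (hint _ (by fun_prop)) fun z => ?_
        simp only [← Finset.sum_mul]
        exact mul_le_mul_of_nonneg_right (norm_pow_le_sum hd c hc z a) (hF0 z)
    _ = ∑ l, ∫ z, (c * ‖z l‖) ^ a * F z :=
        integral_finsetSum _ fun l _ => hint _ (by fun_prop)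
    _ ≤ ∑ _l : Fin d, C := Finset.sum_le_sum fun l _ => h l
    _ = d * C := by simp

/-- The indices l and i mark the factor carrying the moment weight and the factor that is
differentiated. They may coincide, so the two exceptional bounds are multiplied independently. -/
lemma integral_prod_le {d : ℕ} {g : Fin d → UnitAddCircle → ℝ} {C D : ℝ} (hg : ∀ j x, 0 ≤ g j x)
    (l i : Fin d) (h : ∀ j, ∫ x, g j x ≤ (if j = l then C else 1) * (if j = i then D else 1)) :
    ∫ z : Torus d, ∏ j, g j (z j) ≤ C * D := by
  rw [integral_fintype_prod_volume_eq_prod]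
  calc ∏ j, ∫ x, g j x ≤ ∏ j, (if j = l then C else 1) * (if j = i then D else 1) :=
        Finset.prod_le_prod (fun j _ => integral_nonneg (hg j)) fun j _ => h j
    _ = C * D := by rw [Finset.prod_mul_distrib]; simp

theorem isKernel_torusKernel {d : ℕ} (hd : 0 < d) {n : ℕ} (hn : 1 ≤ n) :
    IsKernel n (d * (24 * 1440)) (torusKernel (d := d) n) := by
  have h0 : (1 : ℝ) ≤ √n := Real.one_le_sqrt.2 (by exact_mod_cast hn)
  have hk := continuous_circleKernel n
  have hk' := continuous_circleKernelDeriv n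
  have hnn : ∀ z : Torus d, 0 ≤ torusKernel n z := fun z =>
    Finset.prod_nonneg fun i _ => circleKernel_nonneg n _
  have hm0 : ∫ x, |circleKernelDeriv n x| ≤ 1440 * √n := by
    simpa using circleKernelDeriv_moment hn (a := 0) (by norm_num)
  refine ⟨smooth_torusKernel n, hnn, ?_, fun z => ?_, ?_, fun a ha => ?_, fun i a ha => ?_⟩
  · simp only [torusKernel]
    rw [integral_fintype_prod_volume_eq_prod]
    simp [integral_circleKernel hn]
  · simp [torusKernel, circleKernel, cosPow, circleCos_neg]
  · have h1 : FiniteRank fun z : Torus d => (∏ i, ((1 + circleCos (z i)) / 2) ^ n) *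
        ((∫ y, cosPow n y)⁻¹ ^ d) :=
      (FiniteRank.prod fun i => (finiteRank_circleCos i).pow n).mul
        (FiniteRank.const (pow_nonneg (inv_nonneg.2 (cosPow_integral_pos hn).le) d))
    convert h1 using 2 with z
    simp [torusKernel, circleKernel, cosPow, div_eq_mul_inv, Finset.prod_mul_distrib]
  · refine moment_le_of_coord hd (by positivity) (smooth_torusKernel n).continuous hnn
      fun l => ?_
    have heq : ∀ z : Torus d, (√n * ‖z l‖) ^ a * torusKernel n z =
        ∏ j, (if j = l then (√n * ‖z j‖) ^ a else 1) * circleKernel n (z j) := by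
      intro z
      rw [Finset.prod_mul_distrib, torusKernel]
      simp
    simp only [heq]
    refine integral_prod_le (g := fun j x => (if j = l then (√n * ‖x‖) ^ a else 1) *
      circleKernel n x) (fun j x => ?_) l l fun j => ?_
    · have := circleKernel_nonneg n x
      split_ifs <;> positivity
    · split_ifs with h
      · linarith [circleKernel_moment hn ha]
      · simp [integral_circleKernel hn]
  · have h1 := (smooth_torusKernel (d := d) n).pderiv i
    rw [mul_assoc]
    refine moment_le_of_coord hd (by positivity) h1.continuous.abs (fun z => abs_nonneg _)
      fun l => ?_
    have heq : ∀ z : Torus d, (√n * ‖z l‖) ^ a * |pderiv i (torusKernel n) z| =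
        ∏ j, (if j = l then (√n * ‖z j‖) ^ a else 1) *
          (if j = i then |circleKernelDeriv n (z j)| else circleKernel n (z j)) := by
      intro z
      rw [Finset.prod_mul_distrib, pderiv_torusKernel, Finset.abs_prod]
      congr 1
      · simp
      · refine Finset.prod_congr rfl fun j _ => ?_
        split_ifs
        · rfl
        · exact abs_of_nonneg (circleKernel_nonneg n _)
    simp only [heq]
    refine (integral_prod_le (C := 24) (D := 1440 * √n)
      (g := fun j x => (if j = l then (√n * ‖x‖) ^ a else 1) *
      (if j = i then |circleKernelDeriv n x| else circleKernel n x)) (fun j x => ?_) l i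
      fun j => ?_).trans (by linarith)
    · have := circleKernel_nonneg n x
      split_ifs <;> positivity
    · by_cases h : j = l <;> by_cases h' : j = i <;> simp only [h, h', if_true, if_false, one_mul, mul_one]
      · by_cases h2 : l = i <;> simp only [h2, if_true, if_false, mul_one]
        · linarith [circleKernelDeriv_moment hn ha]
        · linarith [circleKernel_moment hn ha]
      · have h2 : l ≠ i := h ▸ h'
        simp only [h2, if_false, mul_one]
        exact circleKernel_moment hn ha
      · have h2 : i ≠ l := h' ▸ h
        simp only [h2, if_false, one_mul]
        exact hm0
      · exact (integral_circleKernel hn).le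

end AdvDiff

end

/-! ### Convolution with approximate identities in L^p. -/

noncomputable section

namespace AdvDiff

instance {d : ℕ} : (volume : Measure (Torus d)).IsNegInvariant :=
  Measure.IsAddHaarMeasure.isNegInvariant_of_regular volume

/-- The convolution on the torus. -/
def conv {d : ℕ} (R f : Torus d → ℝ) (x : Torus d) : ℝ := ∫ y, R (x - y) * f y

lemma conv_eq {d : ℕ} (R f : Torus d → ℝ) (x : Torus d) :
    conv R f x = ∫ z, R z * f (x - z) := by
  have := integral_sub_left_eq_self (fun z => R z * f (x - z)) volume x
  simp only [sub_sub_cancel] at this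
  exact this

lemma continuous_integrable {d : ℕ} {G : Torus d → ℝ} (hG : Continuous G) : Integrable G :=
  hG.integrable_of_hasCompactSupport (HasCompactSupport.of_compactSpace _)

lemma continuous_bounded {d : ℕ} {G : Torus d → ℝ} (hG : Continuous G) :
    ∃ C, 0 ≤ C ∧ ∀ x, |G x| ≤ C := by
  obtain ⟨C, hC⟩ := isCompact_univ.exists_bound_of_continuousOn hG.continuousOn
  exact ⟨C, (norm_nonneg _).trans (hC 0 trivial), fun x => hC x trivial⟩

lemma integrable_continuous_mul {d : ℕ} {G f : Torus d → ℝ} (hG : Continuous G)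
    (hf : Integrable f) : Integrable fun x => G x * f x := by
  obtain ⟨C, -, hC⟩ := continuous_bounded hG
  exact hf.bdd_mul hG.aestronglyMeasurable (Eventually.of_forall hC)

lemma integrable_mul_continuous {d : ℕ} {G f : Torus d → ℝ} (hG : Continuous G)
    (hf : Integrable f) : Integrable fun x => f x * G x := by
  simpa only [mul_comm] using integrable_continuous_mul hG hf

lemma rpow_lintegral_le {Ω : Type*} [MeasurableSpace Ω] (ρ : Measure Ω) [IsProbabilityMeasure ρ]
    {p : ℝ} (hp : 1 ≤ p) {g : Ω → ℝ≥0∞} (hg : AEMeasurable g ρ) :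
    (∫⁻ z, g z ∂ρ) ^ p ≤ ∫⁻ z, g z ^ p ∂ρ := by
  have h := eLpNorm'_le_eLpNorm'_of_exponent_le (f := g) zero_lt_one hp ρ hg.aestronglyMeasurable
  simp only [eLpNorm', enorm_eq_self, ENNReal.rpow_one, div_one] at h
  calc _ ≤ ((∫⁻ z, g z ^ p ∂ρ) ^ (1 / p)) ^ p := ENNReal.rpow_le_rpow h (by linarith)
    _ = _ := by rw [← ENNReal.rpow_mul, one_div_mul_cancel (by linarith), ENNReal.rpow_one]

/-- Jensen for the probability measure ρ followed by Tonelli. It serves as Minkowski's inequality,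
both for averages over a kernel and for averages along a segment. -/
lemma lintegral_rpow_lintegral_le {Ω X : Type*} [MeasurableSpace Ω] [MeasurableSpace X]
    (ρ : Measure Ω) [IsProbabilityMeasure ρ] (μ : Measure X) [SFinite μ]
    {p : ℝ} (hp : 1 ≤ p) {H : Ω × X → ℝ≥0∞} (hH : AEMeasurable H (ρ.prod μ)) :
    ∫⁻ x, (∫⁻ z, H (z, x) ∂ρ) ^ p ∂μ ≤ ∫⁻ z, ∫⁻ x, H (z, x) ^ p ∂μ ∂ρ := by
  have h1 : ∀ᵐ x ∂μ, AEMeasurable (fun z => H (z, x)) ρ := by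
    have h := hH.prod_swap
    have := h.aestronglyMeasurable.prodMk_left
    filter_upwards [this] with x hx using hx.aemeasurable
  calc ∫⁻ x, (∫⁻ z, H (z, x) ∂ρ) ^ p ∂μ ≤ ∫⁻ x, ∫⁻ z, H (z, x) ^ p ∂ρ ∂μ := by
        refine lintegral_mono_ae ?_
        filter_upwards [h1] with x hx using rpow_lintegral_le ρ hp hx
    _ = _ := by
        rw [lintegral_lintegral_swap]
        exact (hH.pow_const p).prod_swap

/-- Makes (z, x) ↦ f(x - z) measurable on the product when f is measurable only up to null sets. -/
lemma quasiMeasurePreserving_sub_swap {d : ℕ} (ρ : Measure (Torus d)) [SFinite ρ] :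
    Measure.QuasiMeasurePreserving (fun q : Torus d × Torus d => q.2 - q.1)
      (ρ.prod volume) volume :=
  (quasiMeasurePreserving_sub_of_right_invariant volume ρ).comp
    (Measure.measurePreserving_swap).quasiMeasurePreserving

/-- The probability measure with density `R`. -/
def kernelMeasure {d : ℕ} (R : Torus d → ℝ) : Measure (Torus d) :=
  volume.withDensity fun z => ENNReal.ofReal (R z)

lemma lintegral_kernelMeasure {d : ℕ} {R : Torus d → ℝ} (hR : Continuous R)
    (g : Torus d → ℝ≥0∞) :
    ∫⁻ z, g z ∂(kernelMeasure R) = ∫⁻ z, ENNReal.ofReal (R z) * g z := by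
  rw [kernelMeasure, lintegral_withDensity_eq_lintegral_mul_non_measurable]
  · rfl
  · exact hR.measurable.ennreal_ofReal
  · exact Eventually.of_forall fun z => ENNReal.ofReal_lt_top

lemma IsKernel.continuous {d n : ℕ} {K : ℝ} {R : Torus d → ℝ} (h : IsKernel n K R) :
    Continuous R := h.smooth.continuous

lemma IsKernel.lintegral_eq_one {d n : ℕ} {K : ℝ} {R : Torus d → ℝ} (h : IsKernel n K R) :
    ∫⁻ z, ENNReal.ofReal (R z) = 1 := by
  rw [← ofReal_integral_eq_lintegral_ofReal (continuous_integrable h.continuous)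
    (Eventually.of_forall h.nonneg), h.integral_eq_one, ENNReal.ofReal_one]

lemma IsKernel.isProbabilityMeasure {d n : ℕ} {K : ℝ} {R : Torus d → ℝ} (h : IsKernel n K R) :
    IsProbabilityMeasure (kernelMeasure R) := by
  refine ⟨?_⟩
  have := lintegral_kernelMeasure h.continuous (fun _ => 1)
  simpa [h.lintegral_eq_one] using this

lemma integrable_kernel_mul_shift {d : ℕ} {R f : Torus d → ℝ} (hR : Continuous R)
    (hf : Integrable f) (x : Torus d) : Integrable fun z => R z * f (x - z) :=
  integrable_continuous_mul hR (hf.comp_sub_left x)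

lemma enorm_conv_le {d n : ℕ} {K : ℝ} {R : Torus d → ℝ} (h : IsKernel n K R)
    (f : Torus d → ℝ) (x : Torus d) :
    ‖conv R f x‖ₑ ≤ ∫⁻ z, ‖f (x - z)‖ₑ ∂(kernelMeasure R) := by
  rw [conv_eq, lintegral_kernelMeasure h.continuous]
  refine (enorm_integral_le_lintegral_enorm _).trans_eq (lintegral_congr fun z => ?_)
  rw [enorm_mul, Real.enorm_of_nonneg (h.nonneg z)]

lemma conv_sub_self {d n : ℕ} {K : ℝ} {R : Torus d → ℝ} (h : IsKernel n K R)
    {f : Torus d → ℝ} (hf : Integrable f) (x : Torus d) :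
    conv R f x - f x = ∫ z, R z * (f (x - z) - f x) := by
  simp only [mul_sub]
  rw [integral_sub (integrable_kernel_mul_shift h.continuous hf x)
    ((continuous_integrable h.continuous).mul_const _), integral_mul_const, h.integral_eq_one,
    one_mul, conv_eq]

lemma enorm_conv_sub_le {d n : ℕ} {K : ℝ} {R : Torus d → ℝ} (h : IsKernel n K R)
    {f : Torus d → ℝ} (hf : Integrable f) (x : Torus d) :
    ‖conv R f x - f x‖ₑ ≤ ∫⁻ z, ‖f (x - z) - f x‖ₑ ∂(kernelMeasure R) := by
  rw [conv_sub_self h hf, lintegral_kernelMeasure h.continuous]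
  refine (enorm_integral_le_lintegral_enorm _).trans_eq (lintegral_congr fun z => ?_)
  rw [enorm_mul, Real.enorm_of_nonneg (h.nonneg z)]

lemma lintegral_comp_sub_const {d : ℕ} (f : Torus d → ℝ≥0∞) (a : Torus d) :
    ∫⁻ x, f (x - a) = ∫⁻ x, f x :=
  lintegral_sub_right_eq_self f a

lemma lintegral_conv_rpow_le {d n : ℕ} {K : ℝ} {R : Torus d → ℝ} (h : IsKernel n K R)
    {f : Torus d → ℝ} (hf : AEStronglyMeasurable f) {p : ℝ} (hp : 1 ≤ p) :
    ∫⁻ x, ‖conv R f x‖ₑ ^ p ≤ ∫⁻ x, ‖f x‖ₑ ^ p := by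
  have := h.isProbabilityMeasure
  have hm : AEMeasurable (fun q : Torus d × Torus d => ‖f (q.2 - q.1)‖ₑ)
      ((kernelMeasure R).prod volume) :=
    (hf.comp_quasiMeasurePreserving (quasiMeasurePreserving_sub_swap _)).enorm
  calc ∫⁻ x, ‖conv R f x‖ₑ ^ p
      ≤ ∫⁻ x, (∫⁻ z, ‖f (x - z)‖ₑ ∂(kernelMeasure R)) ^ p := by
        gcongr with x
        exact enorm_conv_le h f x
    _ ≤ ∫⁻ z, ∫⁻ x, ‖f (x - z)‖ₑ ^ p ∂volume ∂(kernelMeasure R) :=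
        lintegral_rpow_lintegral_le (kernelMeasure R) volume hp hm
    _ = ∫⁻ x, ‖f x‖ₑ ^ p := by
        simp only [lintegral_comp_sub_const (fun x => ‖f x‖ₑ ^ p)]
        simp

lemma lintegral_conv_sub_rpow_le {d n : ℕ} {K : ℝ} {R : Torus d → ℝ} (h : IsKernel n K R)
    {f : Torus d → ℝ} (hf : Integrable f) {p : ℝ} (hp : 1 ≤ p) :
    ∫⁻ x, ‖conv R f x - f x‖ₑ ^ p ≤
      ∫⁻ z, ENNReal.ofReal (R z) * ∫⁻ x, ‖f (x - z) - f x‖ₑ ^ p := by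
  have := h.isProbabilityMeasure
  have hm : AEMeasurable (fun q : Torus d × Torus d => ‖f (q.2 - q.1) - f q.2‖ₑ)
      ((kernelMeasure R).prod volume) :=
    ((hf.1.comp_quasiMeasurePreserving (quasiMeasurePreserving_sub_swap _)).sub
      hf.1.comp_snd).enorm
  calc ∫⁻ x, ‖conv R f x - f x‖ₑ ^ p
      ≤ ∫⁻ x, (∫⁻ z, ‖f (x - z) - f x‖ₑ ∂(kernelMeasure R)) ^ p := by
        gcongr with x
        exact enorm_conv_sub_le h hf x
    _ ≤ ∫⁻ z, ∫⁻ x, ‖f (x - z) - f x‖ₑ ^ p ∂volume ∂(kernelMeasure R) :=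
        lintegral_rpow_lintegral_le (kernelMeasure R) volume hp hm
    _ = _ := lintegral_kernelMeasure h.continuous _

lemma tendsto_lintegral_shift {d : ℕ} {p : ℝ} (hp : 1 ≤ p) {f : Torus d → ℝ}
    (hf : MemLp f (ENNReal.ofReal p)) :
    Tendsto (fun z => ∫⁻ x, ‖f (x - z) - f x‖ₑ ^ p) (𝓝 0) (𝓝 0) := by
  have hp' : Fact (1 ≤ ENNReal.ofReal p) := ⟨by simpa using hp⟩
  have hp0 : (0 : ℝ) < p := by linarith
  let g : Torus d → C(Torus d, Torus d) := fun z => ⟨fun x => x - z, by fun_prop⟩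
  have hg : Continuous g :=
    ContinuousMap.continuous_of_continuous_uncurry g
      (show Continuous fun q : Torus d × Torus d => q.2 - q.1 by fun_prop)
  have hgm : ∀ z, MeasurePreserving (g z) volume volume := fun z =>
    measurePreserving_sub_right volume z
  have h1 : Tendsto (fun z => Lp.compMeasurePreserving (g z) (hgm z) (hf.toLp f)) (𝓝 0)
      (𝓝 (Lp.compMeasurePreserving (g 0) (hgm 0) (hf.toLp f))) :=
    Filter.Tendsto.compMeasurePreservingLp tendsto_const_nhds (hg.tendsto 0) hgm (hgm 0)
      ENNReal.ofReal_ne_top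
  have h0 : ∀ z, (Lp.compMeasurePreserving (g z) (hgm z) (hf.toLp f) : Torus d → ℝ) =ᵐ[volume]
      fun x => f (x - z) := fun z =>
    (Lp.coeFn_compMeasurePreserving _ (hgm z)).trans
      ((hgm z).quasiMeasurePreserving.ae_eq_comp hf.coeFn_toLp)
  rw [tendsto_iff_edist_tendsto_0] at h1
  have h2 := h1.ennrpow_const p
  rw [ENNReal.zero_rpow_of_pos hp0] at h2
  refine h2.congr fun z => ?_
  rw [Lp.edist_def, eLpNorm_eq_lintegral_rpow_enorm_toReal (by simpa using hp0)
    ENNReal.ofReal_ne_top, ENNReal.toReal_ofReal hp0.le, ← ENNReal.rpow_mul,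
    one_div_mul_cancel hp0.ne', ENNReal.rpow_one]
  refine lintegral_congr_ae ?_
  filter_upwards [h0 z, h0 0] with x hx hx'
  simp only [Pi.sub_apply, hx, hx', sub_zero]

/-- Nonnegative weights of bounded mass which concentrate at `0`. -/
lemma tendsto_lintegral_concentrate {d : ℕ} {m : ℕ → Torus d → ℝ} {C : ℝ}
    (hm : ∀ n, Continuous (m n)) (hm0 : ∀ n z, 0 ≤ m n z) (h0 : ∀ n, 1 ≤ n → ∫ z, m n z ≤ C)
    (h2 : ∀ n : ℕ, 1 ≤ n → ∫ z, ‖z‖ ^ 2 * m n z ≤ C / n) {g : Torus d → ℝ≥0∞} {B : ℝ}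
    (hB : ∀ z, g z ≤ ENNReal.ofReal B) (hg : Tendsto g (𝓝 0) (𝓝 0)) :
    Tendsto (fun n => ∫⁻ z, ENNReal.ofReal (m n z) * g z) atTop (𝓝 0) := by
  have hC : 0 ≤ C := (integral_nonneg (hm0 1)).trans (h0 1 le_rfl)
  wlog hB0 : 0 ≤ B generalizing B
  · exact this (B := 0) (fun z => (hB z).trans (ENNReal.ofReal_le_ofReal (not_le.1 hB0).le)) le_rfl
  rw [ENNReal.tendsto_atTop_zero]
  intro ε hε
  rcases eq_or_ne ε ⊤ with rfl | hεt
  · exact ⟨0, fun _ _ => le_top⟩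
  have hε' : 0 < ε.toReal := ENNReal.toReal_pos hε.ne' hεt
  set η : ℝ := ε.toReal / (2 * (C + 1)) with hη
  have hη0 : 0 < η := by positivity
  obtain ⟨r, hr0, hr⟩ : ∃ r > 0, ∀ z : Torus d, ‖z‖ < r → g z ≤ ENNReal.ofReal η := by
    have := (ENNReal.tendsto_nhds_zero.1 hg) (ENNReal.ofReal η) (by simpa using hη0)
    obtain ⟨r, hr0, hr⟩ := Metric.eventually_nhds_iff.1 this
    exact ⟨r, hr0, fun z hz => hr (by simpa [dist_zero_right] using hz)⟩
  -- Near 0 the function g is at most η; away from 0 the quadratic term dominates the uniform bound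
  -- B. Only the mass and the second moment of the weights are then needed.
  have hpt : ∀ z, g z ≤ ENNReal.ofReal (η + B / r ^ 2 * ‖z‖ ^ 2) := by
    intro z
    rcases lt_or_ge ‖z‖ r with hz | hz
    · exact (hr z hz).trans (ENNReal.ofReal_le_ofReal (by
        have : 0 ≤ B / r ^ 2 * ‖z‖ ^ 2 := by positivity
        linarith))
    · refine (hB z).trans (ENNReal.ofReal_le_ofReal ?_)
      have h1 : r ^ 2 ≤ ‖z‖ ^ 2 := by gcongr
      have : B ≤ B / r ^ 2 * ‖z‖ ^ 2 := by
        rw [div_mul_eq_mul_div, le_div_iff₀ (by positivity)]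
        gcongr
      linarith
  obtain ⟨N, hN⟩ := exists_nat_gt (B / r ^ 2 * C / (ε.toReal / 2))
  refine ⟨N + 1, fun n hn => ?_⟩
  have hn1 : 1 ≤ n := by omega
  have hn0 : (0 : ℝ) < n := by exact_mod_cast hn1
  have hcont := hm n
  calc ∫⁻ z, ENNReal.ofReal (m n z) * g z
      ≤ ∫⁻ z, ENNReal.ofReal (m n z * (η + B / r ^ 2 * ‖z‖ ^ 2)) := by
        refine lintegral_mono fun z => ?_
        rw [ENNReal.ofReal_mul (hm0 n z)]
        gcongr
        exact hpt z
    _ = ENNReal.ofReal (∫ z, m n z * (η + B / r ^ 2 * ‖z‖ ^ 2)) := by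
        rw [ofReal_integral_eq_lintegral_ofReal (continuous_integrable (by fun_prop))
          (Eventually.of_forall fun z => mul_nonneg (hm0 n z) (by positivity))]
    _ ≤ ENNReal.ofReal ε.toReal := by
        refine ENNReal.ofReal_le_ofReal ?_
        have h3 : ∫ z, m n z * (η + B / r ^ 2 * ‖z‖ ^ 2) =
            η * (∫ z, m n z) + B / r ^ 2 * (∫ z, ‖z‖ ^ 2 * m n z) := by
          rw [← integral_const_mul, ← integral_const_mul, ← integral_add
            (continuous_integrable (by fun_prop)) (continuous_integrable (by fun_prop))]
          refine integral_congr_ae (Eventually.of_forall fun z => ?_)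
          ring
        rw [h3]
        have h4 : η * ∫ z, m n z ≤ ε.toReal / 2 := by
          calc η * ∫ z, m n z ≤ η * (C + 1) := by
                gcongr; linarith [h0 n hn1]
            _ = ε.toReal / 2 := by rw [hη]; field_simp
        have h5 : B / r ^ 2 * ∫ z, ‖z‖ ^ 2 * m n z ≤ ε.toReal / 2 := by
          calc B / r ^ 2 * ∫ z, ‖z‖ ^ 2 * m n z ≤ B / r ^ 2 * (C / n) := by
                gcongr; exact h2 n hn1
            _ = B / r ^ 2 * C / n := by ring
            _ ≤ ε.toReal / 2 := by
                rw [div_lt_iff₀ (by positivity)] at hN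
                rw [div_le_iff₀ hn0]
                have : (N : ℝ) ≤ n := by exact_mod_cast (by omega : N ≤ n)
                nlinarith
        linarith
    _ = ε := ENNReal.ofReal_toReal hεt

lemma IsKernel.norm_sq_moment {d n : ℕ} {K : ℝ} {R : Torus d → ℝ} (h : IsKernel n K R)
    (hn : 1 ≤ n) : ∫ z, ‖z‖ ^ 2 * R z ≤ K / n := by
  have hn0 : (0 : ℝ) < n := by exact_mod_cast hn
  have h1 := h.moment 2 (by norm_num)
  simp only [mul_pow, Real.sq_sqrt hn0.le, mul_assoc] at h1
  rw [integral_const_mul] at h1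
  rwa [le_div_iff₀' hn0]

lemma IsKernel.one_le {d n : ℕ} {K : ℝ} {R : Torus d → ℝ} (h : IsKernel n K R) : 1 ≤ K := by
  have := h.moment 0 (by norm_num)
  simpa [h.integral_eq_one] using this

lemma lintegral_shift_le {d : ℕ} {p : ℝ} (hp : 1 ≤ p) {f : Torus d → ℝ}
    (hf : MemLp f (ENNReal.ofReal p)) :
    ∃ B : ℝ, ∀ z, ∫⁻ x, ‖f (x - z) - f x‖ₑ ^ p ≤ ENNReal.ofReal B := by
  have hp0 : (0 : ℝ) < p := by linarith
  have hfin := lintegral_rpow_enorm_lt_top_of_eLpNorm_lt_top (by simpa using hp0)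
    ENNReal.ofReal_ne_top hf.2
  rw [ENNReal.toReal_ofReal hp0.le] at hfin
  set I := ∫⁻ x, ‖f x‖ₑ ^ p with hI
  have hlt : (2 : ℝ≥0∞) ^ (p - 1) * (I + I) ≠ ⊤ :=
    ENNReal.mul_ne_top (ENNReal.rpow_ne_top_of_nonneg (by linarith) (by simp))
      (ENNReal.add_ne_top.2 ⟨hfin.ne, hfin.ne⟩)
  refine ⟨((2 : ℝ≥0∞) ^ (p - 1) * (I + I)).toReal, fun z => ?_⟩
  rw [ENNReal.ofReal_toReal hlt]
  have hm1 : AEMeasurable fun x => ‖f (x - z)‖ₑ ^ p :=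
    ((hf.1.comp_quasiMeasurePreserving
      (measurePreserving_sub_right volume z).quasiMeasurePreserving).enorm).pow_const p
  calc ∫⁻ x, ‖f (x - z) - f x‖ₑ ^ p
      ≤ ∫⁻ x, (2 : ℝ≥0∞) ^ (p - 1) * (‖f (x - z)‖ₑ ^ p + ‖f x‖ₑ ^ p) := by
        refine lintegral_mono fun x => ?_
        refine le_trans ?_ (ENNReal.rpow_add_le_mul_rpow_add_rpow _ _ hp)
        gcongr
        exact enorm_sub_le
    _ = _ := by
        rw [lintegral_const_mul' _ _ (ENNReal.rpow_ne_top_of_nonneg (by linarith) (by simp)),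
          lintegral_add_left' hm1, lintegral_comp_sub_const (fun x => ‖f x‖ₑ ^ p)]

lemma tendsto_lintegral_conv_sub {d : ℕ} {K : ℝ} {R : ℕ → Torus d → ℝ}
    (h : ∀ n, 1 ≤ n → IsKernel n K (R n)) {p : ℝ} (hp : 1 ≤ p) {f : Torus d → ℝ}
    (hf : MemLp f (ENNReal.ofReal p)) :
    Tendsto (fun n => ∫⁻ x, ‖conv (R n) f x - f x‖ₑ ^ p) atTop (𝓝 0) := by
  have hfi : Integrable f := hf.integrable (by simpa using hp)
  obtain ⟨B, hB⟩ := lintegral_shift_le hp hf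
  have hK := (h 1 le_rfl).one_le
  -- Index 0 carries no kernel hypothesis, so the sequence is altered there.
  let R' : ℕ → Torus d → ℝ := fun n => R (max n 1)
  have h' : ∀ n, IsKernel (max n 1) K (R' n) := fun n => h _ (le_max_right _ _)
  have h1 := tendsto_lintegral_concentrate (m := R') (C := K)
    (fun n => (h' n).continuous) (fun n => (h' n).nonneg)
    (fun n _ => by rw [(h' n).integral_eq_one]; exact hK)
    (fun n hn => by
      have := (h' n).norm_sq_moment (le_max_right _ _)
      rwa [max_eq_left hn] at this) hB (tendsto_lintegral_shift hp hf)
  refine tendsto_of_tendsto_of_tendsto_of_le_of_le' tendsto_const_nhds h1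
    (Eventually.of_forall fun n => zero_le) ?_
  filter_upwards [eventually_ge_atTop 1] with n hn
  have : R' n = R n := by simp only [R', max_eq_left hn]
  rw [this]
  exact lintegral_conv_sub_rpow_le (h n hn) hfi hp

end AdvDiff

end

/-! ### Weak gradients: mollification, translation estimates, uniqueness. -/

noncomputable section

namespace AdvDiff

/-- A convolution is finitely many scalar coefficients times fixed smooth functions. Smoothness,
differentiation and, later, time dependence all reduce to these coefficients. -/
lemma conv_eq_sum {d : ℕ} {ι : Type*} [Fintype ι] {R : Torus d → ℝ} {a : ι → Torus d → ℝ}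
    (ha : ∀ j, SmoothOnTorus (a j)) (hR : ∀ x y, R (x - y) = ∑ j, a j x * a j y)
    {f : Torus d → ℝ} (hf : Integrable f) (x : Torus d) :
    conv R f x = ∑ j, (∫ y, f y * a j y) * a j x := by
  simp only [conv, hR, Finset.sum_mul]
  rw [integral_finsetSum]
  · refine Finset.sum_congr rfl fun j _ => ?_
    rw [← integral_mul_const]
    refine integral_congr_ae (Eventually.of_forall fun y => ?_)
    ring
  · intro j _
    simp only [mul_assoc]
    exact (integrable_continuous_mul (ha j).continuous hf).const_mul _

lemma FiniteRank.smooth_conv {d : ℕ} {R : Torus d → ℝ} (hR : FiniteRank R)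
    {f : Torus d → ℝ} (hf : Integrable f) : SmoothOnTorus (conv R f) := by
  obtain ⟨ι, _, a, ha, haR⟩ := hR
  have h : conv R f = fun x => ∑ j, (∫ y, f y * a j y) * a j x :=
    funext fun x => conv_eq_sum ha haR hf x
  rw [h]
  exact SmoothOnTorus.sum fun j _ => (ha j).const_mul _

lemma pderiv_kernel_eq_sum {d : ℕ} {ι : Type*} [Fintype ι] {R : Torus d → ℝ}
    {a : ι → Torus d → ℝ} (ha : ∀ j, SmoothOnTorus (a j))
    (hR : ∀ x y, R (x - y) = ∑ j, a j x * a j y) (i : Fin d) (x y : Torus d) :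
    pderiv i R (x - y) = ∑ j, pderiv i (a j) x * a j y := by
  rw [← pderiv_comp_sub_const y i x]
  have h : (fun x => R (x - y)) = fun x => ∑ j, a j y * a j x := by
    funext x; rw [hR]; exact Finset.sum_congr rfl fun j _ => mul_comm _ _
  rw [h, pderiv_sum fun j _ => (ha j).const_mul _]
  refine Finset.sum_congr rfl fun j _ => ?_
  rw [pderiv_const_mul (ha j), mul_comm]

lemma pderiv_conv_eq_sum {d : ℕ} {ι : Type*} [Fintype ι] {R : Torus d → ℝ}
    {a : ι → Torus d → ℝ} (ha : ∀ j, SmoothOnTorus (a j))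
    (hR : ∀ x y, R (x - y) = ∑ j, a j x * a j y) {f : Torus d → ℝ} (hf : Integrable f)
    (i : Fin d) (x : Torus d) :
    pderiv i (conv R f) x = ∑ j, (∫ y, f y * a j y) * pderiv i (a j) x := by
  have h : conv R f = fun x => ∑ j, (∫ y, f y * a j y) * a j x :=
    funext fun x => conv_eq_sum ha hR hf x
  rw [h, pderiv_sum fun j _ => (ha j).const_mul _]
  exact Finset.sum_congr rfl fun j _ => pderiv_const_mul (ha j) _ i x

lemma FiniteRank.pderiv_conv {d : ℕ} {R : Torus d → ℝ} (hR : FiniteRank R)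
    {f : Torus d → ℝ} (hf : Integrable f) (i : Fin d) (x : Torus d) :
    pderiv i (conv R f) x = conv (pderiv i R) f x := by
  obtain ⟨ι, _, a, ha, haR⟩ := hR
  rw [pderiv_conv_eq_sum ha haR hf]
  simp only [conv, pderiv_kernel_eq_sum ha haR, Finset.sum_mul]
  rw [integral_finsetSum]
  · refine Finset.sum_congr rfl fun j _ => ?_
    rw [← integral_mul_const]
    refine integral_congr_ae (Eventually.of_forall fun y => ?_)
    ring
  · intro j _
    simp only [mul_assoc]
    exact (integrable_continuous_mul (ha j).continuous hf).const_mul _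

/-- The reflected kernel y ↦ R(x - y) is an admissible test function; the sign from the reflection
cancels the one from the integration by parts. -/
lemma conv_pderiv_of_isWeakGrad {d : ℕ} {R : Torus d → ℝ} (hR : SmoothOnTorus R)
    {f : Torus d → ℝ} {G : Fin d → Torus d → ℝ} (hf : IsWeakGrad f G) (i : Fin d) (x : Torus d) :
    conv (pderiv i R) f x = conv R (G i) x := by
  have h := hf.2.2 _ (hR.comp_const_sub x) i
  simp only [pderiv_comp_const_sub hR, smul_eq_mul, neg_mul, integral_neg, neg_inj] at h
  exact h

lemma IsKernel.pderiv_conv_of_isWeakGrad {d n : ℕ} {K : ℝ} {R : Torus d → ℝ}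
    (h : IsKernel n K R) {f : Torus d → ℝ} {G : Fin d → Torus d → ℝ} (hf : IsWeakGrad f G)
    (i : Fin d) (x : Torus d) : pderiv i (conv R f) x = conv R (G i) x := by
  rw [h.finiteRank.pderiv_conv hf.1, conv_pderiv_of_isWeakGrad h.smooth hf]

/-- Rounding each coordinate gives a shortest lift, along which x and x - z can be joined by a
segment. -/
lemma exists_proj_abs_le {d : ℕ} (z : Torus d) : ∃ y : Euc d, proj y = z ∧ ∀ i, |y i| ≤ ‖z‖ := by
  have h : ∀ i, ∃ s : ℝ, (s : UnitAddCircle) = z i ∧ |s| = ‖z i‖ := by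
    intro i
    obtain ⟨s, hs⟩ := QuotientAddGroup.mk_surjective (z i)
    refine ⟨s - round s, ?_, ?_⟩
    · rw [← hs]
      have : ((s - round s : ℝ) : UnitAddCircle) = (s : UnitAddCircle) - ((round s : ℝ) : UnitAddCircle) :=
        rfl
      rw [this]
      have h0 : ((round s : ℝ) : UnitAddCircle) = 0 :=
        (AddCircle.coe_eq_zero_iff 1).2 ⟨round s, by simp⟩
      rw [h0, sub_zero]
    · rw [← hs]
      exact (UnitAddCircle.norm_eq (x := s)).symm
  choose y hy hy' using h
  exact ⟨WithLp.toLp 2 y, funext hy, fun i => (hy' i).trans_le (norm_le_pi_norm z i)⟩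

lemma lintegral_comp_add_const {d : ℕ} (f : Torus d → ℝ≥0∞) (a : Torus d) :
    ∫⁻ x, f (x + a) = ∫⁻ x, f x :=
  lintegral_add_right_eq_self f a

lemma SmoothOnTorus.enorm_shift_le {d : ℕ} {F : Torus d → ℝ} (hF : SmoothOnTorus F)
    {y : Euc d} {c : ℝ} (hy : ∀ i, |y i| ≤ c) (x : Torus d) :
    ‖F (x + proj y) - F x‖ₑ ≤
      ∫⁻ s in Set.Ioc (0 : ℝ) 1, ENNReal.ofReal c * ∑ i, ‖AdvDiff.pderiv i F (x + proj (s • y))‖ₑ := by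
  have hcont : ∀ i, Continuous fun s : ℝ => AdvDiff.pderiv i F (x + proj (s • y)) := fun i =>
    (hF.pderiv i).continuous.comp
      (continuous_const.add (continuous_proj.comp (continuous_id.smul continuous_const)))
  have h1 := intervalIntegral.integral_eq_sub_of_hasDerivAt (a := 0) (b := 1)
    (fun s _ => hF.hasDerivAt_line x y s)
    ((continuous_finsetSum _ fun i _ => (hcont i).const_mul (y i)).intervalIntegrable _ _)
  rw [one_smul, zero_smul] at h1
  have h2 : (proj (0 : Euc d)) = 0 := by funext i; simp [proj]
  rw [h2, add_zero] at h1
  rw [← h1, intervalIntegral.integral_of_le zero_le_one]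
  refine (enorm_integral_le_lintegral_enorm _).trans (lintegral_mono fun s => ?_)
  refine (enorm_sum_le _ _).trans ?_
  rw [Finset.mul_sum]
  refine Finset.sum_le_sum fun i _ => ?_
  rw [enorm_mul]
  gcongr
  rw [Real.enorm_eq_ofReal_abs]
  exact ENNReal.ofReal_le_ofReal (hy i)

lemma sum_rpow_le {d : ℕ} {p : ℝ} (hp : 1 ≤ p) (a : Fin d → ℝ≥0∞) :
    (∑ i, a i) ^ p ≤ (d : ℝ≥0∞) ^ (p - 1) * ∑ i, a i ^ p := by
  simpa using ENNReal.rpow_sum_le_const_mul_sum_rpow (Finset.univ : Finset (Fin d)) a hp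

/-- The fundamental theorem of calculus along the segment, Jensen in its parameter s, and
translation invariance, which removes s from the inner integral. -/
lemma SmoothOnTorus.lintegral_shift_le {d : ℕ} {F : Torus d → ℝ} (hF : SmoothOnTorus F)
    {p : ℝ} (hp : 1 ≤ p) (z : Torus d) :
    ∫⁻ x, ‖F (x - z) - F x‖ₑ ^ p ≤
      ‖z‖ₑ ^ p * ((d : ℝ≥0∞) ^ (p - 1) * ∑ i, ∫⁻ x, ‖AdvDiff.pderiv i F x‖ₑ ^ p) := by
  have hp0 : 0 ≤ p := by linarith
  obtain ⟨y, hy, hyz⟩ := exists_proj_abs_le (-z)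
  rw [norm_neg] at hyz
  have : IsProbabilityMeasure (volume.restrict (Set.Ioc (0 : ℝ) 1)) := ⟨by simp⟩
  have hc : ∀ i, Continuous fun q : ℝ × Torus d => AdvDiff.pderiv i F (q.2 + proj (q.1 • y)) :=
    fun i => (hF.pderiv i).continuous.comp
      (continuous_snd.add (continuous_proj.comp (continuous_fst.smul continuous_const)))
  have hm : Measurable fun q : ℝ × Torus d =>
      ENNReal.ofReal ‖z‖ * ∑ i, ‖AdvDiff.pderiv i F (q.2 + proj (q.1 • y))‖ₑ :=
    (Finset.measurable_fun_sum _ fun i _ => (hc i).measurable.enorm).const_mul _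
  calc ∫⁻ x, ‖F (x - z) - F x‖ₑ ^ p
      ≤ ∫⁻ x, (∫⁻ s in Set.Ioc (0 : ℝ) 1,
          ENNReal.ofReal ‖z‖ * ∑ i, ‖AdvDiff.pderiv i F (x + proj (s • y))‖ₑ) ^ p := by
        refine lintegral_mono fun x => ENNReal.rpow_le_rpow ?_ hp0
        rw [sub_eq_add_neg x z, ← hy]
        exact hF.enorm_shift_le hyz x
    _ ≤ ∫⁻ s in Set.Ioc (0 : ℝ) 1, ∫⁻ x,
          (ENNReal.ofReal ‖z‖ * ∑ i, ‖AdvDiff.pderiv i F (x + proj (s • y))‖ₑ) ^ p :=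
        lintegral_rpow_lintegral_le (volume.restrict (Set.Ioc (0 : ℝ) 1)) volume hp
          hm.aemeasurable
    _ = ∫⁻ x, (ENNReal.ofReal ‖z‖ * ∑ i, ‖AdvDiff.pderiv i F x‖ₑ) ^ p := by
        have : ∀ s : ℝ, ∫⁻ x,
            (ENNReal.ofReal ‖z‖ * ∑ i, ‖AdvDiff.pderiv i F (x + proj (s • y))‖ₑ) ^ p =
            ∫⁻ x, (ENNReal.ofReal ‖z‖ * ∑ i, ‖AdvDiff.pderiv i F x‖ₑ) ^ p := fun s =>
          lintegral_comp_add_const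
            (fun x => (ENNReal.ofReal ‖z‖ * ∑ i, ‖AdvDiff.pderiv i F x‖ₑ) ^ p) (proj (s • y))
        simp only [this]
        simp
    _ ≤ ∫⁻ x, ‖z‖ₑ ^ p * ((d : ℝ≥0∞) ^ (p - 1) * ∑ i, ‖AdvDiff.pderiv i F x‖ₑ ^ p) := by
        refine lintegral_mono fun x => ?_
        rw [ENNReal.mul_rpow_of_nonneg _ _ hp0, ← Real.enorm_of_nonneg (norm_nonneg z), enorm_norm]
        gcongr
        exact sum_rpow_le hp _
    _ = _ := by
        have hmi : ∀ i, Measurable fun x => ‖AdvDiff.pderiv i F x‖ₑ ^ p := fun i =>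
          (hF.pderiv i).continuous.measurable.enorm.pow_const p
        have hms := Finset.measurable_fun_sum Finset.univ fun i (_ : i ∈ Finset.univ) => hmi i
        rw [lintegral_const_mul _ (hms.const_mul _), lintegral_const_mul _ hms,
          lintegral_finsetSum _ fun i _ => hmi i]

lemma exists_seq_conv_tendsto_ae {d : ℕ} {K : ℝ} {R : ℕ → Torus d → ℝ}
    (h : ∀ n, 1 ≤ n → IsKernel n K (R n)) {f : Torus d → ℝ} (hf : Integrable f) :
    ∃ ns : ℕ → ℕ, StrictMono ns ∧
      ∀ᵐ x, Tendsto (fun k => conv (R (ns k)) f x) atTop (𝓝 (f x)) := by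
  have hcont : ∀ n, 1 ≤ n → Continuous (conv (R n) f) := fun n hn =>
    ((h n hn).finiteRank.smooth_conv hf).continuous
  let R' : ℕ → Torus d → ℝ := fun n => R (max n 1)
  have h1 := tendsto_lintegral_conv_sub h le_rfl (f := f) (by
    rw [ENNReal.ofReal_one]; exact memLp_one_iff_integrable.2 hf)
  simp only [ENNReal.rpow_one] at h1
  have h2 : Tendsto (fun n => eLpNorm (conv (R (n + 1)) f - f) 1 volume) atTop (𝓝 0) := by
    simp only [eLpNorm_one_eq_lintegral_enorm, Pi.sub_apply]
    exact h1.comp (tendsto_add_atTop_nat 1)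
  obtain ⟨ns, hns, hns'⟩ := (tendstoInMeasure_of_tendsto_eLpNorm one_ne_zero
    (fun n => (hcont (n + 1) (by omega)).aestronglyMeasurable) hf.1 h2).exists_seq_tendsto_ae
  exact ⟨fun k => ns k + 1, fun i j hij => by simpa using hns hij, hns'⟩

/-- Mollification does not increase the norm of the gradient, so the smooth estimate holds with a
constant independent of n. Fatou along an almost everywhere convergent subsequence removes the
mollification. -/
theorem IsWeakGrad.lintegral_shift_le {d : ℕ} (hd : 0 < d) {f : Torus d → ℝ}
    {G : Fin d → Torus d → ℝ} (hf : IsWeakGrad f G) {p : ℝ} (hp : 1 ≤ p) (z : Torus d) :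
    ∫⁻ x, ‖f (x - z) - f x‖ₑ ^ p ≤
      ‖z‖ₑ ^ p * ((d : ℝ≥0∞) ^ (p - 1) * ∑ i, ∫⁻ x, ‖G i x‖ₑ ^ p) := by
  have hk : ∀ n : ℕ, 1 ≤ n → IsKernel n (d * (24 * 1440)) (torusKernel (d := d) n) :=
    fun n hn => isKernel_torusKernel hd hn
  obtain ⟨ns, hns, hae⟩ := exists_seq_conv_tendsto_ae hk hf.1
  have hae' : ∀ᵐ x, Tendsto (fun k => conv (torusKernel (ns k)) f (x - z)) atTop (𝓝 (f (x - z))) :=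
    (measurePreserving_sub_right volume z).quasiMeasurePreserving.ae hae
  have hns1 : ∀ k, 1 ≤ k → 1 ≤ ns k := fun k hk => hk.trans (hns.id_le k)
  have hsm : ∀ k, 1 ≤ k → SmoothOnTorus (conv (torusKernel (ns k)) f) := fun k hk' =>
    (hk _ (hns1 k hk')).finiteRank.smooth_conv hf.1
  have hb : ∀ k, 1 ≤ k → ∫⁻ x, ‖conv (torusKernel (ns k)) f (x - z) -
      conv (torusKernel (ns k)) f x‖ₑ ^ p ≤
      ‖z‖ₑ ^ p * ((d : ℝ≥0∞) ^ (p - 1) * ∑ i, ∫⁻ x, ‖G i x‖ₑ ^ p) := by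
    intro k hk'
    refine ((hsm k hk').lintegral_shift_le hp z).trans ?_
    refine mul_le_mul_right (mul_le_mul_right (Finset.sum_le_sum fun i _ => ?_) _) _
    simp only [(hk _ (hns1 k hk')).pderiv_conv_of_isWeakGrad hf]
    exact lintegral_conv_rpow_le (hk _ (hns1 k hk')) (hf.2.1 i).1 hp
  calc ∫⁻ x, ‖f (x - z) - f x‖ₑ ^ p
      = ∫⁻ x, liminf (fun k => ‖conv (torusKernel (ns (k + 1))) f (x - z) -
          conv (torusKernel (ns (k + 1))) f x‖ₑ ^ p) atTop := by
        refine lintegral_congr_ae ?_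
        filter_upwards [hae, hae'] with x hx hx'
        have := (((hx'.sub hx).comp (tendsto_add_atTop_nat 1)).enorm).ennrpow_const p
        exact this.liminf_eq.symm
    _ ≤ liminf (fun k => ∫⁻ x, ‖conv (torusKernel (ns (k + 1))) f (x - z) -
          conv (torusKernel (ns (k + 1))) f x‖ₑ ^ p) atTop := by
        refine lintegral_liminf_le fun k => ?_
        have := (hsm (k + 1) (by omega)).continuous
        exact (((this.comp (continuous_sub_right z)).sub this).measurable.enorm).pow_const p
    _ ≤ _ := by
        refine liminf_le_of_le (by isBoundedDefault) fun b hb' => ?_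
        obtain ⟨k, hk'⟩ := hb'.exists
        exact hk'.trans (hb (k + 1) (by omega))

/-- Both candidates have the same mollifications, namely the classical derivatives of the mollified
function, and these converge almost everywhere along a subsequence. -/
theorem IsWeakGrad.unique {d : ℕ} (hd : 0 < d) {f : Torus d → ℝ}
    {G G' : Fin d → Torus d → ℝ} (hG : IsWeakGrad f G) (hG' : IsWeakGrad f G') (i : Fin d) :
    G i =ᵐ[volume] G' i := by
  have hk : ∀ n : ℕ, 1 ≤ n → IsKernel n (d * (24 * 1440)) (torusKernel (d := d) n) :=
    fun n hn => isKernel_torusKernel hd hn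
  have hint : Integrable (fun x => G i x - G' i x) := (hG.2.1 i).sub (hG'.2.1 i)
  obtain ⟨ns, hns, hae⟩ := exists_seq_conv_tendsto_ae hk hint
  filter_upwards [hae] with x hx
  have h0 : ∀ k, 1 ≤ k → conv (torusKernel (ns k)) (fun x => G i x - G' i x) x = 0 := by
    intro k hk'
    have hkk := hk _ (hk'.trans (hns.id_le k))
    have h1 : conv (torusKernel (ns k)) (fun x => G i x - G' i x) x =
        conv (torusKernel (ns k)) (G i) x - conv (torusKernel (ns k)) (G' i) x := by
      simp only [conv, mul_sub]
      exact integral_sub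
        (integrable_continuous_mul (hkk.continuous.comp (continuous_sub_left x)) (hG.2.1 i))
        (integrable_continuous_mul (hkk.continuous.comp (continuous_sub_left x)) (hG'.2.1 i))
    rw [h1, ← hkk.pderiv_conv_of_isWeakGrad hG, ← hkk.pderiv_conv_of_isWeakGrad hG', sub_self]
  have h2 : Tendsto (fun k => conv (torusKernel (ns k)) (fun x => G i x - G' i x) x) atTop (𝓝 0) :=
    tendsto_const_nhds.congr' (by
      filter_upwards [eventually_ge_atTop 1] with k hk' using (h0 k hk').symm)
  exact sub_eq_zero.1 (tendsto_nhds_unique hx h2)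

theorem IsWeakGrad.gradL2Sq_eq {d : ℕ} (hd : 0 < d) {f : Torus d → ℝ}
    {G : Fin d → Torus d → ℝ} (hG : IsWeakGrad f G) :
    gradL2Sq f = ∫⁻ x, ∑ i, ‖G i x‖ₑ ^ 2 := by
  refine le_antisymm (iInf₂_le G hG) (le_iInf₂ fun G' hG' => le_of_eq ?_)
  refine lintegral_congr_ae ?_
  have h : ∀ᵐ x, ∀ i, G i x = G' i x := ae_all_iff.2 fun i => hG.unique hd hG' i
  filter_upwards [h] with x hx
  simp [hx]

lemma IsWeakGrad.coord {d : ℕ} {f : Torus d → Euc d} {G : Fin d → Torus d → Euc d}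
    (h : IsWeakGrad f G) (j : Fin d) : IsWeakGrad (fun x => f x j) (fun i x => G i x j) := by
  let L : Euc d →L[ℝ] ℝ := EuclideanSpace.proj j
  have hL : ∀ {g : Torus d → Euc d}, Integrable g → Integrable fun x => g x j := fun hg =>
    L.integrable_comp hg
  have hs : ∀ {φ : Torus d → ℝ} {g : Torus d → Euc d}, Continuous φ → Integrable g →
      Integrable fun x => φ x • g x := by
    intro φ g hφ hg
    obtain ⟨C, -, hC⟩ := continuous_bounded hφ
    exact hg.bdd_smul C hφ.aestronglyMeasurable (Eventually.of_forall hC)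
  have hi : ∀ {φ : Torus d → ℝ} {g : Torus d → Euc d}, Continuous φ → Integrable g →
      ∫ x, φ x • g x j = (∫ x, φ x • g x) j := by
    intro φ g hφ hg
    exact L.integral_comp_comm (hs hφ hg)
  refine ⟨hL h.1, fun i => hL (h.2.1 i), fun φ hφ i => ?_⟩
  rw [hi (hφ.pderiv i).continuous h.1, hi hφ.continuous (h.2.1 i), h.2.2 φ hφ i]
  rfl

end AdvDiff

end

/-! ### The commutator of advection and mollification. -/

noncomputable section

namespace AdvDiff

/-- A divergence free velocity field at a fixed time whose increments are controlled in `L^p`. -/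
structure IsDrift {d : ℕ} (p B : ℝ) (b : Torus d → Euc d) : Prop where
  integrable : ∀ i, Integrable fun x => b x i
  incr : ∀ i z, ∫⁻ x, ‖b (x - z) i - b x i‖ₑ ^ p ≤ ENNReal.ofReal (B * ‖z‖) ^ p
  div_eq_zero : ∀ φ : Torus d → ℝ, SmoothOnTorus φ → ∫ x, ∑ i, b x i * pderiv i φ x = 0

/-- The commutator of the advection operator and the convolution with `R`. -/
def commutator {d : ℕ} (R : Torus d → ℝ) (b : Torus d → Euc d) (f : Torus d → ℝ)
    (x : Torus d) : ℝ :=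
  ∫ y, f y * ∑ i, (b x i - b y i) * pderiv i R (x - y)

lemma integrable_bdd_mul_shift {d : ℕ} {f g : Torus d → ℝ} {M : ℝ}
    (hf : AEStronglyMeasurable f) (hM : ∀ᵐ x, |f x| ≤ M) (hg : Integrable g) :
    Integrable fun x => f x * g x :=
  hg.bdd_mul hf hM

lemma IsKernel.pderiv_neg {d n : ℕ} {K : ℝ} {R : Torus d → ℝ} (h : IsKernel n K R) (i : Fin d)
    (z : Torus d) : pderiv i R (-z) = - pderiv i R z := by
  have h1 := pderiv_comp_const_sub h.smooth 0 i z
  simp only [zero_sub, h.even] at h1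
  change pderiv i R z = _ at h1
  linarith

/-- The part with b(x) vanishes because a derivative has mean zero, the part with b(x - z) because b
is divergence free when tested with the reflected kernel. -/
lemma IsKernel.integral_pderiv_mul_shift {d n : ℕ} {K p B : ℝ} {R : Torus d → ℝ}
    (h : IsKernel n K R) {b : Torus d → Euc d} (hb : IsDrift p B b) (x : Torus d) :
    ∫ z, ∑ i, (b x i - b (x - z) i) * pderiv i R z = 0 := by
  have hc : ∀ i, Continuous (pderiv i R) := fun i => (h.smooth.pderiv i).continuous
  have hi1 : ∀ i, Integrable fun z => b x i * pderiv i R z := fun i =>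
    (continuous_integrable (hc i)).const_mul _
  have hi2 : ∀ i, Integrable fun z => b (x - z) i * pderiv i R z := fun i =>
    integrable_mul_continuous (hc i) ((hb.integrable i).comp_sub_left x)
  have h1 : ∫ z, ∑ i, b (x - z) i * pderiv i R z = 0 := by
    have h2 := hb.div_eq_zero _ (h.smooth.comp_const_sub x)
    have h3 := integral_sub_left_eq_self
      (fun y => ∑ i, b y i * pderiv i (fun y => R (x - y)) y) volume x
    rw [h2] at h3
    simp only [pderiv_comp_const_sub h.smooth, sub_sub_cancel, mul_neg,
      Finset.sum_neg_distrib, integral_neg, neg_eq_zero] at h3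
    exact h3
  simp only [sub_mul, Finset.sum_sub_distrib]
  rw [integral_sub (integrable_finsetSum _ fun i _ => hi1 i)
    (integrable_finsetSum _ fun i _ => hi2 i), h1, sub_zero,
    integral_finsetSum _ fun i _ => hi1 i]
  refine Finset.sum_eq_zero fun i _ => ?_
  rw [integral_const_mul, h.smooth.integral_pderiv, mul_zero]

/-- The cancellation of DiPerna and Lions: a multiple of f(x) may be subtracted at no cost, so both
f and b enter through increments. -/
lemma commutator_eq {d n : ℕ} {K p B M : ℝ} {R : Torus d → ℝ}
    (h : IsKernel n K R) {b : Torus d → Euc d} (hb : IsDrift p B b) {f : Torus d → ℝ}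
    (hf : AEStronglyMeasurable f) (hM : ∀ᵐ x, |f x| ≤ M) (x : Torus d) :
    commutator R b f x =
      ∫ z, (f (x - z) - f x) * ∑ i, (b x i - b (x - z) i) * pderiv i R z := by
  have hc : ∀ i, Continuous (pderiv i R) := fun i => (h.smooth.pderiv i).continuous
  have hq := (Measure.measurePreserving_sub_left (volume : Measure (Torus d)) x).quasiMeasurePreserving
  have hi : Integrable fun z => ∑ i, (b x i - b (x - z) i) * pderiv i R z :=
    integrable_finsetSum _ fun i _ => integrable_mul_continuous (hc i)
      ((integrable_const _).sub ((hb.integrable i).comp_sub_left x))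
  have h1 : commutator R b f x =
      ∫ z, f (x - z) * ∑ i, (b x i - b (x - z) i) * pderiv i R z := by
    have h3 := integral_sub_left_eq_self
      (fun y => f y * ∑ i, (b x i - b y i) * pderiv i R (x - y)) volume x
    simp only [sub_sub_cancel] at h3
    exact h3.symm
  have hi' : Integrable fun z => f (x - z) * ∑ i, (b x i - b (x - z) i) * pderiv i R z :=
    integrable_bdd_mul_shift (hf.comp_quasiMeasurePreserving hq) (hq.ae hM) hi
  have h2 : ∀ z, (f (x - z) - f x) * ∑ i, (b x i - b (x - z) i) * pderiv i R z =
      f (x - z) * (∑ i, (b x i - b (x - z) i) * pderiv i R z) -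
      f x * ∑ i, (b x i - b (x - z) i) * pderiv i R z := fun z => sub_mul _ _ _
  simp only [h2]
  rw [integral_sub hi' (hi.const_mul _), integral_const_mul, h.integral_pderiv_mul_shift hb,
    mul_zero, sub_zero, h1]

/-- The squared `L²` norm of an increment. -/
def incrSq {d : ℕ} (f : Torus d → ℝ) (z : Torus d) : ℝ≥0∞ := ∫⁻ x, ‖f (x - z) - f x‖ₑ ^ (2 : ℝ)

/-- Hölder with weights 1/2 + 1/p + (p-2)/(2p) = 1. The third factor is interpolated between L^∞ and
L² through |δ| ≤ M^{2/p} |δ|^{(p-2)/p}. The loss in this interpolation is what produces the factor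
(p-2)/(p-1) in the final exponent. -/
lemma lintegral_triple_le {d : ℕ} {p B M : ℝ} (hp : 2 < p) {β ζ δ : Torus d → ℝ}
    (hβ : AEStronglyMeasurable β) (hζ : AEStronglyMeasurable ζ) (hδ : AEStronglyMeasurable δ)
    (hβB : ∫⁻ x, ‖β x‖ₑ ^ p ≤ ENNReal.ofReal B ^ p) (hδM : ∀ᵐ x, |δ x| ≤ M) :
    ∫⁻ x, ‖ζ x‖ₑ * (‖δ x‖ₑ * ‖β x‖ₑ) ≤
      (∫⁻ x, ‖ζ x‖ₑ ^ (2 : ℝ)) ^ (1 / 2 : ℝ) * (ENNReal.ofReal M ^ (2 / p) *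
        (ENNReal.ofReal B * (∫⁻ x, ‖δ x‖ₑ ^ (2 : ℝ)) ^ ((p - 2) / (2 * p)))) := by
  have hp0 : 0 < p := by linarith
  have key := ENNReal.lintegral_prod_norm_pow_le (μ := (volume : Measure (Torus d)))
    (Finset.univ : Finset (Fin 3))
    (f := ![fun x => ‖ζ x‖ₑ ^ (2 : ℝ), fun x => ‖β x‖ₑ ^ p, fun x => ‖δ x‖ₑ ^ (2 : ℝ)])
    (p := ![1 / 2, 1 / p, (p - 2) / (2 * p)]) (by
      intro i _
      fin_cases i
      · exact hζ.enorm.pow_const _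
      · exact hβ.enorm.pow_const _
      · exact hδ.enorm.pow_const _) (by
      simp only [Fin.sum_univ_three, Matrix.cons_val_zero, Matrix.cons_val_one,
        Matrix.cons_val_two, Matrix.head_cons, Matrix.tail_cons]
      field_simp; ring) (by
      intro i _
      fin_cases i
      · norm_num
      · simpa using hp0.le
      · exact div_nonneg (by linarith) (by linarith))
  simp only [Fin.prod_univ_three, Matrix.cons_val_zero, Matrix.cons_val_one,
    Matrix.cons_val_two, Matrix.head_cons, Matrix.tail_cons] at key
  have hθ : 2 / p + (p - 2) / p = 1 := by field_simp; ring
  calc ∫⁻ x, ‖ζ x‖ₑ * (‖δ x‖ₑ * ‖β x‖ₑ)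
      ≤ ∫⁻ x, ENNReal.ofReal M ^ (2 / p) * ((‖ζ x‖ₑ ^ (2 : ℝ)) ^ (1 / 2 : ℝ) *
          (‖β x‖ₑ ^ p) ^ (1 / p) * (‖δ x‖ₑ ^ (2 : ℝ)) ^ ((p - 2) / (2 * p))) := by
        refine lintegral_mono_ae ?_
        filter_upwards [hδM] with x hx
        rw [← ENNReal.rpow_mul, ← ENNReal.rpow_mul, ← ENNReal.rpow_mul,
          show (2 : ℝ) * (1 / 2) = 1 by norm_num, mul_one_div_cancel hp0.ne',
          show 2 * ((p - 2) / (2 * p)) = (p - 2) / p by field_simp, ENNReal.rpow_one,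
          ENNReal.rpow_one]
        have h1 : ‖δ x‖ₑ ≤ ENNReal.ofReal M ^ (2 / p) * ‖δ x‖ₑ ^ ((p - 2) / p) := by
          calc ‖δ x‖ₑ = ‖δ x‖ₑ ^ (2 / p + (p - 2) / p) := by rw [hθ, ENNReal.rpow_one]
            _ = ‖δ x‖ₑ ^ (2 / p) * ‖δ x‖ₑ ^ ((p - 2) / p) :=
                ENNReal.rpow_add_of_nonneg _ _ (by positivity)
                  (div_nonneg (by linarith) hp0.le)
            _ ≤ _ := by
                gcongr
                rw [Real.enorm_eq_ofReal_abs]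
                exact ENNReal.ofReal_le_ofReal hx
        calc ‖ζ x‖ₑ * (‖δ x‖ₑ * ‖β x‖ₑ)
            ≤ ‖ζ x‖ₑ * ((ENNReal.ofReal M ^ (2 / p) * ‖δ x‖ₑ ^ ((p - 2) / p)) * ‖β x‖ₑ) := by
              gcongr
          _ = _ := by ring
    _ ≤ ENNReal.ofReal M ^ (2 / p) * ((∫⁻ x, ‖ζ x‖ₑ ^ (2 : ℝ)) ^ (1 / 2 : ℝ) *
          (∫⁻ x, ‖β x‖ₑ ^ p) ^ (1 / p) *
          (∫⁻ x, ‖δ x‖ₑ ^ (2 : ℝ)) ^ ((p - 2) / (2 * p))) := by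
        rw [lintegral_const_mul' _ _
          (ENNReal.rpow_ne_top_of_nonneg (by positivity) ENNReal.ofReal_ne_top)]
        gcongr
    _ ≤ ENNReal.ofReal M ^ (2 / p) * ((∫⁻ x, ‖ζ x‖ₑ ^ (2 : ℝ)) ^ (1 / 2 : ℝ) *
          ENNReal.ofReal B * (∫⁻ x, ‖δ x‖ₑ ^ (2 : ℝ)) ^ ((p - 2) / (2 * p))) := by
        gcongr
        calc (∫⁻ x, ‖β x‖ₑ ^ p) ^ (1 / p) ≤ (ENNReal.ofReal B ^ p) ^ (1 / p) := by gcongr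
          _ = ENNReal.ofReal B := by
            rw [← ENNReal.rpow_mul, mul_one_div_cancel hp0.ne', ENNReal.rpow_one]
    _ = _ := by ring

/-- The bound for the commutator, see `enorm_integral_mul_commutator_le`. -/
def commBound {d : ℕ} (p B M : ℝ) (R f : Torus d → ℝ) : ℝ≥0∞ :=
  ∑ i, ∫⁻ z, ‖pderiv i R z‖ₑ * (ENNReal.ofReal (2 * M) ^ (2 / p) *
    (ENNReal.ofReal (B * ‖z‖) * incrSq f z ^ ((p - 2) / (2 * p))))

lemma abs_shift_sub_le {d : ℕ} {f : Torus d → ℝ} {M : ℝ} (hM : ∀ᵐ x, |f x| ≤ M) (z : Torus d) :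
    ∀ᵐ x, |f (x - z) - f x| ≤ 2 * M := by
  filter_upwards [hM, (measurePreserving_sub_right volume z).quasiMeasurePreserving.ae hM]
    with x hx hx'
  exact (abs_sub _ _).trans (by linarith)

/-- Tonelli brings the integral over x inside, where the triple Hölder bound applies at fixed z; the
kernel is integrated last. Pairing with ζ isolates exactly the L² norm of ζ. -/
theorem enorm_integral_mul_commutator_le {d n : ℕ} {K p B M : ℝ} (hp : 2 < p)
    {R : Torus d → ℝ} (h : IsKernel n K R) {b : Torus d → Euc d} (hb : IsDrift p B b)
    {f ζ : Torus d → ℝ} (hf : AEStronglyMeasurable f) (hM : ∀ᵐ x, |f x| ≤ M)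
    (hζ : AEStronglyMeasurable ζ) :
    ‖∫ x, ζ x * commutator R b f x‖ₑ ≤
      (∫⁻ x, ‖ζ x‖ₑ ^ (2 : ℝ)) ^ (1 / 2 : ℝ) * commBound p B M R f := by
  have hc : ∀ i, Continuous (pderiv i R) := fun i => (h.smooth.pderiv i).continuous
  have hsub := quasiMeasurePreserving_sub_swap (volume : Measure (Torus d))
  have hfm : AEStronglyMeasurable (fun q : Torus d × Torus d => f (q.2 - q.1) - f q.2)
      (volume.prod volume) := (hf.comp_quasiMeasurePreserving hsub).sub hf.comp_snd
  have hbm : ∀ i, AEStronglyMeasurable (fun q : Torus d × Torus d => b (q.2 - q.1) i - b q.2 i)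
      (volume.prod volume) := fun i =>
    ((hb.integrable i).1.comp_quasiMeasurePreserving hsub).sub (hb.integrable i).1.comp_snd
  have hm : ∀ i, AEMeasurable (fun q : Torus d × Torus d => ‖pderiv i R q.1‖ₑ *
      (‖ζ q.2‖ₑ * (‖f (q.2 - q.1) - f q.2‖ₑ * ‖b (q.2 - q.1) i - b q.2 i‖ₑ)))
      (volume.prod volume) := fun i =>
    ((hc i).measurable.enorm.comp measurable_fst).aemeasurable.mul
      (hζ.comp_snd.enorm.mul (hfm.enorm.mul (hbm i).enorm))
  have hpt : ∀ x, ‖ζ x * commutator R b f x‖ₑ ≤ ∫⁻ z, ∑ i, ‖pderiv i R z‖ₑ *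
      (‖ζ x‖ₑ * (‖f (x - z) - f x‖ₑ * ‖b (x - z) i - b x i‖ₑ)) := by
    intro x
    rw [commutator_eq h hb hf hM, ← integral_const_mul]
    refine (enorm_integral_le_lintegral_enorm _).trans (lintegral_mono fun z => ?_)
    rw [enorm_mul, enorm_mul]
    calc ‖ζ x‖ₑ * (‖f (x - z) - f x‖ₑ * ‖∑ i, (b x i - b (x - z) i) * pderiv i R z‖ₑ)
        ≤ ‖ζ x‖ₑ * (‖f (x - z) - f x‖ₑ * ∑ i, ‖(b x i - b (x - z) i) * pderiv i R z‖ₑ) := by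
          gcongr; exact enorm_sum_le _ _
      _ = _ := by
          rw [Finset.mul_sum, Finset.mul_sum]
          refine Finset.sum_congr rfl fun i _ => ?_
          rw [enorm_mul, ← enorm_neg (b x i - b (x - z) i), neg_sub]
          ring
  calc ‖∫ x, ζ x * commutator R b f x‖ₑ
      ≤ ∫⁻ x, ∫⁻ z, ∑ i, ‖pderiv i R z‖ₑ *
        (‖ζ x‖ₑ * (‖f (x - z) - f x‖ₑ * ‖b (x - z) i - b x i‖ₑ)) :=
        (enorm_integral_le_lintegral_enorm _).trans (lintegral_mono hpt)
    _ = ∫⁻ z, ∫⁻ x, ∑ i, ‖pderiv i R z‖ₑ *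
        (‖ζ x‖ₑ * (‖f (x - z) - f x‖ₑ * ‖b (x - z) i - b x i‖ₑ)) := by
        rw [lintegral_lintegral_swap]
        exact (Finset.aemeasurable_fun_sum Finset.univ fun i _ => hm i).prod_swap
    _ ≤ ∫⁻ z, ∑ i, ‖pderiv i R z‖ₑ * ((∫⁻ x, ‖ζ x‖ₑ ^ (2 : ℝ)) ^ (1 / 2 : ℝ) *
          (ENNReal.ofReal (2 * M) ^ (2 / p) *
          (ENNReal.ofReal (B * ‖z‖) * incrSq f z ^ ((p - 2) / (2 * p))))) := by
        refine lintegral_mono fun z => ?_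
        have hq := (measurePreserving_sub_right (volume : Measure (Torus d)) z).quasiMeasurePreserving
        have hfz : AEStronglyMeasurable (fun x => f (x - z) - f x) :=
          (hf.comp_quasiMeasurePreserving hq).sub hf
        have hbz : ∀ i, AEStronglyMeasurable (fun x => b (x - z) i - b x i) := fun i =>
          ((hb.integrable i).1.comp_quasiMeasurePreserving hq).sub (hb.integrable i).1
        have hmz : ∀ i, AEMeasurable (fun x => ‖pderiv i R z‖ₑ *
            (‖ζ x‖ₑ * (‖f (x - z) - f x‖ₑ * ‖b (x - z) i - b x i‖ₑ))) volume := fun i =>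
          (hζ.enorm.mul (hfz.enorm.mul (hbz i).enorm)).const_mul _
        rw [lintegral_finsetSum' _ fun i _ => hmz i]
        refine Finset.sum_le_sum fun i _ => ?_
        rw [lintegral_const_mul' _ _ enorm_ne_top]
        gcongr
        exact lintegral_triple_le hp (hbz i) hζ hfz (hb.incr i z)
          (abs_shift_sub_le hM z)
    _ ≤ _ := by
        have hW : AEMeasurable (incrSq f) volume :=
          (hfm.enorm.pow_const (2 : ℝ)).lintegral_prod_right'
        have hz : ∀ i, AEMeasurable (fun z => ‖pderiv i R z‖ₑ * (ENNReal.ofReal (2 * M) ^ (2 / p) *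
            (ENNReal.ofReal (B * ‖z‖) * incrSq f z ^ ((p - 2) / (2 * p))))) volume := fun i =>
          (hc i).measurable.enorm.aemeasurable.mul
            (((measurable_norm.const_mul B).ennreal_ofReal.aemeasurable.mul
              (hW.pow_const _)).const_mul _)
        have heq : ∀ z, ∑ i, ‖pderiv i R z‖ₑ * ((∫⁻ x, ‖ζ x‖ₑ ^ (2 : ℝ)) ^ (1 / 2 : ℝ) *
            (ENNReal.ofReal (2 * M) ^ (2 / p) *
            (ENNReal.ofReal (B * ‖z‖) * incrSq f z ^ ((p - 2) / (2 * p))))) =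
            (∫⁻ x, ‖ζ x‖ₑ ^ (2 : ℝ)) ^ (1 / 2 : ℝ) * ∑ i, ‖pderiv i R z‖ₑ *
            (ENNReal.ofReal (2 * M) ^ (2 / p) *
            (ENNReal.ofReal (B * ‖z‖) * incrSq f z ^ ((p - 2) / (2 * p)))) := by
          intro z
          rw [Finset.mul_sum]
          refine Finset.sum_congr rfl fun i _ => ?_
          ring
        simp only [heq]
        rw [lintegral_const_mul'' _ (Finset.aemeasurable_fun_sum _ fun i _ => hz i),
          lintegral_finsetSum' _ fun i _ => hz i]
        rfl

lemma incrSq_le {d : ℕ} {f : Torus d → ℝ} {M : ℝ} (hM : ∀ᵐ x, |f x| ≤ M) (z : Torus d) :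
    incrSq f z ≤ ENNReal.ofReal ((2 * M) ^ 2) := by
  calc incrSq f z ≤ ∫⁻ _x : Torus d, ENNReal.ofReal ((2 * M) ^ 2) := by
        refine lintegral_mono_ae ?_
        filter_upwards [abs_shift_sub_le hM z] with x hx
        rw [Real.enorm_eq_ofReal_abs, ENNReal.ofReal_rpow_of_nonneg (abs_nonneg _) (by norm_num)]
        refine ENNReal.ofReal_le_ofReal ?_
        rw [Real.rpow_two]
        gcongr
    _ = _ := by simp

/-- The factor ‖z‖ gained from the increment of the drift pays for the √n lost by differentiating
the kernel. This keeps commutators bounded uniformly in n. -/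
lemma IsKernel.pderiv_norm_moment {d n : ℕ} {K : ℝ} {R : Torus d → ℝ} (h : IsKernel n K R)
    (hn : 1 ≤ n) (i : Fin d) : ∫ z, ‖z‖ * |pderiv i R z| ≤ K := by
  have hn0 : (0 : ℝ) < √n := Real.sqrt_pos.2 (by exact_mod_cast hn)
  have h1 := h.pderiv_moment i 1 (by norm_num)
  simp only [pow_one, mul_assoc] at h1
  rw [integral_const_mul, mul_comm] at h1
  exact le_of_mul_le_mul_right h1 hn0

/-- Shows that the weights ‖z‖|∂R| concentrate at 0, as `tendsto_lintegral_concentrate` requires. -/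
lemma IsKernel.pderiv_norm_cube_moment {d n : ℕ} {K : ℝ} {R : Torus d → ℝ} (h : IsKernel n K R)
    (hn : 1 ≤ n) (i : Fin d) : ∫ z, ‖z‖ ^ 2 * (‖z‖ * |pderiv i R z|) ≤ K / n := by
  have hn1 : (0 : ℝ) < n := by exact_mod_cast hn
  have hn0 : (0 : ℝ) < √n := Real.sqrt_pos.2 hn1
  have h1 := h.pderiv_moment i 3 (by norm_num)
  have h2 : ∀ z : Torus d, (√n * ‖z‖) ^ 3 * |pderiv i R z| =
      (n * √n) * (‖z‖ ^ 2 * (‖z‖ * |pderiv i R z|)) := by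
    intro z
    have := Real.sq_sqrt hn1.le
    linear_combination (√n * ‖z‖ ^ 3 * |pderiv i R z|) * this
  simp only [h2] at h1
  rw [integral_const_mul] at h1
  rw [le_div_iff₀' hn1]
  refine le_of_mul_le_mul_right ?_ hn0
  linarith

lemma commBound_eq {d : ℕ} {p B M : ℝ} (hp : 2 < p) (hB : 0 ≤ B) (R f : Torus d → ℝ) :
    commBound p B M R f = ENNReal.ofReal (2 * M) ^ (2 / p) * ENNReal.ofReal B *
      ∑ i, ∫⁻ z, ENNReal.ofReal (‖z‖ * |pderiv i R z|) * incrSq f z ^ ((p - 2) / (2 * p)) := by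
  rw [commBound, Finset.mul_sum]
  refine Finset.sum_congr rfl fun i _ => ?_
  rw [← lintegral_const_mul' _ _ (ENNReal.mul_ne_top
    (ENNReal.rpow_ne_top_of_nonneg (by positivity) ENNReal.ofReal_ne_top) ENNReal.ofReal_ne_top)]
  refine lintegral_congr fun z => ?_
  rw [ENNReal.ofReal_mul hB, ENNReal.ofReal_mul (norm_nonneg z), ← Real.enorm_eq_ofReal_abs]
  ring

/-- A crude bound using only boundedness of f and uniform in n. It dominates the commutators in time
when n tends to infinity. -/
lemma commBound_le {d n : ℕ} {K p B M : ℝ} (hp : 2 < p) (hB : 0 ≤ B) (hM0 : 0 ≤ M)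
    {R : Torus d → ℝ} (h : IsKernel n K R) (hn : 1 ≤ n) {f : Torus d → ℝ}
    (hM : ∀ᵐ x, |f x| ≤ M) :
    commBound p B M R f ≤ ENNReal.ofReal (2 * M * B * (d * K)) := by
  have hp0 : 0 < p := by linarith
  have hθ : 2 / p + (p - 2) / p = 1 := by field_simp; ring
  have hθ0 : 0 ≤ (p - 2) / p := div_nonneg (by linarith) hp0.le
  have hθ0' : 0 ≤ (p - 2) / (2 * p) := div_nonneg (by linarith) (by linarith)
  rw [commBound_eq hp hB]
  have h1 : ∀ i, ∫⁻ z, ENNReal.ofReal (‖z‖ * |pderiv i R z|) * incrSq f z ^ ((p - 2) / (2 * p)) ≤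
      ENNReal.ofReal K * ENNReal.ofReal (2 * M) ^ ((p - 2) / p) := by
    intro i
    have hc := (h.smooth.pderiv i).continuous
    calc _ ≤ ∫⁻ z, ENNReal.ofReal (‖z‖ * |pderiv i R z|) *
          ENNReal.ofReal (2 * M) ^ ((p - 2) / p) := by
          gcongr with z
          calc incrSq f z ^ ((p - 2) / (2 * p))
              ≤ (ENNReal.ofReal ((2 * M) ^ 2)) ^ ((p - 2) / (2 * p)) := by
                gcongr; exact incrSq_le hM z
            _ = _ := by
                rw [ENNReal.ofReal_pow (by positivity), ← ENNReal.rpow_natCast, ← ENNReal.rpow_mul]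
                congr 1
                push_cast
                field_simp
      _ ≤ _ := by
          rw [lintegral_mul_const' _ _ (ENNReal.rpow_ne_top_of_nonneg hθ0 ENNReal.ofReal_ne_top),
            ← ofReal_integral_eq_lintegral_ofReal (continuous_integrable (by fun_prop))
            (Eventually.of_forall fun z => by positivity)]
          gcongr
          exact h.pderiv_norm_moment hn i
  calc _ ≤ ENNReal.ofReal (2 * M) ^ (2 / p) * ENNReal.ofReal B *
      ∑ _i : Fin d, ENNReal.ofReal K * ENNReal.ofReal (2 * M) ^ ((p - 2) / p) := by
        gcongr with i; exact h1 i
    _ = (ENNReal.ofReal (2 * M) ^ (2 / p) * ENNReal.ofReal (2 * M) ^ ((p - 2) / p)) *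
        (ENNReal.ofReal B * (d * ENNReal.ofReal K)) := by
        simp only [Finset.sum_const, Finset.card_univ, Fintype.card_fin, nsmul_eq_mul]
        ring
    _ = _ := by
        rw [← ENNReal.rpow_add_of_nonneg _ _ (by positivity) hθ0, hθ, ENNReal.rpow_one,
          mul_assoc (2 * M), ENNReal.ofReal_mul (p := 2 * M) (by positivity),
          ENNReal.ofReal_mul hB, ENNReal.ofReal_mul (p := (d : ℝ)) (by positivity),
          ENNReal.ofReal_natCast]

/-- The qualitative version: translations are continuous in L² and the kernel weights concentrate at
0, so no gradient of f is needed. -/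
lemma tendsto_commBound {d : ℕ} {K p B M : ℝ} (hp : 2 < p) (hB : 0 ≤ B)
    {R : ℕ → Torus d → ℝ} (h : ∀ n, 1 ≤ n → IsKernel n K (R n)) {f : Torus d → ℝ}
    (hf : AEStronglyMeasurable f) (hM : ∀ᵐ x, |f x| ≤ M) :
    Tendsto (fun n => commBound p B M (R (n + 1)) f) atTop (𝓝 0) := by
  have hp0 : 0 < p := by linarith
  have hθ0 : 0 < (p - 2) / (2 * p) := div_pos (by linarith) (by linarith)
  have hK := (h 1 le_rfl).one_le
  have hf2 : MemLp f (ENNReal.ofReal 2) := by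
    have : MemLp f ⊤ := memLp_top_of_bound hf M hM
    exact this.mono_exponent le_top
  have h1 := tendsto_lintegral_shift (p := 2) (by norm_num) hf2
  have h2 := h1.ennrpow_const ((p - 2) / (2 * p))
  rw [ENNReal.zero_rpow_of_pos hθ0] at h2
  simp only [commBound_eq hp hB]
  have h3 : ∀ i, Tendsto (fun n : ℕ => ∫⁻ z, ENNReal.ofReal (‖z‖ * |pderiv i (R (n + 1)) z|) *
      incrSq f z ^ ((p - 2) / (2 * p))) atTop (𝓝 0) := by
    intro i
    have hc : ∀ n : ℕ, Continuous fun z => ‖z‖ * |pderiv i (R (n + 1)) z| := fun n =>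
      continuous_norm.mul ((h (n + 1) (by omega)).smooth.pderiv i).continuous.abs
    refine tendsto_lintegral_concentrate (C := K) hc (fun n z => by positivity)
      (fun n _ => (h (n + 1) (by omega)).pderiv_norm_moment (by omega) i) (fun n hn => ?_)
      (B := ((2 * M) ^ 2) ^ ((p - 2) / (2 * p))) (fun z => ?_) h2
    · refine ((h (n + 1) (by omega)).pderiv_norm_cube_moment (by omega) i).trans ?_
      have : (0 : ℝ) < n := by exact_mod_cast hn
      gcongr
      simp
    · rw [← ENNReal.ofReal_rpow_of_nonneg (by positivity) hθ0.le]
      gcongr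
      exact incrSq_le hM z
  have h4 := ENNReal.Tendsto.const_mul (tendsto_finsetSum Finset.univ fun i _ => h3 i)
    (a := ENNReal.ofReal (2 * M) ^ (2 / p) * ENNReal.ofReal B)
    (Or.inr (ENNReal.mul_ne_top
      (ENNReal.rpow_ne_top_of_nonneg (by positivity) ENNReal.ofReal_ne_top) ENNReal.ofReal_ne_top))
  simpa using h4

/-- The commutator bound for functions with a weak gradient. -/
lemma commBound_le_of_grad {d n : ℕ} {K p B M g : ℝ} (hp : 2 < p) (hB : 0 ≤ B) (hM0 : 0 ≤ M)
    (hg : 0 ≤ g) {R : Torus d → ℝ} (h : IsKernel n K R) (hn : 1 ≤ n) {f : Torus d → ℝ}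
    (hfg : ∀ z, incrSq f z ≤ ENNReal.ofReal (‖z‖ ^ 2 * g)) :
    commBound p B M R f ≤ ENNReal.ofReal ((2 * M) ^ (2 / p) * B * (d * (2 * K)) *
      (g / n) ^ ((p - 2) / (2 * p))) := by
  have hp0 : 0 < p := by linarith
  have hn1 : (0 : ℝ) < n := by exact_mod_cast hn
  have hn0 : (0 : ℝ) < √n := Real.sqrt_pos.2 hn1
  set θ := (p - 2) / (2 * p) with hθ
  have hθ0 : 0 ≤ θ := div_nonneg (by linarith) (by linarith)
  have hθ1 : 2 * θ ≤ 1 := by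
    rw [hθ]; field_simp; linarith
  have hK := h.one_le
  rw [commBound_eq hp hB]
  have h1 : ∀ i, ∫⁻ z, ENNReal.ofReal (‖z‖ * |pderiv i R z|) * incrSq f z ^ θ ≤
      ENNReal.ofReal (2 * K * (g / n) ^ θ) := by
    intro i
    have hc := (h.smooth.pderiv i).continuous
    -- In the rescaled variable y = √n‖z‖ the increment bound becomes y² g/n. Since 2θ ≤ 1, its
    -- power satisfies (y²)^θ ≤ 1 + y, so first and second moments suffice.
    have hpt : ∀ z : Torus d, (‖z‖ * |pderiv i R z|) * (‖z‖ ^ 2 * g) ^ θ ≤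
        ((g / n) ^ θ / √n) * ((√n * ‖z‖) ^ 1 * |pderiv i R z| +
          (√n * ‖z‖) ^ 2 * |pderiv i R z|) := by
      intro z
      set y := √n * ‖z‖ with hy
      have hy0 : 0 ≤ y := by positivity
      have hzy : ‖z‖ = y / √n := by rw [hy]; field_simp
      have e1 : ‖z‖ ^ 2 * g = y ^ 2 * (g / n) := by
        rw [hzy, div_pow, Real.sq_sqrt hn1.le]; ring
      have e2 : (y ^ 2) ^ θ ≤ 1 + y := by
        rcases le_total y 1 with hy1 | hy1
        · exact (Real.rpow_le_one (by positivity) (by nlinarith) hθ0).trans (by linarith)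
        · calc (y ^ 2) ^ θ = y ^ (2 * θ) := by
                rw [← Real.rpow_natCast, ← Real.rpow_mul hy0]; norm_num
            _ ≤ y ^ (1 : ℝ) := Real.rpow_le_rpow_of_exponent_le hy1 hθ1
            _ ≤ 1 + y := by rw [Real.rpow_one]; linarith
      rw [e1, Real.mul_rpow (by positivity) (by positivity), hzy]
      calc y / √n * |pderiv i R z| * ((y ^ 2) ^ θ * (g / n) ^ θ)
          ≤ y / √n * |pderiv i R z| * ((1 + y) * (g / n) ^ θ) := by gcongr
        _ = _ := by ring
    calc _ ≤ ∫⁻ z, ENNReal.ofReal (((g / n) ^ θ / √n) * ((√n * ‖z‖) ^ 1 * |pderiv i R z| +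
          (√n * ‖z‖) ^ 2 * |pderiv i R z|)) := by
          refine lintegral_mono fun z => ?_
          refine le_trans ?_ (ENNReal.ofReal_le_ofReal (hpt z))
          rw [ENNReal.ofReal_mul (p := ‖z‖ * |pderiv i R z|) (by positivity),
            ← ENNReal.ofReal_rpow_of_nonneg (by positivity) hθ0]
          gcongr
          exact hfg z
      _ = ENNReal.ofReal (∫ z, ((g / n) ^ θ / √n) * ((√n * ‖z‖) ^ 1 * |pderiv i R z| +
          (√n * ‖z‖) ^ 2 * |pderiv i R z|)) := by
          rw [ofReal_integral_eq_lintegral_ofReal (continuous_integrable (by fun_prop))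
            (Eventually.of_forall fun z => by positivity)]
      _ ≤ _ := by
          refine ENNReal.ofReal_le_ofReal ?_
          rw [integral_const_mul, integral_add (continuous_integrable (by fun_prop))
            (continuous_integrable (by fun_prop))]
          have i1 := h.pderiv_moment i 1 (by norm_num)
          have i2 := h.pderiv_moment i 2 (by norm_num)
          calc _ ≤ (g / n) ^ θ / √n * (K * √n + K * √n) := by gcongr
            _ = _ := by field_simp; ring
  calc _ ≤ ENNReal.ofReal (2 * M) ^ (2 / p) * ENNReal.ofReal B *
      ∑ _i : Fin d, ENNReal.ofReal (2 * K * (g / n) ^ θ) := by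
        gcongr with i; exact h1 i
    _ = _ := by
        simp only [Finset.sum_const, Finset.card_univ, Fintype.card_fin, nsmul_eq_mul]
        rw [ENNReal.ofReal_rpow_of_nonneg (by positivity) (by positivity),
          ← ENNReal.ofReal_natCast, ← ENNReal.ofReal_mul (by positivity),
          ← ENNReal.ofReal_mul (by positivity), ← ENNReal.ofReal_mul (by positivity)]
        congr 1
        ring

end AdvDiff

end

/-! ### Finite-rank identities and estimates for the commutator and Laplacian terms. -/

noncomputable section

namespace AdvDiff

lemma sum_pderiv_mul_eq_neg {d n : ℕ} {K : ℝ} {R : Torus d → ℝ} (h : IsKernel n K R)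
    {ι : Type*} [Fintype ι] {a : ι → Torus d → ℝ} (ha : ∀ j, SmoothOnTorus (a j))
    (hR : ∀ x y, R (x - y) = ∑ j, a j x * a j y) (i : Fin d) (x y : Torus d) :
    ∑ j, pderiv i (a j) y * a j x = - pderiv i R (x - y) := by
  rw [← pderiv_kernel_eq_sum ha hR, ← neg_sub x y, h.pderiv_neg]

/-- Second derivatives of an even kernel are even, so they may be moved from one variable to the
other. -/
lemma sum_pderiv_pderiv_comm {d n : ℕ} {K : ℝ} {R : Torus d → ℝ} (h : IsKernel n K R)
    {ι : Type*} [Fintype ι] {a : ι → Torus d → ℝ} (ha : ∀ j, SmoothOnTorus (a j))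
    (hR : ∀ x y, R (x - y) = ∑ j, a j x * a j y) (i : Fin d) (x y : Torus d) :
    ∑ j, pderiv i (pderiv i (a j)) x * a j y = ∑ j, a j x * pderiv i (pderiv i (a j)) y := by
  have h1 : ∀ x y, pderiv i (pderiv i R) (x - y) = ∑ j, pderiv i (pderiv i (a j)) x * a j y := by
    intro x y
    rw [← pderiv_comp_sub_const y i x]
    have e : (fun x => pderiv i R (x - y)) = fun x => ∑ j, a j y * pderiv i (a j) x := by
      funext x
      rw [pderiv_kernel_eq_sum ha hR]
      exact Finset.sum_congr rfl fun j _ => mul_comm _ _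
    rw [e, pderiv_sum fun j _ => ((ha j).pderiv i).const_mul _]
    refine Finset.sum_congr rfl fun j _ => ?_
    rw [pderiv_const_mul ((ha j).pderiv i), mul_comm]
  have h2 : ∀ z, pderiv i (pderiv i R) (-z) = pderiv i (pderiv i R) z := by
    intro z
    have e := pderiv_comp_const_sub (h.smooth.pderiv i) 0 i z
    have e' : (fun x => pderiv i R (0 - x)) = fun x => (-1) * pderiv i R x := by
      funext x; rw [zero_sub, h.pderiv_neg]; ring
    rw [e', pderiv_const_mul (h.smooth.pderiv i), zero_sub] at e
    linarith
  rw [← h1, ← neg_sub, h2, h1]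
  exact Finset.sum_congr rfl fun j _ => mul_comm _ _

lemma pderiv_pderiv_conv_eq_sum {d : ℕ} {ι : Type*} [Fintype ι] {R : Torus d → ℝ}
    {a : ι → Torus d → ℝ} (ha : ∀ j, SmoothOnTorus (a j))
    (hR : ∀ x y, R (x - y) = ∑ j, a j x * a j y) {f : Torus d → ℝ} (hf : Integrable f)
    (i : Fin d) (x : Torus d) :
    pderiv i (pderiv i (conv R f)) x = ∑ j, (∫ y, f y * a j y) * pderiv i (pderiv i (a j)) x := by
  have h : pderiv i (conv R f) = fun x => ∑ j, (∫ y, f y * a j y) * pderiv i (a j) x :=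
    funext fun x => pderiv_conv_eq_sum ha hR hf i x
  rw [h, pderiv_sum fun j _ => ((ha j).pderiv i).const_mul _]
  exact Finset.sum_congr rfl fun j _ => pderiv_const_mul ((ha j).pderiv i) _ i x

/-- Puts the Laplacian on the functions a_j, which is how it appears when the equation is tested
with a_j. -/
lemma laplace_conv_eq {d n : ℕ} {K : ℝ} {R : Torus d → ℝ} (h : IsKernel n K R)
    {ι : Type*} [Fintype ι] {a : ι → Torus d → ℝ} (ha : ∀ j, SmoothOnTorus (a j))
    (hR : ∀ x y, R (x - y) = ∑ j, a j x * a j y) {f : Torus d → ℝ} (hf : Integrable f)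
    (x : Torus d) :
    laplace (conv R f) x = ∑ j, (∫ y, f y * laplace (a j) y) * a j x := by
  have hi : ∀ (φ : Torus d → ℝ), SmoothOnTorus φ → Integrable fun y => f y * φ y :=
    fun φ hφ => integrable_mul_continuous hφ.continuous hf
  have h1 : ∀ i, pderiv i (pderiv i (conv R f)) x =
      ∑ j, (∫ y, f y * pderiv i (pderiv i (a j)) y) * a j x := by
    intro i
    rw [pderiv_pderiv_conv_eq_sum ha hR hf]
    simp only [← integral_mul_const]
    rw [← integral_finsetSum _ fun j _ => (hi _ (ha j)).mul_const _,
      ← integral_finsetSum _ fun j _ => (hi _ (((ha j).pderiv i).pderiv i)).mul_const _]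
    refine integral_congr_ae (Eventually.of_forall fun y => ?_)
    have := sum_pderiv_pderiv_comm h ha hR i x y
    calc ∑ j, f y * a j y * pderiv i (pderiv i (a j)) x
        = f y * ∑ j, pderiv i (pderiv i (a j)) x * a j y := by
          rw [Finset.mul_sum]; exact Finset.sum_congr rfl fun j _ => by ring
      _ = f y * ∑ j, a j x * pderiv i (pderiv i (a j)) y := by rw [this]
      _ = _ := by rw [Finset.mul_sum]; exact Finset.sum_congr rfl fun j _ => by ring
  simp only [laplace, h1, Finset.mul_sum]
  rw [Finset.sum_comm]
  refine Finset.sum_congr rfl fun j _ => ?_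
  rw [← Finset.sum_mul, integral_finsetSum _ fun i _ => hi _ (((ha j).pderiv i).pderiv i)]

lemma integrable_drift_mul {d : ℕ} {p B M : ℝ} {b : Torus d → Euc d} (hb : IsDrift p B b)
    {f : Torus d → ℝ} (hf : AEStronglyMeasurable f) (hM : ∀ᵐ x, |f x| ≤ M)
    {φ : Fin d → Torus d → ℝ} (hφ : ∀ i, Continuous (φ i)) :
    Integrable fun x => f x * ∑ i, b x i * φ i x :=
  integrable_bdd_mul_shift hf hM
    (integrable_finsetSum _ fun i _ => integrable_mul_continuous (hφ i) (hb.integrable i))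

/-- The form in which the commutator arises from the equation: the first sum comes from testing the
advection term with each a_j, the second is the drift acting on the mollified function. -/
lemma commutator_eq_add {d n : ℕ} {K p B M : ℝ} {R : Torus d → ℝ} (h : IsKernel n K R)
    {ι : Type*} [Fintype ι] {a : ι → Torus d → ℝ} (ha : ∀ j, SmoothOnTorus (a j))
    (hR : ∀ x y, R (x - y) = ∑ j, a j x * a j y) {b : Torus d → Euc d} (hb : IsDrift p B b)
    {f : Torus d → ℝ} (hf : AEStronglyMeasurable f) (hM : ∀ᵐ x, |f x| ≤ M) (x : Torus d) :
    commutator R b f x = ∑ j, (∫ y, f y * ∑ i, b y i * pderiv i (a j) y) * a j x +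
      ∑ i, b x i * pderiv i (conv R f) x := by
  have hfi : Integrable f := (memLp_top_of_bound hf M hM).integrable le_top
  have hc : ∀ i, Continuous fun y => pderiv i R (x - y) := fun i =>
    (h.smooth.pderiv i).continuous.comp (continuous_sub_left x)
  have h1 : ∑ j, (∫ y, f y * ∑ i, b y i * pderiv i (a j) y) * a j x =
      - ∫ y, f y * ∑ i, b y i * pderiv i R (x - y) := by
    simp only [← integral_mul_const]
    rw [← integral_finsetSum _ fun j _ => (integrable_drift_mul hb hf hM
      (φ := fun i => pderiv i (a j)) fun i => ((ha j).pderiv i).continuous).mul_const _,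
      ← integral_neg]
    refine integral_congr_ae (Eventually.of_forall fun y => ?_)
    calc ∑ j, f y * (∑ i, b y i * pderiv i (a j) y) * a j x
        = f y * ∑ i, b y i * ∑ j, pderiv i (a j) y * a j x := by
          simp only [Finset.mul_sum, Finset.sum_mul]
          rw [Finset.sum_comm]
          exact Finset.sum_congr rfl fun i _ => Finset.sum_congr rfl fun j _ => by ring
      _ = _ := by
          simp only [sum_pderiv_mul_eq_neg h ha hR, mul_neg, Finset.sum_neg_distrib]
  have h2 : ∑ i, b x i * pderiv i (conv R f) x = ∫ y, f y * ∑ i, b x i * pderiv i R (x - y) := by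
    simp only [h.finiteRank.pderiv_conv hfi, conv, ← integral_const_mul]
    rw [← integral_finsetSum _ fun i _ => (integrable_continuous_mul (hc i) hfi).const_mul _]
    refine integral_congr_ae (Eventually.of_forall fun y => ?_)
    simp only [Finset.mul_sum]
    exact Finset.sum_congr rfl fun i _ => by ring
  rw [h1, h2, neg_add_eq_sub, ← integral_sub
    (integrable_bdd_mul_shift hf hM
      (integrable_finsetSum _ fun i _ => (continuous_integrable (hc i)).const_mul _))
    (integrable_drift_mul hb hf hM hc)]
  refine integral_congr_ae (Eventually.of_forall fun y => ?_)
  simp only [sub_mul, Finset.sum_sub_distrib, mul_sub]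

lemma integrable_commutator {d n : ℕ} {K p B M : ℝ} {R : Torus d → ℝ} (h : IsKernel n K R)
    {b : Torus d → Euc d} (hb : IsDrift p B b)
    {f : Torus d → ℝ} (hf : AEStronglyMeasurable f) (hM : ∀ᵐ x, |f x| ≤ M) :
    Integrable (commutator R b f) := by
  obtain ⟨ι, _, a, ha, hR⟩ := h.finiteRank
  have hfi : Integrable f := (memLp_top_of_bound hf M hM).integrable le_top
  have e : commutator R b f = fun x => ∑ j, (∫ y, f y * ∑ i, b y i * pderiv i (a j) y) * a j x +
      ∑ i, b x i * pderiv i (conv R f) x := funext (commutator_eq_add h ha hR hb hf hM)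
  rw [e]
  exact (integrable_finsetSum _ fun j _ => (continuous_integrable (ha j).continuous).const_mul _).add
    (integrable_finsetSum _ fun i _ => integrable_mul_continuous
      ((h.finiteRank.smooth_conv hfi).pderiv i).continuous (hb.integrable i))

lemma cauchySchwarz_lintegral {d : ℕ} {f g : Torus d → ℝ} (hf : AEStronglyMeasurable f)
    (hg : AEStronglyMeasurable g) :
    ∫⁻ x, ‖f x‖ₑ * ‖g x‖ₑ ≤ (∫⁻ x, ‖f x‖ₑ ^ (2 : ℝ)) ^ (1 / 2 : ℝ) *
      (∫⁻ x, ‖g x‖ₑ ^ (2 : ℝ)) ^ (1 / 2 : ℝ) :=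
  ENNReal.lintegral_mul_le_Lp_mul_Lq volume Real.HolderConjugate.two_two hf.enorm hg.enorm

lemma enorm_integral_mul_conv_le {d : ℕ} {D f ζ : Torus d → ℝ} (hD : Continuous D)
    (hf : AEStronglyMeasurable f) (hζ : AEStronglyMeasurable ζ) :
    ‖∫ x, ζ x * conv D f x‖ₑ ≤ (∫⁻ x, ‖ζ x‖ₑ ^ (2 : ℝ)) ^ (1 / 2 : ℝ) *
      (ENNReal.ofReal (∫ z, |D z|) * (∫⁻ x, ‖f x‖ₑ ^ (2 : ℝ)) ^ (1 / 2 : ℝ)) := by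
  have hsub := quasiMeasurePreserving_sub_swap (volume : Measure (Torus d))
  have hm : AEMeasurable (fun q : Torus d × Torus d => ‖D q.1‖ₑ * (‖ζ q.2‖ₑ * ‖f (q.2 - q.1)‖ₑ))
      (volume.prod volume) :=
    (hD.measurable.enorm.comp measurable_fst).aemeasurable.mul
      (hζ.comp_snd.enorm.mul (hf.comp_quasiMeasurePreserving hsub).enorm)
  calc ‖∫ x, ζ x * conv D f x‖ₑ
      ≤ ∫⁻ x, ∫⁻ z, ‖D z‖ₑ * (‖ζ x‖ₑ * ‖f (x - z)‖ₑ) := by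
        refine (enorm_integral_le_lintegral_enorm _).trans (lintegral_mono fun x => ?_)
        rw [conv_eq, ← integral_const_mul]
        refine (enorm_integral_le_lintegral_enorm _).trans_eq (lintegral_congr fun z => ?_)
        rw [enorm_mul, enorm_mul]; ring
    _ = ∫⁻ z, ∫⁻ x, ‖D z‖ₑ * (‖ζ x‖ₑ * ‖f (x - z)‖ₑ) := by
        rw [lintegral_lintegral_swap]
        exact hm.prod_swap
    _ ≤ ∫⁻ z, ‖D z‖ₑ * ((∫⁻ x, ‖ζ x‖ₑ ^ (2 : ℝ)) ^ (1 / 2 : ℝ) *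
          (∫⁻ x, ‖f x‖ₑ ^ (2 : ℝ)) ^ (1 / 2 : ℝ)) := by
        refine lintegral_mono fun z => ?_
        rw [lintegral_const_mul' _ _ enorm_ne_top]
        gcongr
        have hq := (measurePreserving_sub_right (volume : Measure (Torus d)) z).quasiMeasurePreserving
        refine (cauchySchwarz_lintegral hζ (hf.comp_quasiMeasurePreserving hq)).trans_eq ?_
        congr 2
        exact lintegral_comp_sub_const (fun x => ‖f x‖ₑ ^ (2 : ℝ)) z
    _ = _ := by
        rw [lintegral_mul_const _ hD.measurable.enorm]
        have : ∫⁻ z, ‖D z‖ₑ = ENNReal.ofReal (∫ z, |D z|) := by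
          rw [ofReal_integral_eq_lintegral_ofReal (continuous_integrable hD.abs)
            (Eventually.of_forall fun z => abs_nonneg _)]
          simp only [Real.enorm_eq_ofReal_abs]
        rw [this]; ring

lemma laplace_conv_of_isWeakGrad {d n : ℕ} {K : ℝ} {R : Torus d → ℝ} (h : IsKernel n K R)
    {f : Torus d → ℝ} {G : Fin d → Torus d → ℝ} (hG : IsWeakGrad f G) (x : Torus d) :
    laplace (conv R f) x = ∑ i, conv (pderiv i R) (G i) x := by
  simp only [laplace]
  refine Finset.sum_congr rfl fun i _ => ?_
  have : pderiv i (conv R f) = conv R (G i) := funext (h.pderiv_conv_of_isWeakGrad hG i)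
  rw [this, h.finiteRank.pderiv_conv (hG.2.1 i)]

lemma IsKernel.pderiv_abs_le {d n : ℕ} {K : ℝ} {R : Torus d → ℝ} (h : IsKernel n K R)
    (i : Fin d) : ∫ z, |pderiv i R z| ≤ K * √n := by
  simpa using h.pderiv_moment i 0 (by norm_num)

/-- One derivative falls on the kernel and the other on f, so the cost is √n instead of n. -/
theorem enorm_integral_mul_laplace_le {d n : ℕ} {K γ : ℝ} {R : Torus d → ℝ} (h : IsKernel n K R)
    {f : Torus d → ℝ} {G : Fin d → Torus d → ℝ} (hG : IsWeakGrad f G)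
    (hγ : ∑ i, ∫⁻ x, ‖G i x‖ₑ ^ (2 : ℝ) ≤ ENNReal.ofReal γ)
    {ζ : Torus d → ℝ} {Z : ℝ} (hζ : AEStronglyMeasurable ζ) (hZ : ∀ᵐ x, |ζ x| ≤ Z) :
    ‖∫ x, ζ x * laplace (conv R f) x‖ₑ ≤ (∫⁻ x, ‖ζ x‖ₑ ^ (2 : ℝ)) ^ (1 / 2 : ℝ) *
      (d * (ENNReal.ofReal (K * √n) * ENNReal.ofReal γ ^ (1 / 2 : ℝ))) := by
  simp only [laplace_conv_of_isWeakGrad h hG, Finset.mul_sum]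
  have hi : ∀ i, Integrable fun x => ζ x * conv (pderiv i R) (G i) x := by
    intro i
    refine integrable_bdd_mul_shift hζ hZ ?_
    have : conv (pderiv i R) (G i) = pderiv i (conv R (G i)) :=
      funext fun x => (h.finiteRank.pderiv_conv (hG.2.1 i) i x).symm
    rw [this]
    exact ((h.finiteRank.smooth_conv (hG.2.1 i)).pderiv i).integrable
  rw [integral_finsetSum _ fun i _ => hi i]
  refine (enorm_sum_le _ _).trans ?_
  calc ∑ i, ‖∫ x, ζ x * conv (pderiv i R) (G i) x‖ₑ
      ≤ ∑ _i : Fin d, (∫⁻ x, ‖ζ x‖ₑ ^ (2 : ℝ)) ^ (1 / 2 : ℝ) *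
        (ENNReal.ofReal (K * √n) * ENNReal.ofReal γ ^ (1 / 2 : ℝ)) := by
        refine Finset.sum_le_sum fun i _ => ?_
        refine (enorm_integral_mul_conv_le (h.smooth.pderiv i).continuous (hG.2.1 i).1 hζ).trans ?_
        gcongr
        · exact h.pderiv_abs_le i
        · exact (Finset.single_le_sum (f := fun i => ∫⁻ x, ‖G i x‖ₑ ^ (2 : ℝ))
            (fun _ _ => zero_le) (Finset.mem_univ i)).trans hγ
    _ = _ := by
        simp only [Finset.sum_const, Finset.card_univ, Fintype.card_fin, nsmul_eq_mul]
        ring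

/-- Positive definiteness of the kernel: with R a sum of products a_j(x) a_j(y), the integral is
minus the sum of the squares of ∫ G_i a_j. -/
lemma integral_mul_laplace_conv_nonpos {d n : ℕ} {K : ℝ} {R : Torus d → ℝ} (h : IsKernel n K R)
    {f : Torus d → ℝ} {G : Fin d → Torus d → ℝ} (hG : IsWeakGrad f G) :
    ∫ x, f x * laplace (conv R f) x ≤ 0 := by
  obtain ⟨ι, _, a, ha, hR⟩ := h.finiteRank
  have h0 : ∀ i x, pderiv i (pderiv i (conv R f)) x =
      ∑ j, (∫ y, G i y * a j y) * pderiv i (a j) x := by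
    intro i x
    have : pderiv i (conv R f) = conv R (G i) := funext (h.pderiv_conv_of_isWeakGrad hG i)
    rw [this, pderiv_conv_eq_sum ha hR (hG.2.1 i)]
  have hi : ∀ φ, SmoothOnTorus φ → Integrable fun x => f x * φ x := fun φ hφ =>
    integrable_mul_continuous hφ.continuous hG.1
  simp only [laplace, h0, Finset.mul_sum]
  rw [integral_finsetSum]
  · refine Finset.sum_nonpos fun i _ => ?_
    rw [integral_finsetSum]
    · refine Finset.sum_nonpos fun j _ => ?_
      have h1 := hG.2.2 (a j) (ha j) i
      simp only [smul_eq_mul] at h1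
      have h2 : ∫ x, f x * ((∫ y, G i y * a j y) * pderiv i (a j) x) =
          (∫ y, G i y * a j y) * ∫ x, pderiv i (a j) x * f x := by
        rw [← integral_const_mul]
        exact integral_congr_ae (Eventually.of_forall fun x => by ring)
      have h3 : ∫ x, a j x * G i x = ∫ x, G i x * a j x :=
        integral_congr_ae (Eventually.of_forall fun x => by ring)
      rw [h2, h1, h3]
      nlinarith [sq_nonneg (∫ x, G i x * a j x)]
    · intro j _
      exact hi _ (((ha j).pderiv i).const_mul _)
  · intro i _
    exact integrable_finsetSum _ fun j _ => hi _ (((ha j).pderiv i).const_mul _)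

lemma lintegral_enorm_sq_eq {d : ℕ} {f : Torus d → ℝ} (hf : MemLp f 2) :
    ∫⁻ x, ‖f x‖ₑ ^ (2 : ℝ) = ENNReal.ofReal (∫ x, f x ^ 2) := by
  rw [ofReal_integral_eq_lintegral_ofReal hf.integrable_sq
    (Eventually.of_forall fun x => sq_nonneg _)]
  refine lintegral_congr fun x => ?_
  rw [Real.enorm_eq_ofReal_abs, ENNReal.ofReal_rpow_of_nonneg (abs_nonneg _) (by norm_num),
    Real.rpow_two, sq_abs]

lemma memLp_two_of_bound {d : ℕ} {f : Torus d → ℝ} {M : ℝ} (hf : AEStronglyMeasurable f)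
    (hM : ∀ᵐ x, |f x| ≤ M) : MemLp f 2 :=
  (memLp_top_of_bound hf M hM).mono_exponent le_top

lemma memLp_of_smooth {d : ℕ} {f : Torus d → ℝ} (hf : SmoothOnTorus f) (p : ℝ≥0∞) : MemLp f p := by
  obtain ⟨C, -, hC⟩ := hf.bounded
  exact (memLp_top_of_bound hf.continuous.aestronglyMeasurable C
    (Eventually.of_forall hC)).mono_exponent le_top

lemma SmoothOnTorus.integral_pow_mul_laplace {d : ℕ} {F : Torus d → ℝ} (hF : SmoothOnTorus F)
    (m : ℕ) : ∫ x, F x ^ m * AdvDiff.laplace F x =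
      - ∑ i, ∫ x, m * F x ^ (m - 1) * AdvDiff.pderiv i F x ^ 2 := by
  simp only [AdvDiff.laplace, Finset.mul_sum]
  rw [integral_finsetSum _ fun i _ => ((hF.pow m).mul ((hF.pderiv i).pderiv i)).integrable,
    ← Finset.sum_neg_distrib]
  refine Finset.sum_congr rfl fun i _ => ?_
  rw [(hF.pow m).integral_mul_pderiv (hF.pderiv i)]
  congr 1
  refine integral_congr_ae (Eventually.of_forall fun x => ?_)
  simp only [pderiv_pow hF]
  ring

lemma SmoothOnTorus.integral_pow_mul_laplace_nonpos {d : ℕ} {F : Torus d → ℝ}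
    (hF : SmoothOnTorus F) (k : ℕ) : ∫ x, F x ^ (2 * k + 1) * AdvDiff.laplace F x ≤ 0 := by
  rw [hF.integral_pow_mul_laplace, neg_nonpos]
  refine Finset.sum_nonneg fun i _ => integral_nonneg fun x => ?_
  rw [Nat.add_sub_cancel]
  have : 0 ≤ F x ^ (2 * k) := by rw [pow_mul]; positivity
  positivity

lemma integral_conv_mul_laplace_ge {d n : ℕ} {K γ : ℝ} (hγ0 : 0 ≤ γ) {R : Torus d → ℝ} (h : IsKernel n K R)
    {f : Torus d → ℝ} {G : Fin d → Torus d → ℝ} (hG : IsWeakGrad f G)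
    (hγ : ∑ i, ∫⁻ x, ‖G i x‖ₑ ^ (2 : ℝ) ≤ ENNReal.ofReal γ) :
    -γ ≤ ∫ x, conv R f x * laplace (conv R f) x := by
  have hF := h.finiteRank.smooth_conv hG.1
  have h1 := hF.integral_pow_mul_laplace 1
  simp only [pow_one, Nat.cast_one, Nat.sub_self, pow_zero, mul_one, one_mul] at h1
  rw [h1, neg_le_neg_iff]
  have h2 : ENNReal.ofReal (∑ i, ∫ x, pderiv i (conv R f) x ^ 2) ≤ ENNReal.ofReal γ := by
    rw [ENNReal.ofReal_sum_of_nonneg fun i _ => integral_nonneg fun x => sq_nonneg _]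
    refine le_trans (Finset.sum_le_sum fun i _ => ?_) hγ
    rw [← lintegral_enorm_sq_eq (memLp_of_smooth (hF.pderiv i) 2)]
    simp only [h.pderiv_conv_of_isWeakGrad hG]
    exact lintegral_conv_rpow_le h (hG.2.1 i).1 (by norm_num)
  exact (ENNReal.ofReal_le_ofReal_iff hγ0).1 h2

lemma incrSq_le_of_grad {d : ℕ} (hd : 0 < d) {γ : ℝ} {f : Torus d → ℝ} {G : Fin d → Torus d → ℝ}
    (hG : IsWeakGrad f G) (hγ : ∑ i, ∫⁻ x, ‖G i x‖ₑ ^ (2 : ℝ) ≤ ENNReal.ofReal γ) (z : Torus d) :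
    incrSq f z ≤ ENNReal.ofReal (‖z‖ ^ 2 * (d * γ)) := by
  refine (hG.lintegral_shift_le hd (p := 2) (by norm_num) z).trans ?_
  have e : ‖z‖ₑ ^ (2 : ℝ) = ENNReal.ofReal (‖z‖ ^ 2) := by
    rw [← enorm_norm, Real.enorm_of_nonneg (norm_nonneg z),
      ENNReal.ofReal_rpow_of_nonneg (norm_nonneg z) (by norm_num), Real.rpow_two]
  rw [ENNReal.ofReal_mul (by positivity), ENNReal.ofReal_mul (by positivity), e,
    ENNReal.ofReal_natCast, show (2 : ℝ) - 1 = 1 by norm_num, ENNReal.rpow_one]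
  gcongr

lemma lintegral_conv_sub_sq_le {d n : ℕ} (hd : 0 < d) (hn : 1 ≤ n) {K γ : ℝ} (hγ0 : 0 ≤ γ)
    {R : Torus d → ℝ} (h : IsKernel n K R) {f : Torus d → ℝ} {G : Fin d → Torus d → ℝ}
    (hG : IsWeakGrad f G) (hγ : ∑ i, ∫⁻ x, ‖G i x‖ₑ ^ (2 : ℝ) ≤ ENNReal.ofReal γ) :
    ∫⁻ x, ‖conv R f x - f x‖ₑ ^ (2 : ℝ) ≤ ENNReal.ofReal (K / n * (d * γ)) := by
  have hc := h.continuous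
  calc _ ≤ ∫⁻ z, ENNReal.ofReal (R z) * incrSq f z :=
        lintegral_conv_sub_rpow_le h hG.1 (by norm_num)
    _ ≤ ∫⁻ z, ENNReal.ofReal (‖z‖ ^ 2 * R z * (d * γ)) := by
        refine lintegral_mono fun z => ?_
        rw [show ‖z‖ ^ 2 * R z * (d * γ) = R z * (‖z‖ ^ 2 * (d * γ)) by ring,
          ENNReal.ofReal_mul (h.nonneg z)]
        gcongr
        exact incrSq_le_of_grad hd hG hγ z
    _ = ENNReal.ofReal (∫ z, ‖z‖ ^ 2 * R z * (d * γ)) := by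
        rw [ofReal_integral_eq_lintegral_ofReal (continuous_integrable (by fun_prop))
          (Eventually.of_forall fun z => by have := h.nonneg z; positivity)]
    _ ≤ _ := by
        rw [integral_mul_const]
        gcongr
        exact h.norm_sq_moment hn

lemma abs_conv_le {d n : ℕ} {K M : ℝ} {R : Torus d → ℝ} (h : IsKernel n K R) {f : Torus d → ℝ}
    (hM : ∀ᵐ x, |f x| ≤ M) (x : Torus d) : |conv R f x| ≤ M := by
  have h1 : ∀ᵐ y, ‖R (x - y) * f y‖ ≤ R (x - y) * M := by
    filter_upwards [hM] with y hy
    rw [norm_mul, Real.norm_of_nonneg (h.nonneg _)]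
    exact mul_le_mul_of_nonneg_left hy (h.nonneg _)
  have h2 : ∫ y, R (x - y) = 1 := by
    rw [integral_sub_left_eq_self R volume x, h.integral_eq_one]
  calc |conv R f x| ≤ ∫ y, R (x - y) * M := norm_integral_le_of_norm_le
        ((continuous_integrable (h.continuous.comp (continuous_sub_left x))).mul_const M) h1
    _ = M := by rw [integral_mul_const, h2, one_mul]

/-- Differentiating the kernel costs √n, so the L^∞ bound alone yields a Lipschitz constant of order
√n. -/
lemma abs_conv_shift_le {d n : ℕ} {K M : ℝ} (hM0 : 0 ≤ M) {R : Torus d → ℝ} (h : IsKernel n K R)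
    {f : Torus d → ℝ} (hf : AEStronglyMeasurable f)
    (hM : ∀ᵐ x, |f x| ≤ M) (x : Torus d) (y : Euc d) :
    |conv R f (x + proj y) - conv R f x| ≤ ‖y‖ * (d * (K * √n * M)) := by
  have hfi : Integrable f := (memLp_top_of_bound hf M hM).integrable le_top
  have hF := h.finiteRank.smooth_conv hfi
  have hK := h.one_le
  have h1 : ∀ i x, |pderiv i (conv R f) x| ≤ K * √n * M := by
    intro i x
    have hc := (h.smooth.pderiv i).continuous
    rw [h.finiteRank.pderiv_conv hfi]
    have h2 : ∀ᵐ y, ‖pderiv i R (x - y) * f y‖ ≤ |pderiv i R (x - y)| * M := by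
      filter_upwards [hM] with y hy
      rw [norm_mul]
      exact mul_le_mul_of_nonneg_left hy (abs_nonneg _)
    calc |conv (pderiv i R) f x| ≤ ∫ y, |pderiv i R (x - y)| * M := norm_integral_le_of_norm_le
          ((continuous_integrable (hc.abs.comp (continuous_sub_left x))).mul_const M) h2
      _ = (∫ z, |pderiv i R z|) * M := by
          rw [integral_mul_const, integral_sub_left_eq_self (fun z => |pderiv i R z|) volume x]
      _ ≤ _ := by gcongr; exact h.pderiv_abs_le i
  have h3 := hF.enorm_shift_le (y := y) (c := ‖y‖) (fun i => by
    simpa using EuclideanSpace.norm_eq y ▸ PiLp.norm_apply_le y i) x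
  have h4 : ‖conv R f (x + proj y) - conv R f x‖ₑ ≤ ENNReal.ofReal (‖y‖ * (d * (K * √n * M))) := by
    refine h3.trans ?_
    calc _ ≤ ∫⁻ _s in Set.Ioc (0 : ℝ) 1, ENNReal.ofReal (‖y‖ * (d * (K * √n * M))) := by
          refine lintegral_mono fun s => ?_
          rw [ENNReal.ofReal_mul (norm_nonneg y), ENNReal.ofReal_mul (by positivity),
            ENNReal.ofReal_natCast]
          gcongr
          calc _ ≤ ∑ _i : Fin d, ENNReal.ofReal (K * √n * M) := by
                refine Finset.sum_le_sum fun i _ => ?_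
                rw [Real.enorm_eq_ofReal_abs]
                exact ENNReal.ofReal_le_ofReal (h1 i _)
            _ = _ := by simp
      _ = _ := by simp
  rw [Real.enorm_eq_ofReal_abs] at h4
  exact (ENNReal.ofReal_le_ofReal_iff (by positivity)).1 h4

end AdvDiff

end

/-! ### Absolutely continuous coefficients in time and weak solutions. -/

noncomputable section

namespace AdvDiff

lemma continuous_primitive {f : ℝ → ℝ} (hf : Integrable f) (c : ℝ) :
    Continuous fun s => c + ∫ σ in (0 : ℝ)..s, f σ :=
  continuous_const.add
    (intervalIntegral.continuous_primitive (fun _ _ => hf.intervalIntegrable) 0)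

lemma abs_primitive_le {f : ℝ → ℝ} (hf : Integrable f) (c s : ℝ) :
    |c + ∫ σ in (0 : ℝ)..s, f σ| ≤ |c| + ∫ σ, |f σ| := by
  refine (abs_add_le _ _).trans (add_le_add le_rfl ?_)
  have h1 : |∫ σ in (0 : ℝ)..s, f σ| ≤ ∫ σ in Set.uIoc 0 s, ‖f σ‖ :=
    intervalIntegral.norm_integral_le_integral_norm_uIoc (E := ℝ)
  refine h1.trans ?_
  exact setIntegral_le_integral hf.norm (Eventually.of_forall fun _ => norm_nonneg _)

lemma integrable_mul_primitive {f g : ℝ → ℝ} (hf : Integrable f) (hg : Integrable g) (c : ℝ) :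
    Integrable fun s => f s * (c + ∫ σ in (0 : ℝ)..s, g σ) :=
  hf.mul_bdd (continuous_primitive hg c).aestronglyMeasurable
    (Eventually.of_forall fun s => abs_primitive_le hg c s)

lemma deriv_primitive_ae {f : ℝ → ℝ} (hf : Integrable f) (c a : ℝ) :
    ∀ᵐ s, s ∈ Set.uIcc 0 a → deriv (fun s => c + ∫ σ in (0 : ℝ)..s, f σ) s = f s := by
  filter_upwards [(hf.intervalIntegrable (a := 0) (b := a)).ae_hasDerivAt_integral] with s hs h
  exact ((hs h 0 Set.left_mem_uIcc).const_add c).deriv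

/-- The drift is merely measurable in time, so the coefficients ∫ w a_j are only primitives of
integrable functions; the product rule is that of absolutely continuous functions. -/
lemma primitive_mul {f g : ℝ → ℝ} (hf : Integrable f) (hg : Integrable g) (c c' s : ℝ) :
    (c + ∫ σ in (0 : ℝ)..s, f σ) * (c' + ∫ σ in (0 : ℝ)..s, g σ) = c * c' +
      ∫ σ in (0 : ℝ)..s, (f σ * (c' + ∫ ρ in (0 : ℝ)..σ, g ρ) +
        (c + ∫ ρ in (0 : ℝ)..σ, f ρ) * g σ) := by
  have hac : ∀ {h : ℝ → ℝ}, Integrable h → ∀ e : ℝ,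
      AbsolutelyContinuousOnInterval (fun s => e + ∫ σ in (0 : ℝ)..s, h σ) 0 s := by
    intro h hh e
    refine AbsolutelyContinuousOnInterval.add (f := fun _ => e) ?_
      (hh.intervalIntegrable.absolutelyContinuousOnInterval_intervalIntegral Set.left_mem_uIcc)
    exact (LipschitzWith.const e).lipschitzOnWith.absolutelyContinuousOnInterval
  have h1 := (hac hf c).integral_deriv_mul_eq_sub (hac hg c')
  simp only [intervalIntegral.integral_same, add_zero] at h1
  have h2 : ∫ σ in (0 : ℝ)..s, (f σ * (c' + ∫ ρ in (0 : ℝ)..σ, g ρ) +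
      (c + ∫ ρ in (0 : ℝ)..σ, f ρ) * g σ) =
      ∫ x in (0 : ℝ)..s, deriv (fun s => c + ∫ σ in (0 : ℝ)..s, f σ) x *
        (c' + ∫ σ in (0 : ℝ)..x, g σ) + (c + ∫ σ in (0 : ℝ)..x, f σ) *
          deriv (fun s => c' + ∫ σ in (0 : ℝ)..s, g σ) x := by
    refine intervalIntegral.integral_congr_ae ?_
    filter_upwards [deriv_primitive_ae hf c s, deriv_primitive_ae hg c' s] with x hx hx' hm
    rw [hx (Set.uIoc_subset_uIcc hm), hx' (Set.uIoc_subset_uIcc hm)]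
  rw [h2, h1]
  ring

lemma primitive_pow {f : ℝ → ℝ} (hf : Integrable f) (c : ℝ) (m : ℕ) (s : ℝ) :
    (c + ∫ σ in (0 : ℝ)..s, f σ) ^ m = c ^ m +
      ∫ σ in (0 : ℝ)..s, m * ((c + ∫ ρ in (0 : ℝ)..σ, f ρ) ^ (m - 1) * f σ) := by
  induction m generalizing s with
  | zero => simp
  | succ m ih =>
    set g : ℝ → ℝ := fun σ => m * ((c + ∫ ρ in (0 : ℝ)..σ, f ρ) ^ (m - 1) * f σ) with hg
    have hgi : Integrable g := by
      refine Integrable.const_mul (hf.bdd_mul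
        ((continuous_primitive hf c).pow _).aestronglyMeasurable
        (c := (|c| + ∫ σ, |f σ|) ^ (m - 1)) (Eventually.of_forall fun s => ?_)) _
      rw [Pi.pow_apply, norm_pow]
      exact pow_le_pow_left₀ (norm_nonneg _) (abs_primitive_le hf c s) _
    rw [pow_succ, ih s, primitive_mul hgi hf, ← pow_succ]
    congr 1
    refine intervalIntegral.integral_congr fun σ _ => ?_
    simp only [← ih σ]
    simp only [hg, Nat.add_sub_cancel]
    push_cast
    -- The case m = 0 is separate because of the truncated exponent m - 1.
    rcases m with _ | m
    · simp
    · simp only [Nat.add_sub_cancel]; push_cast; ring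

/-- The chain rule for powers of a finite sum with absolutely continuous coefficients. -/
lemma integral_sum_primitive_pow {d : ℕ} {ι : Type*} [Fintype ι] {a : ι → Torus d → ℝ}
    (ha : ∀ j, Continuous (a j)) {α : ι → ℝ → ℝ} (hα : ∀ j, Integrable (α j)) (c : ι → ℝ)
    (m : ℕ) (t : ℝ) :
    let F : ℝ → Torus d → ℝ := fun s x => ∑ j, (c j + ∫ σ in (0 : ℝ)..s, α j σ) * a j x
    Integrable (fun s => ∫ x, m * (F s x ^ (m - 1) * ∑ j, α j s * a j x)) ∧
    ∫ x, F t x ^ m = (∫ x, F 0 x ^ m) +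
      ∫ s in (0 : ℝ)..t, ∫ x, m * (F s x ^ (m - 1) * ∑ j, α j s * a j x) := by
  intro F
  have hFp : ∀ s x, F s x = (∑ j, c j * a j x) + ∫ σ in (0 : ℝ)..s, ∑ j, α j σ * a j x := by
    intro s x
    rw [intervalIntegral.integral_finsetSum fun j _ => ((hα j).mul_const _).intervalIntegrable]
    simp only [F, add_mul, Finset.sum_add_distrib, intervalIntegral.integral_mul_const]
  have hi : ∀ x, Integrable fun σ => ∑ j, α j σ * a j x := fun x =>
    integrable_finsetSum _ fun j _ => (hα j).mul_const _
  have hFc : Continuous fun q : ℝ × Torus d => F q.1 q.2 :=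
    continuous_finsetSum _ fun j _ =>
      ((continuous_primitive (hα j) (c j)).comp continuous_fst).mul ((ha j).comp continuous_snd)
  obtain ⟨C, hC0, hC⟩ : ∃ C : ℝ, 0 ≤ C ∧ ∀ s x, |F s x| ≤ C := by
    choose Ca hCa0 hCa using fun j => continuous_bounded (ha j)
    refine ⟨∑ j, (|c j| + ∫ σ, |α j σ|) * Ca j, Finset.sum_nonneg fun j _ => ?_, fun s x => ?_⟩
    · exact mul_nonneg (add_nonneg (abs_nonneg _) (integral_nonneg fun _ => abs_nonneg _)) (hCa0 j)
    · refine (Finset.abs_sum_le_sum_abs _ _).trans (Finset.sum_le_sum fun j _ => ?_)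
      rw [abs_mul]
      exact mul_le_mul (abs_primitive_le (hα j) _ _) (hCa j x) (abs_nonneg _)
        (add_nonneg (abs_nonneg _) (integral_nonneg fun _ => abs_nonneg _))
  have hprod : Integrable (fun q : ℝ × Torus d =>
      m * (F q.1 q.2 ^ (m - 1) * ∑ j, α j q.1 * a j q.2)) (volume.prod volume) := by
    refine Integrable.const_mul (Integrable.bdd_mul (c := C ^ (m - 1))
      (integrable_finsetSum _ fun j _ => (hα j).mul_prod (continuous_integrable (ha j)))
      (hFc.pow _).aestronglyMeasurable (Eventually.of_forall fun q => ?_)) _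
    rw [Pi.pow_apply, norm_pow]
    exact pow_le_pow_left₀ (norm_nonneg _) (hC _ _) _
  refine ⟨hprod.integral_prod_left, ?_⟩
  have hpow : ∀ x, F t x ^ m = F 0 x ^ m +
      ∫ s in (0 : ℝ)..t, m * (F s x ^ (m - 1) * ∑ j, α j s * a j x) := by
    intro x
    have := primitive_pow (hi x) (∑ j, c j * a j x) m t
    simp only [← hFp] at this
    rw [this]
    congr 2
    simp [F]
  have hcont : ∀ s, Continuous fun x => F s x ^ m := fun s =>
    (hFc.comp (Continuous.prodMk continuous_const continuous_id)).pow m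
  have hr : Integrable (Function.uncurry fun s x =>
      m * (F s x ^ (m - 1) * ∑ j, α j s * a j x)) ((volume.restrict (Set.uIoc 0 t)).prod volume) := by
    have : ((volume : Measure ℝ).restrict (Set.uIoc 0 t)).prod (volume : Measure (Torus d)) =
        (volume.prod volume).restrict (Set.uIoc 0 t ×ˢ Set.univ) := by
      rw [← Measure.prod_restrict, Measure.restrict_univ]
    rw [this]
    exact hprod.restrict
  rw [intervalIntegral_integral_swap hr, ← integral_add (continuous_integrable (hcont 0))]
  · exact integral_congr_ae (Eventually.of_forall hpow)
  · have e : (fun x => ∫ s in (0 : ℝ)..t, m * (F s x ^ (m - 1) * ∑ j, α j s * a j x)) =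
        fun x => F t x ^ m - F 0 x ^ m := funext fun x => by rw [hpow x]; ring
    rw [e]
    exact (continuous_integrable (hcont t)).sub (continuous_integrable (hcont 0))

/-- A drift which is measurable in space and time and satisfies uniform bounds in time. -/
structure IsTimeDrift {d : ℕ} (τ p B : ℝ) (b : ℝ → Torus d → Euc d) : Prop where
  meas : ∀ i, AEStronglyMeasurable (fun q : ℝ × Torus d => b q.1 q.2 i)
    ((volume.restrict (Set.Icc 0 τ)).prod volume)
  drift : ∀ᵐ s ∂volume.restrict (Set.Icc 0 τ), IsDrift p B (b s)
  bound : ∀ᵐ s ∂volume.restrict (Set.Icc 0 τ), ∀ i, ∫ x, |b s x i| ≤ B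

/-- The rate of change of `⟨w, φ⟩` along the advection-diffusion equation. -/
def rate {d : ℕ} (b : ℝ → Torus d → Euc d) (ν : ℝ) (w : ℝ → Torus d → ℝ) (φ : Torus d → ℝ)
    (σ : ℝ) : ℝ :=
  ∫ x, w σ x * ((∑ i, b σ x i * pderiv i φ x) + ν * laplace φ x)

lemma integrableOn_rate {d : ℕ} {τ ν M p B : ℝ} {b : ℝ → Torus d → Euc d}
    {w : ℝ → Torus d → ℝ} (hM : ∀ s ∈ Set.Icc 0 τ, ∀ᵐ x, |w s x| ≤ M)
    (hb : IsTimeDrift τ p B b) {φ : Torus d → ℝ} (hφ : SmoothOnTorus φ)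
    (hm : AEStronglyMeasurable (rate b ν w φ) (volume.restrict (Set.Icc 0 τ))) :
    IntegrableOn (rate b ν w φ) (Set.Icc 0 τ) := by
  choose C hC0 hC using fun i => (hφ.pderiv i).bounded
  obtain ⟨C', hC'0, hC'⟩ := hφ.laplace.bounded
  refine Integrable.of_bound (C := M * ((∑ i, B * C i) + |ν| * C')) hm ?_
  filter_upwards [hb.drift, hb.bound, ae_restrict_mem measurableSet_Icc] with s hd hbd hs
  have hM0 : 0 ≤ M := by
    obtain ⟨x, hx⟩ := (hM s hs).exists
    exact (abs_nonneg _).trans hx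
  have hi : Integrable fun x => M * ((∑ i, |b s x i| * C i) + |ν| * C') :=
    ((integrable_finsetSum _ fun i _ => ((hd.integrable i).abs.mul_const _)).add
      (integrable_const _)).const_mul _
  refine (norm_integral_le_of_norm_le hi ?_).trans ?_
  · filter_upwards [hM s hs] with x hx
    rw [norm_mul]
    refine mul_le_mul hx ((norm_add_le _ _).trans (add_le_add ?_ ?_)) (norm_nonneg _) hM0
    · refine (norm_sum_le _ _).trans (Finset.sum_le_sum fun i _ => ?_)
      rw [norm_mul]
      exact mul_le_mul_of_nonneg_left (hC i x) (norm_nonneg _)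
    · rw [norm_mul]
      exact mul_le_mul_of_nonneg_left (hC' x) (norm_nonneg _)
  · rw [integral_const_mul, integral_add (integrable_finsetSum _ fun i _ =>
      ((hd.integrable i).abs.mul_const _)) (integrable_const _),
      integral_finsetSum _ fun i _ => ((hd.integrable i).abs.mul_const _)]
    simp only [integral_mul_const, integral_const, probReal_univ, smul_eq_mul, one_mul]
    refine mul_le_mul_of_nonneg_left (add_le_add (Finset.sum_le_sum fun i _ => ?_) le_rfl) hM0
    exact mul_le_mul_of_nonneg_right (hbd i) (hC0 i)

/-- Bounded weak solutions of the advection-diffusion equation on `[0, τ]`, in the form integrated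
in time. -/
structure WeakSol {d : ℕ} (τ : ℝ) (b : ℝ → Torus d → Euc d) (ν M : ℝ)
    (w : ℝ → Torus d → ℝ) : Prop where
  rate_meas : ∀ φ : Torus d → ℝ, SmoothOnTorus φ →
    AEStronglyMeasurable (rate b ν w φ) (volume.restrict (Set.Icc 0 τ))
  smeas : ∀ s ∈ Set.Icc 0 τ, AEStronglyMeasurable (w s)
  bdd : ∀ s ∈ Set.Icc 0 τ, ∀ᵐ x, |w s x| ≤ M
  eqn : ∀ φ : Torus d → ℝ, SmoothOnTorus φ → ∀ s ∈ Set.Icc 0 τ,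
    ∫ x, w s x * φ x = (∫ x, w 0 x * φ x) + ∫ σ in (0 : ℝ)..s, rate b ν w φ σ

lemma WeakSol.integrable {d : ℕ} {τ ν M : ℝ} {b : ℝ → Torus d → Euc d} {w : ℝ → Torus d → ℝ}
    (hw : WeakSol τ b ν M w) {s : ℝ} (hs : s ∈ Set.Icc 0 τ) : Integrable (w s) :=
  (memLp_top_of_bound (hw.smeas s hs) M (hw.bdd s hs)).integrable le_top

lemma WeakSol.rate_integrable {d : ℕ} {τ ν M p B : ℝ} {b : ℝ → Torus d → Euc d}
    {w : ℝ → Torus d → ℝ} (hw : WeakSol τ b ν M w) (hb : IsTimeDrift τ p B b)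
    {φ : Torus d → ℝ} (hφ : SmoothOnTorus φ) :
    IntegrableOn (rate b ν w φ) (Set.Icc 0 τ) :=
  integrableOn_rate hw.bdd hb hφ (hw.rate_meas φ hφ)

/-- Rates are extended by zero outside [0, τ], so that statements on primitives of globally
integrable functions apply; primitives inside the interval are unchanged. -/
lemma integral_indicator_primitive {τ s : ℝ} (hs : s ∈ Set.Icc 0 τ) (f : ℝ → ℝ) :
    ∫ σ in (0 : ℝ)..s, (Set.Icc 0 τ).indicator f σ = ∫ σ in (0 : ℝ)..s, f σ := by
  refine intervalIntegral.integral_congr fun σ hσ => ?_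
  rw [Set.uIcc_of_le hs.1] at hσ
  exact Set.indicator_of_mem (Set.mem_Icc.2 ⟨hσ.1, hσ.2.trans hs.2⟩) f

/-- The source term in the equation for `conv R w`. -/
def source {d : ℕ} (R : Torus d → ℝ) (b : Torus d → Euc d) (ν : ℝ) (f : Torus d → ℝ)
    (x : Torus d) : ℝ :=
  commutator R b f x + ν * laplace (conv R f) x

/-- The first sum is the time derivative of the mollified solution. The identity says that this
solution satisfies the transport equation with right-hand side `source`. -/
lemma source_eq_add {d n : ℕ} {K p B M τ ν s : ℝ} {R : Torus d → ℝ} (h : IsKernel n K R)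
    {ι : Type*} [Fintype ι] {a : ι → Torus d → ℝ} (ha : ∀ j, SmoothOnTorus (a j))
    (hR : ∀ x y, R (x - y) = ∑ j, a j x * a j y) {b : ℝ → Torus d → Euc d}
    {w : ℝ → Torus d → ℝ} (hw : WeakSol τ b ν M w) (hs : s ∈ Set.Icc 0 τ) (hb : IsDrift p B (b s))
    (x : Torus d) :
    source R (b s) ν (w s) x = (∑ j, rate b ν w (a j) s * a j x) +
      ∑ i, b s x i * pderiv i (conv R (w s)) x := by
  have hr : ∀ j, rate b ν w (a j) s = (∫ y, w s y * ∑ i, b s y i * pderiv i (a j) y) +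
      ν * ∫ y, w s y * laplace (a j) y := by
    intro j
    rw [← integral_const_mul, ← integral_add
      (integrable_drift_mul hb (hw.smeas s hs) (hw.bdd s hs) fun i => ((ha j).pderiv i).continuous)
      ((integrable_mul_continuous (ha j).laplace.continuous (hw.integrable hs)).const_mul ν)]
    refine integral_congr_ae (Eventually.of_forall fun y => ?_)
    simp only
    ring
  rw [source, commutator_eq_add h ha hR hb (hw.smeas s hs) (hw.bdd s hs),
    laplace_conv_eq h ha hR (hw.integrable hs)]
  simp only [hr, add_mul, Finset.sum_add_distrib, Finset.mul_sum, mul_assoc]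
  ring

end AdvDiff

end

/-! ### Balance laws for mollified solutions. -/

noncomputable section

namespace AdvDiff

lemma integrable_indicator_rate {d : ℕ} {τ ν M p B : ℝ} {b : ℝ → Torus d → Euc d}
    {w : ℝ → Torus d → ℝ} (hw : WeakSol τ b ν M w) (hb : IsTimeDrift τ p B b)
    {φ : Torus d → ℝ} (hφ : SmoothOnTorus φ) :
    Integrable ((Set.Icc 0 τ).indicator (rate b ν w φ)) :=
  (integrable_indicator_iff measurableSet_Icc).2 (hw.rate_integrable hb hφ)

lemma WeakSol.eqn_indicator {d : ℕ} {τ ν M : ℝ} {b : ℝ → Torus d → Euc d}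
    {w : ℝ → Torus d → ℝ} (hw : WeakSol τ b ν M w) {φ : Torus d → ℝ} (hφ : SmoothOnTorus φ)
    {s : ℝ} (hs : s ∈ Set.Icc 0 τ) :
    ∫ x, w s x * φ x = (∫ x, w 0 x * φ x) +
      ∫ σ in (0 : ℝ)..s, (Set.Icc 0 τ).indicator (rate b ν w φ) σ := by
  rw [hw.eqn φ hφ s hs, integral_indicator_primitive hs]

lemma intervalIntegrable_congr_ae_Icc {f g : ℝ → ℝ} {τ t : ℝ} (ht : t ∈ Set.Icc 0 τ)
    (hf : Integrable f) (hfg : ∀ᵐ s ∂volume.restrict (Set.Icc 0 τ), f s = g s) :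
    IntervalIntegrable g volume 0 t ∧ ∫ s in (0 : ℝ)..t, f s = ∫ s in (0 : ℝ)..t, g s := by
  have h1 : ∀ᵐ s ∂volume.restrict (Set.uIoc 0 t), f s = g s := by
    rw [Set.uIoc_of_le ht.1]
    exact ae_restrict_of_ae_restrict_of_subset
      (Set.Ioc_subset_Icc_self.trans (Set.Icc_subset_Icc_right ht.2)) hfg
  exact ⟨hf.intervalIntegrable.congr_ae h1,
    intervalIntegral.integral_congr_ae ((ae_restrict_iff' measurableSet_uIoc).1 h1)⟩

/-- The chain rule produces the integral of b · ∇(F^m), which vanishes because F^m is smooth and b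
is divergence free; only the source remains. -/
theorem WeakSol.integral_conv_pow {d n : ℕ} {K τ ν M p B : ℝ} {R : Torus d → ℝ}
    (h : IsKernel n K R) {b : ℝ → Torus d → Euc d} {w : ℝ → Torus d → ℝ}
    (hw : WeakSol τ b ν M w) (hb : IsTimeDrift τ p B b) (m : ℕ) {t : ℝ} (ht : t ∈ Set.Icc 0 τ) :
    IntervalIntegrable (fun s => ∫ x, m * (conv R (w s) x ^ (m - 1) * source R (b s) ν (w s) x))
      volume 0 t ∧
    ∫ x, conv R (w t) x ^ m = (∫ x, conv R (w 0) x ^ m) +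
      ∫ s in (0 : ℝ)..t, ∫ x, m * (conv R (w s) x ^ (m - 1) * source R (b s) ν (w s) x) := by
  obtain ⟨ι, _, a, ha, hR⟩ := h.finiteRank
  have h0 : (0 : ℝ) ∈ Set.Icc 0 τ := ⟨le_rfl, ht.1.trans ht.2⟩
  obtain ⟨hi, he⟩ := integral_sum_primitive_pow (fun j => (ha j).continuous)
    (fun j => integrable_indicator_rate hw hb (ha j)) (fun j => ∫ x, w 0 x * a j x) m t
  have hF : ∀ s ∈ Set.Icc 0 τ, ∀ x, ∑ j, ((∫ x, w 0 x * a j x) +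
      ∫ σ in (0 : ℝ)..s, (Set.Icc 0 τ).indicator (rate b ν w (a j)) σ) * a j x =
      conv R (w s) x := by
    intro s hs x
    rw [conv_eq_sum ha hR (hw.integrable hs)]
    simp only [hw.eqn_indicator (ha _) hs]
  simp only [hF t ht, hF 0 h0] at he
  have hae : ∀ᵐ s ∂volume.restrict (Set.Icc 0 τ),
      (∫ x, m * ((∑ j, ((∫ x, w 0 x * a j x) +
        ∫ σ in (0 : ℝ)..s, (Set.Icc 0 τ).indicator (rate b ν w (a j)) σ) * a j x) ^ (m - 1) *
        ∑ j, (Set.Icc 0 τ).indicator (rate b ν w (a j)) s * a j x)) =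
      ∫ x, m * (conv R (w s) x ^ (m - 1) * source R (b s) ν (w s) x) := by
    filter_upwards [hb.drift, ae_restrict_mem measurableSet_Icc] with s hd hs
    have hFs := h.finiteRank.smooth_conv (hw.integrable hs)
    have hi1 : Integrable fun x => m * (conv R (w s) x ^ (m - 1) *
        ∑ j, rate b ν w (a j) s * a j x) :=
      continuous_integrable (((hFs.pow _).continuous.mul
        (continuous_finsetSum _ fun j _ => (ha j).continuous.const_mul _)).const_mul _)
    have hi2 : Integrable fun x => ∑ i, b s x i * pderiv i (fun x => conv R (w s) x ^ m) x :=
      integrable_finsetSum _ fun i _ =>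
        integrable_mul_continuous ((hFs.pow m).pderiv i).continuous (hd.integrable i)
    have e : ∀ x, m * (conv R (w s) x ^ (m - 1) * source R (b s) ν (w s) x) =
        m * (conv R (w s) x ^ (m - 1) * ∑ j, rate b ν w (a j) s * a j x) +
          ∑ i, b s x i * pderiv i (fun x => conv R (w s) x ^ m) x := by
      intro x
      rw [source_eq_add h ha hR hw hs hd, mul_add, mul_add]
      congr 1
      rw [Finset.mul_sum, Finset.mul_sum]
      refine Finset.sum_congr rfl fun i _ => ?_
      rw [pderiv_pow hFs]
      ring
    simp only [e]
    rw [integral_add hi1 hi2, hd.div_eq_zero _ (hFs.pow m), add_zero]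
    simp only [hF s hs, Set.indicator_of_mem hs]
  obtain ⟨h1, h2⟩ := intervalIntegrable_congr_ae_Icc ht hi hae
  exact ⟨h1, by rw [he, h2]⟩

/-- By finite rank the pairing is a finite sum of products of scalar functions of time, so only w is
mollified and v stays rough. The advection of w is cancelled by the advection in the equation for v
tested with the mollified w. -/
theorem WeakSol.integral_mul_conv {d n : ℕ} {K τ ν ν' M M' p B : ℝ} {R : Torus d → ℝ}
    (h : IsKernel n K R) {b : ℝ → Torus d → Euc d} {v w : ℝ → Torus d → ℝ}
    (hv : WeakSol τ b ν' M' v) (hw : WeakSol τ b ν M w) (hb : IsTimeDrift τ p B b)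
    {t : ℝ} (ht : t ∈ Set.Icc 0 τ) :
    IntervalIntegrable (fun s => ∫ x, v s x * (source R (b s) ν (w s) x +
      ν' * laplace (conv R (w s)) x)) volume 0 t ∧
    ∫ x, v t x * conv R (w t) x = (∫ x, v 0 x * conv R (w 0) x) +
      ∫ s in (0 : ℝ)..t, ∫ x, v s x * (source R (b s) ν (w s) x +
        ν' * laplace (conv R (w s)) x) := by
  obtain ⟨ι, _, a, ha, hR⟩ := h.finiteRank
  have h0 : (0 : ℝ) ∈ Set.Icc 0 τ := ⟨le_rfl, ht.1.trans ht.2⟩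
  have hva : ∀ s ∈ Set.Icc 0 τ, ∫ x, v s x * conv R (w s) x =
      ∑ j, (∫ x, w s x * a j x) * ∫ x, v s x * a j x := by
    intro s hs
    simp only [conv_eq_sum ha hR (hw.integrable hs), Finset.mul_sum]
    rw [integral_finsetSum _ fun j _ => integrable_mul_continuous
      ((ha j).continuous.const_mul _) (hv.integrable hs)]
    refine Finset.sum_congr rfl fun j _ => ?_
    rw [← integral_const_mul]
    exact integral_congr_ae (Eventually.of_forall fun x => by simp only; ring)
  have hi := fun j => integrable_indicator_rate hw hb (ha j)
  have hi' := fun j => integrable_indicator_rate hv hb (ha j)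
  have hint : ∀ j, Integrable fun σ => (Set.Icc 0 τ).indicator (rate b ν w (a j)) σ *
      ((∫ x, v 0 x * a j x) + ∫ ρ in (0 : ℝ)..σ, (Set.Icc 0 τ).indicator (rate b ν' v (a j)) ρ) +
      ((∫ x, w 0 x * a j x) + ∫ ρ in (0 : ℝ)..σ, (Set.Icc 0 τ).indicator (rate b ν w (a j)) ρ) *
      (Set.Icc 0 τ).indicator (rate b ν' v (a j)) σ := by
    intro j
    refine (integrable_mul_primitive (hi j) (hi' j) _).add ?_
    simpa only [mul_comm] using integrable_mul_primitive (hi' j) (hi j) _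
  have hae : ∀ᵐ s ∂volume.restrict (Set.Icc 0 τ),
      (∑ j, ((Set.Icc 0 τ).indicator (rate b ν w (a j)) s *
      ((∫ x, v 0 x * a j x) + ∫ ρ in (0 : ℝ)..s, (Set.Icc 0 τ).indicator (rate b ν' v (a j)) ρ) +
      ((∫ x, w 0 x * a j x) + ∫ ρ in (0 : ℝ)..s, (Set.Icc 0 τ).indicator (rate b ν w (a j)) ρ) *
      (Set.Icc 0 τ).indicator (rate b ν' v (a j)) s)) =
      ∫ x, v s x * (source R (b s) ν (w s) x + ν' * laplace (conv R (w s)) x) := by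
    filter_upwards [hb.drift, ae_restrict_mem measurableSet_Icc] with s hd hs
    have hFs := h.finiteRank.smooth_conv (hw.integrable hs)
    simp only [← hw.eqn_indicator (ha _) hs, ← hv.eqn_indicator (ha _) hs,
      Set.indicator_of_mem hs]
    have hpd : ∀ j, Continuous fun x => laplace (a j) x := fun j => (ha j).laplace.continuous
    have hiv : ∀ j, Integrable fun x => v s x *
        ((∑ i, b s x i * pderiv i (a j) x) + ν' * laplace (a j) x) := by
      intro j
      simp only [mul_add]
      exact (integrable_drift_mul hd (hv.smeas s hs) (hv.bdd s hs)
        fun i => ((ha j).pderiv i).continuous).add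
        (integrable_mul_continuous ((hpd j).const_mul _) (hv.integrable hs))
    have e : ∀ x, v s x * (source R (b s) ν (w s) x + ν' * laplace (conv R (w s)) x) =
        ∑ j, (rate b ν w (a j) s * (v s x * a j x) + (∫ x, w s x * a j x) *
          (v s x * ((∑ i, b s x i * pderiv i (a j) x) + ν' * laplace (a j) x))) := by
      intro x
      have hl : laplace (conv R (w s)) x = ∑ j, (∫ y, w s y * a j y) * laplace (a j) x := by
        simp only [laplace, pderiv_pderiv_conv_eq_sum ha hR (hw.integrable hs), Finset.mul_sum]
        exact Finset.sum_comm
      have hp : ∑ i, b s x i * pderiv i (conv R (w s)) x =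
          ∑ j, (∫ y, w s y * a j y) * ∑ i, b s x i * pderiv i (a j) x := by
        simp only [pderiv_conv_eq_sum ha hR (hw.integrable hs), Finset.mul_sum]
        rw [Finset.sum_comm]
        exact Finset.sum_congr rfl fun j _ => Finset.sum_congr rfl fun i _ => by ring
      rw [source_eq_add h ha hR hw hs hd, hl, hp, Finset.mul_sum, ← Finset.sum_add_distrib,
        ← Finset.sum_add_distrib, Finset.mul_sum]
      exact Finset.sum_congr rfl fun j _ => by ring
    simp only [e]
    have hsum : ∀ j, Integrable fun x => rate b ν w (a j) s * (v s x * a j x) +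
        (∫ x, w s x * a j x) *
          (v s x * ((∑ i, b s x i * pderiv i (a j) x) + ν' * laplace (a j) x)) := fun j =>
      ((integrable_mul_continuous (ha j).continuous (hv.integrable hs)).const_mul _).add
        ((hiv j).const_mul _)
    rw [integral_finsetSum _ fun j _ => hsum j]
    refine Finset.sum_congr rfl fun j _ => ?_
    rw [integral_add ((integrable_mul_continuous (ha j).continuous
      (hv.integrable hs)).const_mul _) ((hiv j).const_mul _), integral_const_mul,
      integral_const_mul]
    rfl
  obtain ⟨h1, h2⟩ := intervalIntegrable_congr_ae_Icc ht
    (integrable_finsetSum _ fun j _ => hint j) hae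
  refine ⟨h1, ?_⟩
  rw [hva t ht, hva 0 h0, ← h2, intervalIntegral.integral_finsetSum fun j _ =>
    (hint j).intervalIntegrable, ← Finset.sum_add_distrib]
  refine Finset.sum_congr rfl fun j _ => ?_
  rw [hw.eqn_indicator (ha j) ht, hv.eqn_indicator (ha j) ht, primitive_mul (hi j) (hi' j)]

end AdvDiff

end

/-! ### Even powers and the maximum principle. -/

noncomputable section

namespace AdvDiff

/-- A one-sided dominated convergence: the rates need not converge, it suffices that they exceed γ
by errors that are bounded and tend to zero. -/
lemma le_add_integral_of_tendsto {t C x y : ℝ} (ht : 0 ≤ t) {g e : ℕ → ℝ → ℝ} {γ : ℝ → ℝ}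
    {ξ η : ℕ → ℝ} (hg : ∀ n, IntervalIntegrable (g n) volume 0 t)
    (hγ : IntervalIntegrable γ volume 0 t)
    (hle : ∀ᵐ s ∂volume.restrict (Set.Icc 0 t), (∀ n, g n s ≤ γ s + e n s ∧ 0 ≤ e n s ∧ e n s ≤ C) ∧
      Tendsto (fun n => e n s) atTop (𝓝 0))
    (hx : Tendsto ξ atTop (𝓝 x)) (hy : Tendsto η atTop (𝓝 y))
    (hxy : ∀ n, ξ n ≤ η n + ∫ s in (0 : ℝ)..t, g n s) :
    x ≤ y + ∫ s in (0 : ℝ)..t, γ s := by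
  have hle' : ∀ᵐ s, s ∈ Set.uIoc 0 t →
      (∀ n, g n s ≤ γ s + e n s ∧ 0 ≤ e n s ∧ e n s ≤ C) ∧
      Tendsto (fun n => e n s) atTop (𝓝 0) := by
    rw [Set.uIoc_of_le ht]
    filter_upwards [(ae_restrict_iff' measurableSet_Icc).1 hle] with s hs hm
    exact hs (Set.Ioc_subset_Icc_self hm)
  -- Only the positive part of the excess is dominated by the errors; the measurability of the
  -- errors themselves is never used.
  have hpos : ∀ n, IntervalIntegrable (fun s => max (g n s - γ s) 0) volume 0 t := fun n => by
    have := ((hg n).sub hγ)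
    rw [intervalIntegrable_iff] at this ⊢
    exact this.pos_part
  have hlim : Tendsto (fun n => ∫ s in (0 : ℝ)..t, max (g n s - γ s) 0) atTop
      (𝓝 (∫ _s in (0 : ℝ)..t, (0 : ℝ))) := by
    refine intervalIntegral.tendsto_integral_filter_of_dominated_convergence (fun _ => C)
      (Eventually.of_forall fun n => (hpos n).aestronglyMeasurable_restrict_uIoc)
      (Eventually.of_forall fun n => ?_) intervalIntegrable_const ?_
    · filter_upwards [hle'] with s hs hm
      obtain ⟨h1, h2, h3⟩ := (hs hm).1 n
      rw [Real.norm_of_nonneg (le_max_right _ _)]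
      exact max_le (by linarith) (by linarith)
    · filter_upwards [hle'] with s hs hm
      refine tendsto_of_tendsto_of_tendsto_of_le_of_le tendsto_const_nhds (hs hm).2
        (fun n => le_max_right _ _) fun n => ?_
      obtain ⟨h1, h2, h3⟩ := (hs hm).1 n
      exact max_le (by linarith) h2
  simp only [intervalIntegral.integral_zero] at hlim
  have hb : ∀ n, ξ n ≤ η n + ((∫ s in (0 : ℝ)..t, γ s) +
      ∫ s in (0 : ℝ)..t, max (g n s - γ s) 0) := by
    intro n
    refine (hxy n).trans (add_le_add le_rfl ?_)
    rw [← intervalIntegral.integral_add hγ (hpos n)]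
    refine intervalIntegral.integral_mono_on ht (hg n) (hγ.add (hpos n)) fun s _ => ?_
    have := le_max_left (g n s - γ s) 0
    linarith
  have := le_of_tendsto_of_tendsto' hx (hy.add (tendsto_const_nhds.add hlim)) hb
  simpa using this

lemma abs_integral_mul_commutator_le {d n : ℕ} {K p B M Z : ℝ} (hp : 2 < p)
    {R : Torus d → ℝ} (h : IsKernel n K R) {b : Torus d → Euc d} (hb : IsDrift p B b)
    {f ζ : Torus d → ℝ} (hf : AEStronglyMeasurable f) (hM : ∀ᵐ x, |f x| ≤ M)
    (hζ : AEStronglyMeasurable ζ) (hZ : ∀ᵐ x, |ζ x| ≤ Z) (hfin : commBound p B M R f ≠ ⊤) :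
    |∫ x, ζ x * commutator R b f x| ≤ Z * (commBound p B M R f).toReal := by
  have hZ0 : 0 ≤ Z := by
    obtain ⟨x, hx⟩ := hZ.exists
    exact (abs_nonneg _).trans hx
  have h1 := enorm_integral_mul_commutator_le hp h hb hf hM hζ
  have h2 : (∫⁻ x, ‖ζ x‖ₑ ^ (2 : ℝ)) ^ (1 / 2 : ℝ) ≤ ENNReal.ofReal Z := by
    rw [lintegral_enorm_sq_eq (memLp_two_of_bound hζ hZ),
      ENNReal.ofReal_rpow_of_nonneg (integral_nonneg fun _ => sq_nonneg _) (by norm_num),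
      ← Real.sqrt_eq_rpow]
    refine ENNReal.ofReal_le_ofReal ((Real.sqrt_le_left hZ0).2 ?_)
    calc ∫ x, ζ x ^ 2 ≤ ∫ _x : Torus d, Z ^ 2 := by
          refine integral_mono_ae (memLp_two_of_bound hζ hZ).integrable_sq (integrable_const _) ?_
          filter_upwards [hZ] with x hx
          exact sq_le_sq' (neg_le_of_abs_le hx) (le_of_abs_le hx)
      _ = Z ^ 2 := by simp
  have h3 := h1.trans (mul_le_mul_left h2 _)
  rw [Real.enorm_eq_ofReal_abs, ← ENNReal.ofReal_toReal hfin, ← ENNReal.ofReal_mul hZ0] at h3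
  exact (ENNReal.ofReal_le_ofReal_iff (mul_nonneg hZ0 ENNReal.toReal_nonneg)).1 h3

lemma tendsto_integral_conv_pow {d : ℕ} {K M : ℝ} {R : ℕ → Torus d → ℝ}
    (h : ∀ n, 1 ≤ n → IsKernel n K (R n)) {f : Torus d → ℝ} (hf : AEStronglyMeasurable f)
    (hM : ∀ᵐ x, |f x| ≤ M) (m : ℕ) :
    Tendsto (fun n => ∫ x, conv (R (n + 1)) f x ^ m) atTop (𝓝 (∫ x, f x ^ m)) := by
  have hM0 : 0 ≤ M := by
    obtain ⟨x, hx⟩ := hM.exists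
    exact (abs_nonneg _).trans hx
  have hfi : Integrable f := (memLp_top_of_bound hf M hM).integrable le_top
  have hn : ∀ n, IsKernel (n + 1) K (R (n + 1)) := fun n => h _ (by omega)
  have hF : ∀ n, SmoothOnTorus (conv (R (n + 1)) f) := fun n => (hn n).finiteRank.smooth_conv hfi
  have h1 := (tendsto_lintegral_conv_sub h (p := 1) le_rfl
    (by simpa using memLp_one_iff_integrable.2 hfi)).comp (tendsto_add_atTop_nat 1)
  simp only [ENNReal.rpow_one] at h1
  have hfm : Integrable fun x => f x ^ m :=
    (memLp_top_of_bound (hf.pow m) (M ^ m) (by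
      filter_upwards [hM] with x hx
      simp only [Pi.pow_apply, norm_pow]
      exact pow_le_pow_left₀ (norm_nonneg _) hx m)).integrable le_top
  refine tendsto_integral_of_L1 _ hfm.aestronglyMeasurable (Eventually.of_forall fun n => ((hF n).pow m).integrable) ?_
  have h2 : Tendsto (fun n => ENNReal.ofReal (m * M ^ (m - 1)) *
      ∫⁻ x, ‖conv (R (n + 1)) f x - f x‖ₑ) atTop (𝓝 0) := by
    have := ENNReal.Tendsto.const_mul (a := ENNReal.ofReal (m * M ^ (m - 1))) h1
      (Or.inr ENNReal.ofReal_ne_top)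
    rwa [mul_zero] at this
  refine tendsto_of_tendsto_of_tendsto_of_le_of_le tendsto_const_nhds h2 (fun _ => zero_le)
    fun n => ?_
  rw [← lintegral_const_mul' _ _ ENNReal.ofReal_ne_top]
  refine lintegral_mono_ae ?_
  filter_upwards [hM] with x hx
  rw [Real.enorm_eq_ofReal_abs, Real.enorm_eq_ofReal_abs, ← ENNReal.ofReal_mul (by positivity)]
  refine ENNReal.ofReal_le_ofReal ((abs_pow_sub_pow_le _ _ m).trans ?_)
  rw [mul_assoc, mul_comm]
  refine mul_le_mul_of_nonneg_right (mul_le_mul_of_nonneg_left ?_ (by positivity)) (abs_nonneg _)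
  exact pow_le_pow_left₀ (le_max_of_le_left (abs_nonneg _)) (max_le (abs_conv_le (hn n) hM x) hx) _

/-- In the balance law for even powers the diffusive term has a sign and the commutator vanishes in
the limit. For ν = 0 this is half of renormalisation, which is all that is needed of the transport
solution. -/
theorem WeakSol.integral_pow_le {d : ℕ} {K τ ν M p B : ℝ} (hp : 2 < p) (hB : 0 ≤ B) (hν : 0 ≤ ν)
    {R : ℕ → Torus d → ℝ} (h : ∀ n, 1 ≤ n → IsKernel n K (R n))
    {b : ℝ → Torus d → Euc d} {w : ℝ → Torus d → ℝ}
    (hw : WeakSol τ b ν M w) (hb : IsTimeDrift τ p B b) (k : ℕ) {t : ℝ} (ht : t ∈ Set.Icc 0 τ) :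
    ∫ x, w t x ^ (2 * k + 2) ≤ ∫ x, w 0 x ^ (2 * k + 2) := by
  have h0 : (0 : ℝ) ∈ Set.Icc 0 τ := ⟨le_rfl, ht.1.trans ht.2⟩
  have hn : ∀ n, IsKernel (n + 1) K (R (n + 1)) := fun n => h _ (by omega)
  have hM0 : 0 ≤ M := by
    obtain ⟨x, hx⟩ := (hw.bdd 0 h0).exists
    exact (abs_nonneg _).trans hx
  have key := le_add_integral_of_tendsto (t := t) (γ := fun _ => 0)
    (C := (2 * k + 2) * (M ^ (2 * k + 1) * (2 * M * B * (d * K))))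
    (e := fun n s => (2 * k + 2) * (M ^ (2 * k + 1) * (commBound p B M (R (n + 1)) (w s)).toReal))
    ht.1 (fun n => (hw.integral_conv_pow (hn n) hb (2 * k + 2) ht).1)
    intervalIntegrable_const ?_ (tendsto_integral_conv_pow h (hw.smeas t ht) (hw.bdd t ht) _)
    (tendsto_integral_conv_pow h (hw.smeas 0 h0) (hw.bdd 0 h0) _)
    (fun n => (hw.integral_conv_pow (hn n) hb (2 * k + 2) ht).2.le)
  · simpa using key
  have hsub : Set.Icc 0 t ⊆ Set.Icc 0 τ := Set.Icc_subset_Icc_right ht.2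
  filter_upwards [ae_restrict_of_ae_restrict_of_subset hsub hb.drift,
    ae_restrict_mem measurableSet_Icc] with s hd hs'
  have hs := hsub hs'
  have hle : ∀ n, commBound p B M (R (n + 1)) (w s) ≤ ENNReal.ofReal (2 * M * B * (d * K)) :=
    fun n => commBound_le hp hB hM0 (hn n) (by omega) (hw.bdd s hs)
  have hfin : ∀ n, commBound p B M (R (n + 1)) (w s) ≠ ⊤ := fun n =>
    ((hle n).trans_lt ENNReal.ofReal_lt_top).ne
  have hK := (hn 0).one_le
  refine ⟨fun n => ⟨?_, by positivity, ?_⟩, ?_⟩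
  · have hF := (hn n).finiteRank.smooth_conv (hw.integrable hs)
    have hc := integrable_mul_continuous (hF.pow (2 * k + 1)).continuous
      (integrable_commutator (hn n) hd (hw.smeas s hs) (hw.bdd s hs))
    have e : ∀ x, ((2 * k + 2 : ℕ) : ℝ) * (conv (R (n + 1)) (w s) x ^ (2 * k + 2 - 1) *
        source (R (n + 1)) (b s) ν (w s) x) = (2 * k + 2) *
          (commutator (R (n + 1)) (b s) (w s) x * conv (R (n + 1)) (w s) x ^ (2 * k + 1) +
          ν * (conv (R (n + 1)) (w s) x ^ (2 * k + 1) * laplace (conv (R (n + 1)) (w s)) x)) := by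
      intro x
      rw [source, show 2 * k + 2 - 1 = 2 * k + 1 by omega]
      push_cast
      ring
    simp only [e]
    rw [integral_const_mul, integral_add hc
      (((hF.pow (2 * k + 1)).mul hF.laplace).integrable.const_mul ν), integral_const_mul, zero_add]
    refine mul_le_mul_of_nonneg_left ?_ (by positivity)
    have h1 := abs_integral_mul_commutator_le hp (hn n) hd (hw.smeas s hs) (hw.bdd s hs)
      (hF.pow (2 * k + 1)).continuous.aestronglyMeasurable (Z := M ^ (2 * k + 1))
      (Eventually.of_forall fun x => by
        rw [abs_pow]
        exact pow_le_pow_left₀ (abs_nonneg _) (abs_conv_le (hn n) (hw.bdd s hs) x) _) (hfin n)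
    have h2 := mul_nonpos_of_nonneg_of_nonpos hν (hF.integral_pow_mul_laplace_nonpos k)
    have h3 := le_of_abs_le h1
    simp only [mul_comm (conv (R (n + 1)) (w s) _ ^ (2 * k + 1)) (commutator _ _ _ _)] at h3
    linarith
  · refine mul_le_mul_of_nonneg_left (mul_le_mul_of_nonneg_left ?_ (by positivity)) (by positivity)
    exact ENNReal.toReal_le_of_le_ofReal (by positivity) (hle n)
  · have := ((ENNReal.tendsto_toReal ENNReal.zero_ne_top).comp
      (tendsto_commBound hp hB h (hw.smeas s hs) (hw.bdd s hs)))
    have := (this.const_mul (M ^ (2 * k + 1))).const_mul (2 * (k : ℝ) + 2)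
    simpa using this

/-- Chebyshev at level A + ε gives a geometric sequence in k that tends to zero. -/
lemma ae_abs_le_of_integral_pow_le {d : ℕ} {f : Torus d → ℝ} {M A : ℝ}
    (hf : AEStronglyMeasurable f) (hM : ∀ᵐ x, |f x| ≤ M) (hA : 0 ≤ A)
    (h : ∀ k : ℕ, ∫ x, f x ^ (2 * k + 2) ≤ A ^ (2 * k + 2)) : ∀ᵐ x, |f x| ≤ A := by
  have key : ∀ ε > 0, volume.real {x : Torus d | A + ε ≤ |f x|} = 0 := by
    intro ε hε
    have hA' : 0 < A + ε := by linarith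
    have hb : ∀ k : ℕ, volume.real {x : Torus d | A + ε ≤ |f x|} ≤ ((A / (A + ε)) ^ 2) ^ (k + 1) := by
      intro k
      have hi : Integrable fun x => f x ^ (2 * k + 2) :=
        (memLp_top_of_bound (hf.pow (2 * k + 2)) (M ^ (2 * k + 2)) (by
          filter_upwards [hM] with x hx
          simp only [Pi.pow_apply, norm_pow]
          exact pow_le_pow_left₀ (norm_nonneg _) hx _)).integrable le_top
      have h1 := mul_meas_ge_le_integral_of_nonneg (μ := (volume : Measure (Torus d)))
        (Eventually.of_forall fun x => by
          change 0 ≤ f x ^ (2 * k + 2)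
          rw [show 2 * k + 2 = 2 * (k + 1) by ring, pow_mul]
          positivity) hi ((A + ε) ^ (2 * k + 2))
      have e : {x : Torus d | (A + ε) ^ (2 * k + 2) ≤ f x ^ (2 * k + 2)} =
          {x : Torus d | A + ε ≤ |f x|} := by
        ext x
        have : f x ^ (2 * k + 2) = |f x| ^ (2 * k + 2) :=
          (Even.pow_abs (by rw [show 2 * k + 2 = 2 * (k + 1) by ring]; exact even_two_mul _) _).symm
        simp only [Set.mem_ofPred_eq, this]
        exact pow_le_pow_iff_left₀ hA'.le (abs_nonneg _) (by omega)
      rw [e] at h1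
      rw [← pow_mul, div_pow, le_div_iff₀ (by positivity), mul_comm]
      have := h1.trans (h k)
      rwa [show 2 * (k + 1) = 2 * k + 2 by ring]
    have hlt : (A / (A + ε)) ^ 2 < 1 := by
      rw [sq_lt_one_iff₀ (by positivity), div_lt_one hA']
      linarith
    have ht := (tendsto_pow_atTop_nhds_zero_of_lt_one (sq_nonneg (A / (A + ε))) hlt).comp
      (tendsto_add_atTop_nat 1)
    exact le_antisymm (ge_of_tendsto' ht hb) measureReal_nonneg
  have h2 : ∀ j : ℕ, ∀ᵐ x : Torus d, |f x| < A + 1 / ((j : ℝ) + 1) := by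
    intro j
    have := key (1 / ((j : ℝ) + 1)) (by positivity)
    rw [measureReal_eq_zero_iff] at this
    simpa [ae_iff] using this
  filter_upwards [ae_all_iff.2 h2] with x hx
  have ht : Tendsto (fun j : ℕ => A + 1 / ((j : ℝ) + 1)) atTop (𝓝 (A + 0)) :=
    tendsto_const_nhds.add tendsto_one_div_add_atTop_nhds_zero_nat
  rw [add_zero] at ht
  exact ge_of_tendsto' ht fun j => (hx j).le

/-- The maximum principle for bounded weak solutions. -/
theorem WeakSol.mono_bound {d : ℕ} {K τ ν M A p B : ℝ} (hp : 2 < p) (hB : 0 ≤ B) (hν : 0 ≤ ν)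
    {R : ℕ → Torus d → ℝ} (h : ∀ n, 1 ≤ n → IsKernel n K (R n))
    {b : ℝ → Torus d → Euc d} {w : ℝ → Torus d → ℝ}
    (hw : WeakSol τ b ν M w) (hb : IsTimeDrift τ p B b) (hA : ∀ᵐ x, |w 0 x| ≤ A) :
    WeakSol τ b ν A w where
  rate_meas := hw.rate_meas
  smeas := hw.smeas
  eqn := hw.eqn
  bdd s hs := by
    have h0 : (0 : ℝ) ∈ Set.Icc 0 τ := ⟨le_rfl, hs.1.trans hs.2⟩
    have hA0 : 0 ≤ A := by
      obtain ⟨x, hx⟩ := hA.exists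
      exact (abs_nonneg _).trans hx
    refine ae_abs_le_of_integral_pow_le (hw.smeas s hs) (hw.bdd s hs) hA0 fun k => ?_
    refine (hw.integral_pow_le hp hB hν h hb k hs).trans ?_
    have hb' : ∀ᵐ x, ‖w 0 x ^ (2 * k + 2)‖ ≤ A ^ (2 * k + 2) := by
      filter_upwards [hA] with x hx
      rw [norm_pow]
      exact pow_le_pow_left₀ (norm_nonneg _) hx _
    have := norm_integral_le_of_norm_le (integrable_const _) hb'
    simp only [integral_const, probReal_univ, smul_eq_mul, one_mul] at this
    exact (le_abs_self _).trans this

end AdvDiff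

end

/-! ### Energy lost by diffusion and regularity of the initial datum. -/

noncomputable section

namespace AdvDiff

lemma rpow_half_lintegral_enorm_sq {d : ℕ} {f : Torus d → ℝ} (hf : MemLp f 2) :
    (∫⁻ x, ‖f x‖ₑ ^ (2 : ℝ)) ^ (1 / 2 : ℝ) = ENNReal.ofReal √(∫ x, f x ^ 2) := by
  rw [lintegral_enorm_sq_eq hf,
    ENNReal.ofReal_rpow_of_nonneg (integral_nonneg fun _ => sq_nonneg _) (by norm_num),
    ← Real.sqrt_eq_rpow]

lemma abs_integral_le_sqrt {d : ℕ} {f : Torus d → ℝ} (hf : MemLp f 2) :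
    ∫ x, |f x| ≤ √(∫ x, f x ^ 2) := by
  have h1 := integral_mul_norm_le_Lp_mul_Lq (μ := (volume : Measure (Torus d)))
    Real.HolderConjugate.two_two (f := f) (g := fun _ => (1 : ℝ)) (by simpa using hf)
    (by simpa using memLp_const 1)
  simpa [Real.sqrt_eq_rpow] using h1

/-- A bound, integrable in time, for the squared `L²` norm of the weak gradient. -/
structure HasGradBound {d : ℕ} (τ : ℝ) (w : ℝ → Torus d → ℝ) (γ : ℝ → ℝ) : Prop where
  integrableOn : IntegrableOn γ (Set.Icc 0 τ)
  nonneg : ∀ s, 0 ≤ γ s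
  grad : ∀ᵐ s ∂volume.restrict (Set.Icc 0 τ), ∃ G : Fin d → Torus d → ℝ,
    IsWeakGrad (w s) G ∧ ∑ i, ∫⁻ x, ‖G i x‖ₑ ^ (2 : ℝ) ≤ ENNReal.ofReal (γ s)

lemma HasGradBound.intervalIntegrable {d : ℕ} {τ t : ℝ} {w : ℝ → Torus d → ℝ} {γ : ℝ → ℝ}
    (hγ : HasGradBound τ w γ) (ht : t ∈ Set.Icc 0 τ) : IntervalIntegrable γ volume 0 t := by
  rw [intervalIntegrable_iff_integrableOn_Icc_of_le ht.1]
  exact hγ.integrableOn.mono_set (Set.Icc_subset_Icc_right ht.2)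

lemma HasGradBound.integral_le {d : ℕ} {τ t : ℝ} {w : ℝ → Torus d → ℝ} {γ : ℝ → ℝ}
    (hγ : HasGradBound τ w γ) (ht : t ∈ Set.Icc 0 τ) :
    ∫ s in (0 : ℝ)..t, γ s ≤ ∫ s in Set.Icc 0 τ, γ s := by
  rw [intervalIntegral.integral_of_le ht.1]
  exact setIntegral_mono_set hγ.integrableOn (Eventually.of_forall hγ.nonneg)
    (Set.Ioc_subset_Icc_self.trans (Set.Icc_subset_Icc_right ht.2)).eventuallyLE

/-- Bounds the energy loss from above by the dissipation; mollification does not increase the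
gradient norm, so the mollified dissipation is at most γ. The rates are negated to fit the one-sided
limit lemma. -/
theorem WeakSol.integral_sq_ge {d : ℕ} {K τ ν M p B : ℝ} (hp : 2 < p) (hB : 0 ≤ B) (hν : 0 ≤ ν)
    {R : ℕ → Torus d → ℝ} (h : ∀ n, 1 ≤ n → IsKernel n K (R n))
    {b : ℝ → Torus d → Euc d} {w : ℝ → Torus d → ℝ} {γ : ℝ → ℝ}
    (hw : WeakSol τ b ν M w) (hb : IsTimeDrift τ p B b) (hγ : HasGradBound τ w γ)
    {t : ℝ} (ht : t ∈ Set.Icc 0 τ) :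
    ∫ x, w 0 x ^ 2 ≤ (∫ x, w t x ^ 2) + 2 * ν * ∫ s in (0 : ℝ)..t, γ s := by
  have h0 : (0 : ℝ) ∈ Set.Icc 0 τ := ⟨le_rfl, ht.1.trans ht.2⟩
  have hn : ∀ n, IsKernel (n + 1) K (R (n + 1)) := fun n => h _ (by omega)
  have hM0 : 0 ≤ M := by
    obtain ⟨x, hx⟩ := (hw.bdd 0 h0).exists
    exact (abs_nonneg _).trans hx
  rw [← intervalIntegral.integral_const_mul]
  refine le_add_integral_of_tendsto (t := t) (γ := fun s => 2 * ν * γ s)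
    (C := 2 * (M * (2 * M * B * (d * K))))
    (e := fun n s => 2 * (M * (commBound p B M (R (n + 1)) (w s)).toReal))
    ht.1 (fun n => (hw.integral_conv_pow (hn n) hb 2 ht).1.neg)
    ((hγ.intervalIntegrable ht).const_mul _) ?_
    (tendsto_integral_conv_pow h (hw.smeas 0 h0) (hw.bdd 0 h0) 2)
    (tendsto_integral_conv_pow h (hw.smeas t ht) (hw.bdd t ht) 2)
    (fun n => ?_)
  swap
  · rw [(hw.integral_conv_pow (hn n) hb 2 ht).2]
    simp only [Pi.neg_apply]
    rw [intervalIntegral.integral_neg]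
    linarith
  have hsub : Set.Icc 0 t ⊆ Set.Icc 0 τ := Set.Icc_subset_Icc_right ht.2
  filter_upwards [ae_restrict_of_ae_restrict_of_subset hsub hb.drift,
    ae_restrict_of_ae_restrict_of_subset hsub hγ.grad,
    ae_restrict_mem measurableSet_Icc] with s hd hg hs'
  obtain ⟨G, hG, hGγ⟩ := hg
  have hs := hsub hs'
  have hle : ∀ n, commBound p B M (R (n + 1)) (w s) ≤ ENNReal.ofReal (2 * M * B * (d * K)) :=
    fun n => commBound_le hp hB hM0 (hn n) (by omega) (hw.bdd s hs)
  have hfin : ∀ n, commBound p B M (R (n + 1)) (w s) ≠ ⊤ := fun n =>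
    ((hle n).trans_lt ENNReal.ofReal_lt_top).ne
  have hK := (hn 0).one_le
  refine ⟨fun n => ⟨?_, by positivity, ?_⟩, ?_⟩
  · have hF := (hn n).finiteRank.smooth_conv (hw.integrable hs)
    have hc := integrable_mul_continuous hF.continuous
      (integrable_commutator (hn n) hd (hw.smeas s hs) (hw.bdd s hs))
    have e : ∀ x, ((2 : ℕ) : ℝ) * (conv (R (n + 1)) (w s) x ^ (2 - 1) *
        source (R (n + 1)) (b s) ν (w s) x) = 2 *
          (commutator (R (n + 1)) (b s) (w s) x * conv (R (n + 1)) (w s) x +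
          ν * (conv (R (n + 1)) (w s) x * laplace (conv (R (n + 1)) (w s)) x)) := by
      intro x
      rw [source]
      push_cast
      ring
    simp only [Pi.neg_apply, e]
    rw [integral_const_mul, integral_add hc
      ((hF.mul hF.laplace).integrable.const_mul ν), integral_const_mul]
    have h1 := abs_integral_mul_commutator_le hp (hn n) hd (hw.smeas s hs) (hw.bdd s hs)
      hF.continuous.aestronglyMeasurable (Z := M)
      (Eventually.of_forall (abs_conv_le (hn n) (hw.bdd s hs))) (hfin n)
    have h2 := mul_le_mul_of_nonneg_left
      (integral_conv_mul_laplace_ge (hγ.nonneg s) (hn n) hG hGγ) hν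
    have h3 := neg_le_of_abs_le h1
    simp only [mul_comm (conv (R (n + 1)) (w s) _) (commutator _ _ _ _)] at h3
    linarith
  · refine mul_le_mul_of_nonneg_left (mul_le_mul_of_nonneg_left ?_ hM0) (by positivity)
    exact ENNReal.toReal_le_of_le_ofReal (by positivity) (hle n)
  · have := ((ENNReal.tendsto_toReal ENNReal.zero_ne_top).comp
      (tendsto_commBound hp hB h (hw.smeas s hs) (hw.bdd s hs)))
    have := (this.const_mul M).const_mul 2
    simpa using this

lemma integral_conv_sq_le {d n : ℕ} {K : ℝ} {R : Torus d → ℝ} (h : IsKernel n K R)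
    {f : Torus d → ℝ} (hf : MemLp f 2) : ∫ x, conv R f x ^ 2 ≤ ∫ x, f x ^ 2 := by
  have h1 := lintegral_conv_rpow_le h hf.1 (p := 2) (by norm_num)
  rw [lintegral_enorm_sq_eq hf, lintegral_enorm_sq_eq (memLp_of_smooth
    (h.finiteRank.smooth_conv (hf.integrable (by norm_num))) 2)] at h1
  exact (ENNReal.ofReal_le_ofReal_iff (integral_nonneg fun _ => sq_nonneg _)).1 h1

lemma integral_sub_sq {d : ℕ} {f g : Torus d → ℝ} (hf : MemLp f 2) (hg : MemLp g 2) :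
    ∫ x, (f x - g x) ^ 2 = (∫ x, f x ^ 2) - 2 * (∫ x, f x * g x) + ∫ x, g x ^ 2 := by
  have hfg : Integrable fun x => f x * g x := hf.integrable_mul hg
  have hi : Integrable fun x => f x ^ 2 - 2 * (f x * g x) :=
    hf.integrable_sq.sub (hfg.const_mul 2)
  rw [← integral_const_mul, ← integral_sub hf.integrable_sq (hfg.const_mul 2),
    ← integral_add hi hg.integrable_sq]
  exact integral_congr_ae (Eventually.of_forall fun x => by simp only; ring)

/-- A time in the initial layer where the gradient is at most its average, chosen outside the null
set on which no weak gradient is available. -/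
lemma HasGradBound.exists_le {d : ℕ} {τ δ : ℝ} {w : ℝ → Torus d → ℝ} {γ : ℝ → ℝ}
    (hγ : HasGradBound τ w γ) (hδ : 0 < δ) (hδτ : δ ≤ τ) :
    ∃ s ∈ Set.Icc 0 δ, γ s ≤ (∫ s in Set.Icc 0 τ, γ s) / δ ∧ ∃ G : Fin d → Torus d → ℝ,
      IsWeakGrad (w s) G ∧ ∑ i, ∫⁻ x, ‖G i x‖ₑ ^ (2 : ℝ) ≤ ENNReal.ofReal (γ s) := by
  have hsub : Set.Icc 0 δ ⊆ Set.Icc 0 τ := Set.Icc_subset_Icc_right hδτ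
  have h1 := (ae_restrict_of_ae_restrict_of_subset hsub hγ.grad).and
    (ae_restrict_mem (μ := (volume : Measure ℝ)) measurableSet_Icc)
  have hne : (volume : Measure ℝ).restrict (Set.Icc 0 δ) ≠ 0 := by
    rw [Ne, Measure.restrict_eq_zero, Real.volume_Icc]
    simpa using hδ
  obtain ⟨s, hs, hle⟩ := exists_notMem_null_le_average hne
    (hγ.integrableOn.mono_set hsub) (ae_iff.1 h1)
  simp only [Set.mem_ofPred_eq, not_not] at hs
  refine ⟨s, hs.2, hle.trans ?_, hs.1⟩
  rw [setAverage_eq, measureReal_def, Real.volume_Icc, sub_zero, ENNReal.toReal_ofReal hδ.le,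
    smul_eq_mul, inv_mul_eq_div]
  gcongr
  · exact ae_of_all _ hγ.nonneg
  · exact hγ.integrableOn

/-- The quantity ‖f‖² - ⟨f, R * f⟩ is carried from time 0 to a time s ≤ δ with gradient at most Γ/δ.
The energy drops by at most 2νΓ, the pairing grows by at most the commutator bound times δ, and at
time s the gradient controls the mollification error. These are the three terms. -/
theorem WeakSol.integral_conv_sub_sq_initial_le {d n : ℕ} (hd : 0 < d) (hn : 1 ≤ n)
    {K τ ν M p B : ℝ} (hp : 2 < p) (hB : 0 ≤ B)
    (hν : 0 ≤ ν) {R : ℕ → Torus d → ℝ} (h : ∀ n, 1 ≤ n → IsKernel n K (R n))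
    {b : ℝ → Torus d → Euc d} {w : ℝ → Torus d → ℝ} {γ : ℝ → ℝ}
    (hw : WeakSol τ b ν M w) (hb : IsTimeDrift τ p B b) (hγ : HasGradBound τ w γ)
    {δ Γ : ℝ} (hδ : 0 < δ) (hδτ : δ ≤ τ) (hΓ : ∫ s in Set.Icc 0 τ, γ s ≤ Γ) :
    ∫ x, (w 0 x - conv (R n) (w 0) x) ^ 2 ≤
      2 * (2 * ν * Γ + M * √(K / n * (d * (Γ / δ))) + M * (2 * M * B * (d * K)) * δ) := by
  have h0 : (0 : ℝ) ∈ Set.Icc 0 τ := ⟨le_rfl, hδ.le.trans hδτ⟩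
  have hM0 : 0 ≤ M := by
    obtain ⟨x, hx⟩ := (hw.bdd 0 h0).exists
    exact (abs_nonneg _).trans hx
  have hk := h n hn
  have hK := hk.one_le
  obtain ⟨s, hs', hsγ, G, hG, hGγ⟩ := hγ.exists_le hδ hδτ
  have hs : s ∈ Set.Icc 0 τ := ⟨hs'.1, hs'.2.trans hδτ⟩
  have hsγ' : γ s ≤ Γ / δ := hsγ.trans (by gcongr)
  have hw0 := memLp_two_of_bound (hw.smeas 0 h0) (hw.bdd 0 h0)
  have hws := memLp_two_of_bound (hw.smeas s hs) (hw.bdd s hs)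
  have hF0 := memLp_of_smooth (hk.finiteRank.smooth_conv (hw.integrable h0)) 2
  have hFs := memLp_of_smooth (hk.finiteRank.smooth_conv (hw.integrable hs)) 2
  have ha := hw.integral_sq_ge hp hB hν h hb hγ hs
  have ha' : 2 * ν * ∫ σ in (0 : ℝ)..s, γ σ ≤ 2 * ν * Γ :=
    mul_le_mul_of_nonneg_left ((hγ.integral_le hs).trans hΓ) (by positivity)
  have hbi := (WeakSol.integral_mul_conv hk hw hw hb hs)
  have hb' : ∫ σ in (0 : ℝ)..s, ∫ x, w σ x * (source (R n) (b σ) ν (w σ) x +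
      ν * laplace (conv (R n) (w σ)) x) ≤ M * (2 * M * B * (d * K)) * δ := by
    have : ∫ σ in (0 : ℝ)..s, ∫ x, w σ x * (source (R n) (b σ) ν (w σ) x +
      ν * laplace (conv (R n) (w σ)) x) ≤
        ∫ _σ in (0 : ℝ)..s, M * (2 * M * B * (d * K)) := by
      refine intervalIntegral.integral_mono_ae_restrict hs.1 hbi.1 intervalIntegrable_const ?_
      have hsub : Set.Icc 0 s ⊆ Set.Icc 0 τ := Set.Icc_subset_Icc_right hs.2
      filter_upwards [ae_restrict_of_ae_restrict_of_subset hsub hb.drift,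
        ae_restrict_of_ae_restrict_of_subset hsub hγ.grad,
        ae_restrict_mem measurableSet_Icc] with σ hdσ hgσ hσ'
      obtain ⟨Gσ, hGσ, -⟩ := hgσ
      have hσ := hsub hσ'
      have hF := hk.finiteRank.smooth_conv (hw.integrable hσ)
      have hle : commBound p B M (R n) (w σ) ≤ ENNReal.ofReal (2 * M * B * (d * K)) :=
        commBound_le hp hB hM0 hk hn (hw.bdd σ hσ)
      have h1 := abs_integral_mul_commutator_le hp hk hdσ (hw.smeas σ hσ) (hw.bdd σ hσ)
        (hw.smeas σ hσ) (hw.bdd σ hσ) (hle.trans_lt ENNReal.ofReal_lt_top).ne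
      -- Each factor of the pairing contributes one diffusive term; both have the favourable sign
      -- and are dropped.
      have h2 := integral_mul_laplace_conv_nonpos hk hGσ
      have h3 : ∫ x, w σ x * commutator (R n) (b σ) (w σ) x ≤ M * (2 * M * B * (d * K)) :=
        (le_of_abs_le h1).trans (mul_le_mul_of_nonneg_left
          (ENNReal.toReal_le_of_le_ofReal (by positivity) hle) hM0)
      have e : ∀ x, w σ x * (source (R n) (b σ) ν (w σ) x + ν * laplace (conv (R n) (w σ)) x) =
          w σ x * commutator (R n) (b σ) (w σ) x +
            2 * ν * (w σ x * laplace (conv (R n) (w σ)) x) := fun x => by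
        rw [source]; ring
      simp only [e]
      rw [integral_add (integrable_bdd_mul_shift (hw.smeas σ hσ) (hw.bdd σ hσ)
        (integrable_commutator hk hdσ (hw.smeas σ hσ) (hw.bdd σ hσ)))
        ((integrable_mul_continuous hF.laplace.continuous (hw.integrable hσ)).const_mul _),
        integral_const_mul]
      have := mul_nonpos_of_nonneg_of_nonpos (by positivity : 0 ≤ 2 * ν) h2
      linarith
    refine this.trans ?_
    rw [intervalIntegral.integral_const, sub_zero, smul_eq_mul, mul_comm]
    exact mul_le_mul_of_nonneg_left hs'.2 (by positivity)
  have hc : (∫ x, w s x ^ 2) - ∫ x, w s x * conv (R n) (w s) x ≤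
      M * √(K / n * (d * (Γ / δ))) := by
    have hwF : Integrable fun x => w s x * conv (R n) (w s) x := hws.integrable_mul hFs
    rw [← integral_sub hws.integrable_sq hwF]
    have hsub : MemLp (fun x => conv (R n) (w s) x - w s x) 2 := hFs.sub hws
    calc ∫ x, (w s x ^ 2 - w s x * conv (R n) (w s) x)
        ≤ ∫ x, M * |conv (R n) (w s) x - w s x| := by
          refine integral_mono_ae (hws.integrable_sq.sub hwF)
            ((hsub.integrable (by norm_num)).abs.const_mul _) ?_
          filter_upwards [hw.bdd s hs] with x hx
          have e : w s x ^ 2 - w s x * conv (R n) (w s) x =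
            w s x * -(conv (R n) (w s) x - w s x) := by ring
          rw [e]
          refine (le_abs_self _).trans ?_
          rw [abs_mul, abs_neg]
          exact mul_le_mul_of_nonneg_right hx (abs_nonneg _)
      _ ≤ M * √(∫ x, (conv (R n) (w s) x - w s x) ^ 2) := by
          rw [integral_const_mul]
          exact mul_le_mul_of_nonneg_left (abs_integral_le_sqrt hsub) hM0
      _ ≤ M * √(K / n * (d * (Γ / δ))) := by
          refine mul_le_mul_of_nonneg_left (Real.sqrt_le_sqrt ?_) hM0
          have h1 := lintegral_conv_sub_sq_le hd hn (hγ.nonneg s) hk hG hGγ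
          rw [lintegral_enorm_sq_eq hsub] at h1
          refine ((ENNReal.ofReal_le_ofReal_iff ?_).1 h1).trans ?_
          · exact mul_nonneg (by positivity) (mul_nonneg (by positivity) (hγ.nonneg s))
          · gcongr
  -- Since ‖R * f‖ ≤ ‖f‖, expanding the square gives ‖f - R * f‖² ≤ 2(‖f‖² - ⟨f, R * f⟩).
  have hq := integral_sub_sq hw0 hF0
  have hq' := integral_conv_sq_le hk hw0
  linarith [hbi.2]

end AdvDiff

end

/-! ### Comparison of the mollified diffusive solution with the transport solution. -/

noncomputable section

namespace AdvDiff

theorem abs_integral_mul_source_le {d n : ℕ} (hd : 0 < d) (hn : 1 ≤ n) {K ν M Z p B γ : ℝ}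
    (hp : 2 < p) (hB : 0 ≤ B) (hM0 : 0 ≤ M) (hν : 0 ≤ ν) (hγ0 : 0 ≤ γ) {R : Torus d → ℝ}
    (h : IsKernel n K R) {b : Torus d → Euc d} (hb : IsDrift p B b) {f ζ : Torus d → ℝ}
    {G : Fin d → Torus d → ℝ} (hG : IsWeakGrad f G)
    (hγ : ∑ i, ∫⁻ x, ‖G i x‖ₑ ^ (2 : ℝ) ≤ ENNReal.ofReal γ)
    (hf : AEStronglyMeasurable f) (hM : ∀ᵐ x, |f x| ≤ M)
    (hζ : AEStronglyMeasurable ζ) (hZ : ∀ᵐ x, |ζ x| ≤ Z) :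
    |∫ x, ζ x * source R b ν f x| ≤ √(∫ x, ζ x ^ 2) *
      ((2 * M) ^ (2 / p) * B * (d * (2 * K)) * (d * γ / n) ^ ((p - 2) / (2 * p)) +
        ν * (d * (K * √n * √γ))) := by
  have hK := h.one_le
  have hζ2 := memLp_two_of_bound hζ hZ
  have hF := h.finiteRank.smooth_conv hG.1
  have hp0 : 0 < p := by linarith
  have e : ∀ x, ζ x * source R b ν f x =
      ζ x * commutator R b f x + ν * (ζ x * laplace (conv R f) x) := fun x => by
    rw [source]; ring
  have hi1 : Integrable fun x => ζ x * commutator R b f x :=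
    integrable_bdd_mul_shift hζ hZ (integrable_commutator h hb hf hM)
  have hi2 : Integrable fun x => ζ x * laplace (conv R f) x :=
    integrable_mul_continuous hF.laplace.continuous (hζ2.integrable (by norm_num))
  have h1 : |∫ x, ζ x * commutator R b f x| ≤ √(∫ x, ζ x ^ 2) *
      ((2 * M) ^ (2 / p) * B * (d * (2 * K)) * (d * γ / n) ^ ((p - 2) / (2 * p))) := by
    have := (enorm_integral_mul_commutator_le hp h hb hf hM hζ).trans
      (mul_le_mul_right (commBound_le_of_grad hp hB hM0 (by positivity : 0 ≤ d * γ) h hn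
        (incrSq_le_of_grad hd hG hγ)) _)
    rw [rpow_half_lintegral_enorm_sq hζ2, ← ENNReal.ofReal_mul (Real.sqrt_nonneg _),
      Real.enorm_eq_ofReal_abs] at this
    exact (ENNReal.ofReal_le_ofReal_iff (by positivity)).1 this
  have h2 : |∫ x, ζ x * laplace (conv R f) x| ≤ √(∫ x, ζ x ^ 2) * (d * (K * √n * √γ)) := by
    have := enorm_integral_mul_laplace_le h hG hγ hζ hZ
    rw [rpow_half_lintegral_enorm_sq hζ2, ENNReal.ofReal_rpow_of_nonneg hγ0 (by norm_num),
      ← Real.sqrt_eq_rpow, ← ENNReal.ofReal_mul (by positivity), ← ENNReal.ofReal_natCast d,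
      ← ENNReal.ofReal_mul (by positivity), ← ENNReal.ofReal_mul (Real.sqrt_nonneg _),
      Real.enorm_eq_ofReal_abs] at this
    exact (ENNReal.ofReal_le_ofReal_iff (by positivity)).1 this
  simp only [e]
  rw [integral_add hi1 (hi2.const_mul ν), integral_const_mul]
  refine (abs_add_le _ _).trans ?_
  rw [abs_mul, abs_of_nonneg hν]
  have := mul_le_mul_of_nonneg_left h2 hν
  linarith

/-- Linearises sublinear powers of γ(s) around Γ. Integrated in time, 1 + γ/Γ gives at most τ + 1 as
soon as ∫γ ≤ Γ. -/
lemma rpow_le_mul_one_add_div {a x y : ℝ} (ha0 : 0 ≤ a) (ha1 : a ≤ 1) (hx : 0 ≤ x) (hy : 0 < y) :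
    x ^ a ≤ y ^ a * (1 + x / y) := by
  have h1 : (x / y) ^ a ≤ 1 + x / y := by
    have h0 : 0 ≤ x / y := by positivity
    rcases le_total (x / y) 1 with h | h
    · exact (Real.rpow_le_one h0 h ha0).trans (by linarith)
    · calc (x / y) ^ a ≤ (x / y) ^ (1 : ℝ) := Real.rpow_le_rpow_of_exponent_le h ha1
        _ ≤ 1 + x / y := by rw [Real.rpow_one]; linarith
  calc x ^ a = y ^ a * (x / y) ^ a := by
        rw [← Real.mul_rpow hy.le (by positivity), mul_div_cancel₀ _ hy.ne']
    _ ≤ _ := mul_le_mul_of_nonneg_left h1 (by positivity)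

/-- The regularised diffusive solution stays close to the solution of the transport equation. -/
theorem WeakSol.integral_sub_conv_sq_le {d n : ℕ} (hd : 0 < d) (hn : 1 ≤ n)
    {K τ ν M p B : ℝ} (hp : 2 < p) (hB : 0 ≤ B)
    (hν : 0 ≤ ν) {R : ℕ → Torus d → ℝ} (h : ∀ n, 1 ≤ n → IsKernel n K (R n))
    {b : ℝ → Torus d → Euc d} {v w : ℝ → Torus d → ℝ} {γ : ℝ → ℝ}
    (hv : WeakSol τ b 0 M v) (hw : WeakSol τ b ν M w) (hb : IsTimeDrift τ p B b)
    (hγ : HasGradBound τ w γ) {Γ : ℝ} (hΓ0 : 0 < Γ) (hΓ : ∫ s in Set.Icc 0 τ, γ s ≤ Γ)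
    {t : ℝ} (ht : t ∈ Set.Icc 0 τ) :
    ∫ x, (v t x - conv (R n) (w t) x) ^ 2 ≤ 2 * (∫ x, (v 0 x - conv (R n) (w 0) x) ^ 2) +
      4 * (((2 * M) ^ (2 / p) * B * (d * (2 * K)) * (d * Γ / n) ^ ((p - 2) / (2 * p)) +
        ν * (d * (K * √n * √Γ))) * (τ + 1)) ^ 2 := by
  have h0 : (0 : ℝ) ∈ Set.Icc 0 τ := ⟨le_rfl, ht.1.trans ht.2⟩
  have hτ0 : 0 ≤ τ := h0.2
  have hM0 : 0 ≤ M := by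
    obtain ⟨x, hx⟩ := (hw.bdd 0 h0).exists
    exact (abs_nonneg _).trans hx
  have hk := h n hn
  have hK := hk.one_le
  have hp0 : 0 < p := by linarith
  have hn1 : (0 : ℝ) < n := by exact_mod_cast hn
  have hd1 : (0 : ℝ) < d := by exact_mod_cast hd
  set D : ℝ := (2 * M) ^ (2 / p) * B * (d * (2 * K)) * (d * Γ / n) ^ ((p - 2) / (2 * p)) +
        ν * (d * (K * √n * √Γ)) with hD
  have hD0 : 0 ≤ D := by positivity
  have hv2 : ∀ s ∈ Set.Icc 0 τ, MemLp (v s) 2 := fun s hs =>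
    memLp_two_of_bound (hv.smeas s hs) (hv.bdd s hs)
  have hFs : ∀ s ∈ Set.Icc 0 τ, SmoothOnTorus (conv (R n) (w s)) := fun s hs =>
    hk.finiteRank.smooth_conv (hw.integrable hs)
  have hF2 : ∀ s ∈ Set.Icc 0 τ, MemLp (conv (R n) (w s)) 2 := fun s hs =>
    memLp_of_smooth (hFs s hs) 2
  have hzm : ∀ s ∈ Set.Icc 0 τ, AEStronglyMeasurable fun x => v s x - conv (R n) (w s) x :=
    fun s hs => (hv.smeas s hs).sub (hFs s hs).continuous.aestronglyMeasurable
  have hzb : ∀ s ∈ Set.Icc 0 τ, ∀ᵐ x, |v s x - conv (R n) (w s) x| ≤ 2 * M := fun s hs => by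
    filter_upwards [hv.bdd s hs] with x hx
    exact (abs_sub _ _).trans (by linarith [abs_conv_le hk (hw.bdd s hs) x])
  set N : ℝ → ℝ := fun s => ∫ x, (v s x - conv (R n) (w s) x) ^ 2 with hN
  have hN0 : ∀ s, 0 ≤ N s := fun s => integral_nonneg fun _ => sq_nonneg _
  have hNb : ∀ s ∈ Set.Icc 0 τ, N s ≤ (2 * M) ^ 2 := fun s hs => by
    have := integral_mono_ae ((hv2 s hs).sub (hF2 s hs)).integrable_sq
      (integrable_const ((2 * M) ^ 2)) (by
        filter_upwards [hzb s hs] with x hx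
        exact sq_le_sq' (neg_le_of_abs_le hx) (le_of_abs_le hx))
    simpa using this
  -- Assuming a bound Y² for N on the whole interval gives a bound linear in Y. No regularity of N
  -- in time is required, in contrast to a Gronwall argument.
  have hstep : ∀ Y : ℝ, 0 ≤ Y → (∀ s ∈ Set.Icc 0 τ, N s ≤ Y ^ 2) → ∀ s ∈ Set.Icc 0 τ,
      N s ≤ N 0 + 2 * Y * (D * (τ + 1)) := by
    intro Y hY hNY s hs
    -- The square is expanded into three terms: the norm of v does not increase, and the other two
    -- satisfy exact balance laws.
    have h1 := hv.integral_pow_le hp hB le_rfl h hb 0 hs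
    have h2 := WeakSol.integral_mul_conv hk hv hw hb hs
    have h3 := hw.integral_conv_pow hk hb 2 hs
    have e0 : N 0 = _ := integral_sub_sq (hv2 0 h0) (hF2 0 h0)
    have es : N s = _ := integral_sub_sq (hv2 s hs) (hF2 s hs)
    have hint := intervalIntegral.integral_sub h3.1 (h2.1.const_mul 2)
    rw [intervalIntegral.integral_const_mul] at hint
    have hle : ∫ σ in (0 : ℝ)..s, ((∫ x, ((2 : ℕ) : ℝ) * (conv (R n) (w σ) x ^ (2 - 1) *
        source (R n) (b σ) ν (w σ) x)) - 2 * ∫ x, v σ x * (source (R n) (b σ) ν (w σ) x +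
          0 * laplace (conv (R n) (w σ)) x)) ≤
        ∫ σ in (0 : ℝ)..s, 2 * (Y * (D * (1 + γ σ / Γ))) := by
      have hγi := hγ.intervalIntegrable hs
      refine intervalIntegral.integral_mono_ae_restrict hs.1 (h3.1.sub (h2.1.const_mul 2))
        (((intervalIntegrable_const.add (hγi.div_const Γ)).const_mul D).const_mul Y |>.const_mul 2)
        ?_
      have hsub : Set.Icc 0 s ⊆ Set.Icc 0 τ := Set.Icc_subset_Icc_right hs.2
      filter_upwards [ae_restrict_of_ae_restrict_of_subset hsub hb.drift,
        ae_restrict_of_ae_restrict_of_subset hsub hγ.grad,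
        ae_restrict_mem measurableSet_Icc] with σ hdσ hgσ hσ'
      obtain ⟨G, hG, hGγ⟩ := hgσ
      have hσ := hsub hσ'
      have hSi : Integrable (source (R n) (b σ) ν (w σ)) :=
        (integrable_commutator hk hdσ (hw.smeas σ hσ) (hw.bdd σ hσ)).add
          ((hFs σ hσ).laplace.integrable.const_mul ν)
      have hi1 : Integrable fun x => conv (R n) (w σ) x * source (R n) (b σ) ν (w σ) x :=
        integrable_bdd_mul_shift (hFs σ hσ).continuous.aestronglyMeasurable
          (Eventually.of_forall (abs_conv_le hk (hw.bdd σ hσ))) hSi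
      have hi2 : Integrable fun x => v σ x * source (R n) (b σ) ν (w σ) x :=
        integrable_bdd_mul_shift (hv.smeas σ hσ) (hv.bdd σ hσ) hSi
      have hmain := abs_integral_mul_source_le hd hn hp hB hM0 hν (hγ.nonneg σ) hk hdσ hG hGγ
        (hw.smeas σ hσ) (hw.bdd σ hσ) (hzm σ hσ) (hzb σ hσ)
      have hY' : √(∫ x, (v σ x - conv (R n) (w σ) x) ^ 2) ≤ Y :=
        (Real.sqrt_le_left hY).2 (hNY σ hσ)
      have hβ : (2 * M) ^ (2 / p) * B * (d * (2 * K)) * (d * γ σ / n) ^ ((p - 2) / (2 * p)) +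
          ν * (d * (K * √n * √(γ σ))) ≤ D * (1 + γ σ / Γ) := by
        have hγσ := hγ.nonneg σ
        have t1 := rpow_le_mul_one_add_div (a := (p - 2) / (2 * p))
          (div_nonneg (by linarith) (by linarith)) ((div_le_one (by linarith)).2 (by linarith))
          (by positivity : 0 ≤ d * γ σ / n) (by positivity : 0 < d * Γ / n)
        have t2 := rpow_le_mul_one_add_div (a := 1 / 2) (by norm_num) (by norm_num) hγσ hΓ0
        rw [← Real.sqrt_eq_rpow, ← Real.sqrt_eq_rpow] at t2
        have e1 : d * γ σ / n / (d * Γ / n) = γ σ / Γ := by field_simp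
        rw [e1] at t1
        calc _ ≤ (2 * M) ^ (2 / p) * B * (d * (2 * K)) *
              ((d * Γ / n) ^ ((p - 2) / (2 * p)) * (1 + γ σ / Γ)) +
              ν * (d * (K * √n * (√Γ * (1 + γ σ / Γ)))) := by gcongr
          _ = _ := by rw [hD]; ring
      -- The two balance laws combine so that the source is tested with the small quantity v - R * w
      -- only.
      have e : (∫ x, ((2 : ℕ) : ℝ) * (conv (R n) (w σ) x ^ (2 - 1) *
          source (R n) (b σ) ν (w σ) x)) - 2 * (∫ x, v σ x * (source (R n) (b σ) ν (w σ) x +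
          0 * laplace (conv (R n) (w σ)) x)) =
          -2 * ∫ x, (v σ x - conv (R n) (w σ) x) * source (R n) (b σ) ν (w σ) x := by
        simp only [Nat.add_one_sub_one, pow_one, zero_mul, add_zero, sub_mul]
        rw [integral_const_mul, integral_sub hi2 hi1]
        push_cast
        ring
      change _ - 2 * _ ≤ _
      rw [e]
      have := (hmain.trans (mul_le_mul hY' hβ (by have := hγ.nonneg σ; positivity) hY))
      have := neg_le_of_abs_le this
      linarith
    have hr : ∫ σ in (0 : ℝ)..s, 2 * (Y * (D * (1 + γ σ / Γ))) ≤ 2 * Y * (D * (τ + 1)) := by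
      have hγi := hγ.intervalIntegrable hs
      rw [intervalIntegral.integral_const_mul, intervalIntegral.integral_const_mul,
        intervalIntegral.integral_const_mul, intervalIntegral.integral_add intervalIntegrable_const
        (hγi.div_const Γ), intervalIntegral.integral_const, intervalIntegral.integral_div, sub_zero,
        smul_eq_mul, mul_one, ← mul_assoc]
      have : (∫ σ in (0 : ℝ)..s, γ σ) / Γ ≤ 1 :=
        (div_le_one hΓ0).2 ((hγ.integral_le hs).trans hΓ)
      exact mul_le_mul_of_nonneg_left (mul_le_mul_of_nonneg_left (add_le_add hs.2 this) hD0)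
        (by positivity)
    norm_num at h1
    have arith : ∀ {a a' c c' e e' I J X Z : ℝ}, a ≤ a' → c = c' + J → e = e' + I →
        I - 2 * J ≤ X → X ≤ Z → a - 2 * c + e ≤ a' - 2 * c' + e' + Z := by
      intros
      linarith
    rw [es, e0]
    exact arith h1 h2.2 h3.2 (hint.ge.trans hle) hr
  set Y : ℝ := √(sSup (N '' Set.Icc 0 τ)) with hY
  have hbdd : BddAbove (N '' Set.Icc 0 τ) := ⟨(2 * M) ^ 2, by rintro _ ⟨s, hs, rfl⟩; exact hNb s hs⟩
  have hNY : ∀ s ∈ Set.Icc 0 τ, N s ≤ Y ^ 2 := fun s hs => by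
    have := le_csSup hbdd (Set.mem_image_of_mem N hs)
    rw [hY, Real.sq_sqrt ((hN0 s).trans this)]
    exact this
  have hsup : Y ^ 2 ≤ N 0 + 2 * Y * (D * (τ + 1)) := by
    rw [hY, Real.sq_sqrt ((hN0 0).trans (le_csSup hbdd (Set.mem_image_of_mem N h0))), ← hY]
    refine csSup_le ⟨_, Set.mem_image_of_mem N h0⟩ ?_
    rintro _ ⟨s, hs, rfl⟩
    exact hstep Y (Real.sqrt_nonneg _) hNY s hs
  refine (hNY t ht).trans ?_
  -- Young's inequality absorbs the term linear in Y into Y²/2.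
  nlinarith [sq_nonneg (Y - 2 * (D * (τ + 1)))]

end AdvDiff

end

/-! ### Choice of scales and the modulus of continuity in L². -/

noncomputable section

namespace AdvDiff

/-- Errors that are powers of the viscosity scale are absorbed into powers of its logarithm; the
factorial comes from a single term of the exponential series. -/
lemma exp_neg_le_factorial_mul_rpow {q l : ℝ} (hl : 1 ≤ l) :
    Real.exp (-l) ≤ (Nat.factorial ⌈q⌉₊ : ℝ) * l ^ (-q) := by
  have hl0 : 0 < l := by linarith
  have h1 := Real.pow_div_factorial_le_exp l hl0.le ⌈q⌉₊
  have h2 : l ^ q ≤ l ^ ⌈q⌉₊ := by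
    rw [← Real.rpow_natCast]
    exact Real.rpow_le_rpow_of_exponent_le hl (Nat.le_ceil q)
  have hf : (0 : ℝ) < Nat.factorial ⌈q⌉₊ := by exact_mod_cast Nat.factorial_pos _
  rw [div_le_iff₀ hf] at h1
  rw [Real.exp_neg, Real.rpow_neg hl0.le, ← div_eq_mul_inv, inv_eq_one_div,
    div_le_div_iff₀ (Real.exp_pos l) (by positivity)]
  linarith

lemma conv_congr_ae {d : ℕ} {R f g : Torus d → ℝ} (h : f =ᵐ[volume] g) : conv R f = conv R g :=
  funext fun x => integral_congr_ae (h.mono fun y hy => by simp only [hy])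

/-- The scale separation at viscosity `exp (-4l)` and the corresponding frequency `n`. -/
lemma exists_scale {l κ : ℝ} (hl : 1 ≤ l) (hκ : 0 ≤ κ) :
    ∃ n : ℕ, 1 ≤ n ∧ l ^ κ ≤ Real.exp (-l) ^ 4 * n ∧ Real.exp (-l) ^ 4 * n ≤ 2 * l ^ κ := by
  have he : 0 < Real.exp (-l) ^ 4 := by positivity
  have he1 : Real.exp (-l) ^ 4 ≤ 1 := pow_le_one₀ (Real.exp_pos _).le
    (Real.exp_le_one_iff.2 (by linarith))
  have hX : 1 ≤ l ^ κ := Real.one_le_rpow hl hκ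
  have h1 : 1 ≤ l ^ κ / Real.exp (-l) ^ 4 := (one_le_div he).2 (he1.trans hX)
  refine ⟨⌈l ^ κ / Real.exp (-l) ^ 4⌉₊, Nat.one_le_ceil_iff.2 (by linarith), ?_, ?_⟩
  · have := Nat.le_ceil (l ^ κ / Real.exp (-l) ^ 4)
    rwa [div_le_iff₀ he, mul_comm] at this
  · have := (Nat.ceil_lt_add_one (by linarith : 0 ≤ l ^ κ / Real.exp (-l) ^ 4)).le
    have h2 : (⌈l ^ κ / Real.exp (-l) ^ 4⌉₊ : ℝ) ≤ 2 * (l ^ κ / Real.exp (-l) ^ 4) := by linarith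
    calc _ ≤ Real.exp (-l) ^ 4 * (2 * (l ^ κ / Real.exp (-l) ^ 4)) :=
          mul_le_mul_of_nonneg_left h2 he.le
      _ = _ := by field_simp

/-- A family of diffusive solutions with dissipation rate `O(log (1/ν) ^ (-q))` as `ν → 0`. -/
structure LogDissipation {d : ℕ} (τ M q M₁ ν₀ : ℝ) (b : ℝ → Torus d → Euc d)
    (u : ℝ → ℝ → Torus d → ℝ) (u₀ : Torus d → ℝ) : Prop where
  weakSol : ∀ ν, 0 < ν → WeakSol τ b ν M (u ν)
  initial : ∀ ν, 0 < ν → u ν 0 =ᵐ[volume] u₀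
  grad : ∀ ν, 0 < ν → ν < ν₀ → ∃ γ, HasGradBound τ (u ν) γ ∧
    ∫ s in Set.Icc 0 τ, γ s ≤ M₁ * Real.log (1 / ν) ^ (-q) / ν

lemma LogDissipation.grad_exp {d : ℕ} {τ M q M₁ ν₀ : ℝ} {b : ℝ → Torus d → Euc d}
    {u : ℝ → ℝ → Torus d → ℝ} {u₀ : Torus d → ℝ} (hu : LogDissipation τ M q M₁ ν₀ b u u₀)
    (hq : 0 < q) (hM₁ : 0 < M₁) {l : ℝ} (hl : 0 < l) (hν : Real.exp (-l) < ν₀) {k : ℕ}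
    (hk : k ≠ 0) :
    ∃ γ, HasGradBound τ (u (Real.exp (-l) ^ k)) γ ∧
      ∫ s in Set.Icc 0 τ, γ s ≤ M₁ * l ^ (-q) / Real.exp (-l) ^ k := by
  have he1 : Real.exp (-l) ≤ 1 := Real.exp_le_one_iff.2 (by linarith)
  obtain ⟨γ, h1, h2⟩ := hu.grad (Real.exp (-l) ^ k) (by positivity)
    ((pow_le_of_le_one (Real.exp_pos _).le he1 hk).trans_lt hν)
  refine ⟨γ, h1, h2.trans ?_⟩
  have e : Real.log (1 / Real.exp (-l) ^ k) = k * l := by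
    rw [one_div, Real.log_inv, Real.log_pow, Real.log_exp]
    ring
  rw [e]
  have hk1 : (1 : ℝ) ≤ k := by exact_mod_cast Nat.one_le_iff_ne_zero.2 hk
  have : (k * l) ^ (-q) ≤ l ^ (-q) :=
    Real.rpow_le_rpow_of_nonpos hl (by nlinarith) (by linarith)
  gcongr

/-- Both the viscosity and the length of the initial layer are e = exp(-l), so viscosity times
dissipation is M₁ l^{-q}. As n ≥ e⁻⁴, the remaining two terms are O(e). At viscosity e⁴ no layer
length would make both of them small enough. -/
theorem LogDissipation.integral_initial_le {d : ℕ} (hd : 0 < d) {K τ M p B q M₁ ν₀ : ℝ}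
    (hp : 2 < p) (hB : 0 ≤ B) (hM0 : 0 ≤ M) (hq : 0 < q) (hM₁ : 0 < M₁) {R : ℕ → Torus d → ℝ}
    (h : ∀ n, 1 ≤ n → IsKernel n K (R n)) {b : ℝ → Torus d → Euc d} (hb : IsTimeDrift τ p B b)
    {u : ℝ → ℝ → Torus d → ℝ} {u₀ : Torus d → ℝ} (hu : LogDissipation τ M q M₁ ν₀ b u u₀)
    {l : ℝ} (hl : 1 ≤ l) (hν : Real.exp (-l) < ν₀) (hτ : Real.exp (-l) ≤ τ) {n : ℕ} (hn : 1 ≤ n)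
    (hnl : 1 ≤ Real.exp (-l) ^ 4 * n) :
    ∫ x, (u₀ x - conv (R n) u₀ x) ^ 2 ≤
      2 * (2 * M₁ + (M * √(K * d * M₁) + M * (2 * M * B * (d * K))) * (Nat.factorial ⌈q⌉₊ : ℝ)) *
        l ^ (-q) := by
  have hl0 : 0 < l := by linarith
  have hn0 : (0 : ℝ) < n := by exact_mod_cast hn
  have hK := (h n hn).one_le
  obtain ⟨γ, hγ, hΓ⟩ := hu.grad_exp hq hM₁ hl0 hν one_ne_zero
  rw [pow_one] at hγ hΓ
  have he := exp_neg_le_factorial_mul_rpow (q := q) hl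
  set e := Real.exp (-l) with he'
  have he0 : 0 < e := Real.exp_pos _
  have hw := hu.weakSol e he0
  have hini := hu.initial e he0
  have hm := hw.integral_conv_sub_sq_initial_le hd hn hp hB he0.le h hb hγ he0 hτ hΓ
  have e1 : ∫ x, (u₀ x - conv (R n) u₀ x) ^ 2 =
      ∫ x, (u e 0 x - conv (R n) (u e 0) x) ^ 2 := by
    rw [conv_congr_ae hini]
    exact integral_congr_ae (hini.mono fun x hx => by simp only [hx])
  have hlq : l ^ (-q) ≤ 1 := Real.rpow_le_one_of_one_le_of_nonpos hl (by linarith)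
  have hlq0 : 0 < l ^ (-q) := by positivity
  have hs : √(K / n * (d * (M₁ * l ^ (-q) / e / e))) ≤ √(K * d * M₁) * e := by
    rw [← Real.sqrt_sq he0.le, ← Real.sqrt_mul (by positivity), Real.sqrt_sq he0.le]
    refine Real.sqrt_le_sqrt ?_
    have h3 : 1 / (n : ℝ) ≤ e ^ 4 := by
      rw [div_le_iff₀ hn0]
      exact hnl
    calc K / n * (d * (M₁ * l ^ (-q) / e / e)) = (K * d * M₁) * (1 / n) * (l ^ (-q)) / e ^ 2 := by
          field_simp
      _ ≤ (K * d * M₁) * e ^ 4 * 1 / e ^ 2 := by gcongr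
      _ = K * d * M₁ * e ^ 2 := by field_simp
  have hs' : e * (M₁ * l ^ (-q) / e) = M₁ * l ^ (-q) := by field_simp
  rw [e1]
  refine hm.trans ?_
  have a1 : M * √(K / n * (d * (M₁ * l ^ (-q) / e / e))) ≤
      M * √(K * d * M₁) * ((Nat.factorial ⌈q⌉₊ : ℝ) * l ^ (-q)) := by
    rw [mul_assoc]
    refine mul_le_mul_of_nonneg_left (hs.trans ?_) hM0
    gcongr
  have a2 : M * (2 * M * B * (d * K)) * e ≤
      M * (2 * M * B * (d * K)) * ((Nat.factorial ⌈q⌉₊ : ℝ) * l ^ (-q)) := by gcongr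
  have a3 : 2 * e * (M₁ * l ^ (-q) / e) = 2 * (M₁ * l ^ (-q)) := by rw [mul_assoc, hs']
  rw [a3]
  linarith

lemma integral_shift_sq_le {d : ℕ} {f g : Torus d → ℝ} (hf : MemLp f 2) (hg : MemLp g 2)
    (a : Torus d) {c : ℝ} (hc : ∀ x, (g (x + a) - g x) ^ 2 ≤ c) :
    ∫ x, (f (x + a) - f x) ^ 2 ≤ 6 * (∫ x, (f x - g x) ^ 2) + 3 * c := by
  have hz : Integrable fun x => (f x - g x) ^ 2 := (hf.sub hg).integrable_sq
  have hzs : Integrable fun x => (f (x + a) - g (x + a)) ^ 2 := hz.comp_add_right a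
  have hsum : Integrable fun x => 3 * (f (x + a) - g (x + a)) ^ 2 + 3 * (f x - g x) ^ 2 :=
    (hzs.const_mul 3).add (hz.const_mul 3)
  have hdom : ∫ x, (f (x + a) - f x) ^ 2 ≤
      ∫ x, ((3 * (f (x + a) - g (x + a)) ^ 2 + 3 * (f x - g x) ^ 2) + 3 * c) := by
    refine integral_mono_of_nonneg (Eventually.of_forall fun _ => sq_nonneg _)
      (hsum.add (integrable_const _)) (Eventually.of_forall fun x => ?_)
    have h1 := hc x
    have h2 : f (x + a) - f x = (f (x + a) - g (x + a)) + (g (x + a) - g x) - (f x - g x) := by ring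
    simp only
    rw [h2]
    generalize f (x + a) - g (x + a) = A at *
    generalize g (x + a) - g x = G at *
    generalize f x - g x = D at *
    nlinarith [sq_nonneg (A - G), sq_nonneg (A + D), sq_nonneg (G + D)]
  refine hdom.trans ?_
  rw [integral_add hsum (integrable_const _), integral_add (hzs.const_mul 3) (hz.const_mul 3),
    integral_const_mul, integral_const_mul, integral_comp_add_const (fun x => (f x - g x) ^ 2) a]
  simp only [integral_const, probReal_univ, smul_eq_mul, one_mul]
  linarith

/-- At increment length e⁴ = exp(-4l), v is compared with the solution of viscosity e⁴ mollified at
e⁴ n ≈ l^{q/(p-1)}. The initial datum is handled at viscosity e, and the mollified solution is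
Lipschitz. -/
theorem LogDissipation.exists_integral_shift_le {d : ℕ} (hd : 0 < d) {K τ M p B q M₁ ν₀ : ℝ}
    (hp : 2 < p) (hB : 0 ≤ B) (hM0 : 0 ≤ M) (hq : 0 < q) (hM₁ : 0 < M₁) {R : ℕ → Torus d → ℝ}
    (h : ∀ n, 1 ≤ n → IsKernel n K (R n)) {b : ℝ → Torus d → Euc d} (hb : IsTimeDrift τ p B b)
    {u : ℝ → ℝ → Torus d → ℝ} {v : ℝ → Torus d → ℝ} (hu : LogDissipation τ M q M₁ ν₀ b u (v 0))
    (hv : WeakSol τ b 0 M v) :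
    ∃ C : ℝ, 0 ≤ C ∧ ∀ l : ℝ, 1 ≤ l → Real.exp (-l) < ν₀ → Real.exp (-l) ≤ τ →
      ∀ y : Euc d, ‖y‖ = Real.exp (-l) ^ 4 →
        ∫ x, (v τ (x + proj y) - v τ x) ^ 2 ≤ C * l ^ (-(q * ((p - 2) / (p - 1)))) := by
  have hK := (h 1 le_rfl).one_le
  have hp1 : 0 < p - 1 := by linarith
  have hp0 : 0 < p := by linarith
  set r := q * ((p - 2) / (p - 1)) with hr
  have hrq : r = q - q / (p - 1) := by rw [hr]; field_simp; ring
  have hκ : 0 ≤ q / (p - 1) := by positivity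
  set C₀ := 2 * (2 * M₁ + (M * √(K * d * M₁) + M * (2 * M * B * (d * K))) *
    (Nat.factorial ⌈q⌉₊ : ℝ)) with hC₀
  set A := ((2 * M) ^ (2 / p) * B * (d * (2 * K)) * (d * M₁) ^ ((p - 2) / (2 * p)) +
    d * K * √(2 * M₁)) * (τ + 1) with hA
  set E := 2 * (d * K * M) ^ 2 * (Nat.factorial ⌈q⌉₊ : ℝ) with hE
  have hC₀0 : 0 ≤ C₀ := by positivity
  have hE0 : 0 ≤ E := by positivity
  refine ⟨6 * (2 * C₀ + 4 * A ^ 2) + 3 * E, by positivity, fun l hl hlν hlτ y hy => ?_⟩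
  have hl0 : 0 < l := by linarith
  have hτ0 : 0 < τ := (Real.exp_pos _).trans_le hlτ
  have hτm : τ ∈ Set.Icc 0 τ := ⟨hτ0.le, le_rfl⟩
  have he1 : Real.exp (-l) ≤ 1 := Real.exp_le_one_iff.2 (by linarith)
  obtain ⟨n, hn, hn1, hn2⟩ := exists_scale hl hκ
  have hn0 : (0 : ℝ) < n := by exact_mod_cast hn
  have hX : 1 ≤ l ^ (q / (p - 1)) := Real.one_le_rpow hl hκ
  have hI := hu.integral_initial_le hd hp hB hM0 hq hM₁ h hb hl hlν hlτ hn (hX.trans hn1)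
  obtain ⟨γ, hγ, hΓ⟩ := hu.grad_exp hq hM₁ hl0 hlν four_ne_zero
  have he := exp_neg_le_factorial_mul_rpow (q := q) hl
  set e := Real.exp (-l) with he'
  have he0 : 0 < e := Real.exp_pos _
  have hν0 : 0 < e ^ 4 := by positivity
  have hw := hu.weakSol (e ^ 4) hν0
  have hini := hu.initial (e ^ 4) hν0
  have hk := h n hn
  have hlq0 : 0 < l ^ (-q) := by positivity
  have hm := WeakSol.integral_sub_conv_sq_le hd hn hp hB hν0.le h hv hw hb hγ
    (by positivity : 0 < M₁ * l ^ (-q) / e ^ 4) hΓ hτm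
  rw [conv_congr_ae hini] at hm
  have hlr : l ^ (-q) ≤ l ^ (-r) := Real.rpow_le_rpow_of_exponent_le hl (by rw [hrq]; linarith)
  have hsq : (l ^ (-r / 2)) ^ 2 = l ^ (-r) := by
    rw [← Real.rpow_natCast, ← Real.rpow_mul hl0.le]
    norm_num
  -- Commutator term: the base is of order l^{-q-q/(p-1)} = l^{-qp/(p-1)}, and the power (p-2)/(2p)
  -- turns this into l^{-r/2}.
  have hD1 : (d * (M₁ * l ^ (-q) / e ^ 4) / n) ^ ((p - 2) / (2 * p)) ≤
      (d * M₁) ^ ((p - 2) / (2 * p)) * l ^ (-r / 2) := by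
    have hexp : l ^ (-r / 2) = (l ^ (-q) / l ^ (q / (p - 1))) ^ ((p - 2) / (2 * p)) := by
      rw [← Real.rpow_sub hl0, ← Real.rpow_mul hl0.le, hr]
      congr 1
      field_simp
      ring
    rw [hexp, ← Real.mul_rpow (by positivity) (by positivity)]
    refine Real.rpow_le_rpow (by positivity) ?_ (div_nonneg (by linarith) (by linarith))
    calc d * (M₁ * l ^ (-q) / e ^ 4) / n = d * M₁ * (l ^ (-q) / (e ^ 4 * n)) := by field_simp
      _ ≤ _ := by gcongr
  -- Diffusive term: its square is of order (e⁴ n) l^{-q} ≈ l^{q/(p-1)-q} = l^{-r}, the same rate,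
  -- which is why the exponent q/(p-1) is optimal here.
  have hD2 : e ^ 4 * (d * (K * √n * √(M₁ * l ^ (-q) / e ^ 4))) ≤ d * K * √(2 * M₁) * l ^ (-r / 2) := by
    have h1 : e ^ 4 * (√n * √(M₁ * l ^ (-q) / e ^ 4)) ≤ √(2 * M₁) * l ^ (-r / 2) := by
      rw [← Real.sqrt_mul hn0.le]
      nth_rewrite 1 [← Real.sqrt_sq hν0.le]
      rw [← Real.sqrt_mul (by positivity), ← Real.sqrt_sq (by positivity : 0 ≤ l ^ (-r / 2)),
        ← Real.sqrt_mul (by positivity), hsq]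
      refine Real.sqrt_le_sqrt ?_
      calc (e ^ 4) ^ 2 * (n * (M₁ * l ^ (-q) / e ^ 4)) = M₁ * l ^ (-q) * (e ^ 4 * n) := by
            field_simp
        _ ≤ M₁ * l ^ (-q) * (2 * l ^ (q / (p - 1))) := by gcongr
        _ = 2 * M₁ * (l ^ (-q) * l ^ (q / (p - 1))) := by ring
        _ = 2 * M₁ * l ^ (-r) := by
            rw [← Real.rpow_add hl0, hrq]
            congr 2
            ring
    calc _ = d * K * (e ^ 4 * (√n * √(M₁ * l ^ (-q) / e ^ 4))) := by ring
      _ ≤ d * K * (√(2 * M₁) * l ^ (-r / 2)) := by gcongr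
      _ = _ := by ring
  have hz : ∫ x, (v τ x - conv (R n) (u (e ^ 4) τ) x) ^ 2 ≤ (2 * C₀ + 4 * A ^ 2) * l ^ (-r) := by
    refine hm.trans ?_
    have h1 : ((2 * M) ^ (2 / p) * B * (d * (2 * K)) *
        (d * (M₁ * l ^ (-q) / e ^ 4) / n) ^ ((p - 2) / (2 * p)) +
        e ^ 4 * (d * (K * √n * √(M₁ * l ^ (-q) / e ^ 4)))) * (τ + 1) ≤ A * l ^ (-r / 2) := by
      calc _ ≤ ((2 * M) ^ (2 / p) * B * (d * (2 * K)) *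
            ((d * M₁) ^ ((p - 2) / (2 * p)) * l ^ (-r / 2)) +
            d * K * √(2 * M₁) * l ^ (-r / 2)) * (τ + 1) := by gcongr
        _ = _ := by rw [hA]; ring
    have h2 := pow_le_pow_left₀ (by positivity) h1 2
    rw [mul_pow A, hsq] at h2
    have h3 : C₀ * l ^ (-q) ≤ C₀ * l ^ (-r) := by gcongr
    linarith
  have hF := hk.finiteRank.smooth_conv (hw.integrable hτm)
  have hFb : ∀ x, (conv (R n) (u (e ^ 4) τ) (x + proj y) - conv (R n) (u (e ^ 4) τ) x) ^ 2 ≤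
      E * l ^ (-r) := by
    intro x
    have h1 := abs_conv_shift_le hM0 hk (hw.smeas τ hτm) (hw.bdd τ hτm) x y
    have h2 := pow_le_pow_left₀ (abs_nonneg _) h1 2
    rw [sq_abs, hy] at h2
    refine h2.trans ?_
    have he4 : e ^ 4 ≤ e := pow_le_of_le_one he0.le he1 four_ne_zero
    -- One factor e⁴ compensates n up to a power of l, and the other one remains as an exponentially
    -- small gain.
    calc (e ^ 4 * (d * (K * √n * M))) ^ 2 = (d * K * M) ^ 2 * (e ^ 4 * (e ^ 4 * (√n) ^ 2)) := by ring
      _ = (d * K * M) ^ 2 * (e ^ 4 * (e ^ 4 * n)) := by rw [Real.sq_sqrt hn0.le]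
      _ ≤ (d * K * M) ^ 2 * (((Nat.factorial ⌈q⌉₊ : ℝ) * l ^ (-q)) *
          (2 * l ^ (q / (p - 1)))) := by
            gcongr
            exact he4.trans he
      _ = E * (l ^ (-q) * l ^ (q / (p - 1))) := by rw [hE]; ring
      _ = E * l ^ (-r) := by
          rw [← Real.rpow_add hl0, hrq]
          congr 2
          ring
  have := integral_shift_sq_le (memLp_two_of_bound (hv.smeas τ hτm) (hv.bdd τ hτm))
    (memLp_of_smooth hF 2) (proj y) hFb
  linarith

end AdvDiff

end

/-! ### From L² increments to the log-Sobolev class. -/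

noncomputable section

namespace AdvDiff

lemma integrableOn_inv_mul_log_rpow {s : ℝ} (hs : 0 < s) :
    IntegrableOn (fun ρ : ℝ => ρ⁻¹ * Real.log (1 / ρ) ^ (-s - 1)) (Set.Ioc 0 (1 / 3)) := by
  have hlog : ∀ ρ : ℝ, 0 < ρ → ρ ≤ 1 / 3 → 0 < Real.log (1 / ρ) := fun ρ h0 h1 => by
    refine Real.log_pos ?_
    rw [lt_div_iff₀ h0]
    linarith
  have hd : ∀ ρ : ℝ, 0 < ρ → HasDerivAt (fun ρ : ℝ => Real.log (1 / ρ)) (-ρ⁻¹) ρ := by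
    intro ρ h0
    simp only [one_div, Real.log_inv]
    exact (Real.hasDerivAt_log h0.ne').neg
  have hd' : ∀ ρ : ℝ, 0 < ρ → ρ ≤ 1 / 3 →
      HasDerivAt (fun ρ : ℝ => Real.log (1 / ρ) ^ (-s) / s) (ρ⁻¹ * Real.log (1 / ρ) ^ (-s - 1)) ρ := by
    intro ρ h0 h1
    have := ((hd ρ h0).rpow_const (p := -s) (Or.inl (hlog ρ h0 h1).ne')).div_const s
    refine this.congr_deriv ?_
    rw [div_eq_iff hs.ne']
    ring
  refine intervalIntegral.integrableOn_deriv_of_nonneg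
    (g := fun ρ : ℝ => Real.log (1 / ρ) ^ (-s) / s) ?_ (fun ρ h => hd' ρ h.1 h.2.le)
    fun ρ h => mul_nonneg (inv_nonneg.2 h.1.le) (Real.rpow_nonneg (hlog ρ h.1 h.2.le).le _)
  intro ρ hρ
  rcases hρ.1.eq_or_lt with h0 | h0
  · subst h0
    -- The default values 1/0 = 0, log 0 = 0 and 0^(-s) = 0 agree with the limit at 0, so the
    -- antiderivative is continuous up to the endpoint.
    have e : Real.log (1 / (0 : ℝ)) ^ (-s) / s = 0 := by
      rw [div_zero, Real.log_zero, Real.zero_rpow (by linarith), zero_div]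
    rw [ContinuousWithinAt, e, ← Set.Ioc_insert_left (by norm_num : (0 : ℝ) ≤ 1 / 3),
      nhdsWithin_insert]
    refine Tendsto.sup ?_ ?_
    · have h2 := tendsto_pure_nhds (fun ρ : ℝ => Real.log (1 / ρ) ^ (-s) / s) 0
      simp only [e] at h2
      exact h2
    · have h1 : Tendsto (fun ρ : ℝ => Real.log (1 / ρ)) (𝓝[Set.Ioc 0 (1 / 3)] 0) atTop := by
        simp only [one_div]
        exact Real.tendsto_log_atTop.comp (tendsto_inv_nhdsGT_zero.mono_left
          (nhdsWithin_mono _ Set.Ioc_subset_Ioi_self))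
      simpa using ((tendsto_rpow_neg_atTop hs).comp h1).div_const s
  · exact (hd' ρ h0 hρ.2).continuousAt.continuousWithinAt

lemma integrableOn_norm_rpow_mul_log {d : ℕ} (hd : 0 < d) {s : ℝ} (hs : 0 < s) :
    IntegrableOn (fun h : Euc d => 1 / ‖h‖ ^ d * Real.log (1 / ‖h‖) ^ (-s - 1))
      (Metric.ball (0 : Euc d) (1 / 3)) := by
  have : Nonempty (Fin d) := ⟨⟨0, hd⟩⟩
  have : Nontrivial (Euc d) := inferInstance
  have h1 := integrableOn_fun_norm_addHaar (E := Euc d) volume (r := 1 / 3)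
    (f := fun ρ : ℝ => 1 / ρ ^ d * Real.log (1 / ρ) ^ (-s - 1))
  refine h1.2 ?_
  refine ((integrableOn_inv_mul_log_rpow hs).mono_set Set.Ioo_subset_Ioc_self).congr_fun ?_
    measurableSet_Ioo
  intro ρ hρ
  have hρ0 : ρ ≠ 0 := hρ.1.ne'
  simp only [finrank_euclideanSpace, Fintype.card_fin, smul_eq_mul]
  obtain ⟨k, rfl⟩ : ∃ k, d = k + 1 := ⟨d - 1, by omega⟩
  rw [Nat.add_sub_cancel, ← mul_assoc]
  congr 1
  field_simp
  ring

/-- The modulus of continuity turns the weight into ‖h‖^{-d} log(1/‖h‖)^{-(r'-r)-1}; in polar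
coordinates the strict inequality r < r' is exactly what integrability at 0 requires. -/
theorem memHlog_of_shift_le {d : ℕ} (hd : 0 < d) {f : Torus d → ℝ} (hf : MemLp f 2) {r r' C : ℝ}
    (hr : r < r')
    (h : ∀ y : Euc d, 0 < ‖y‖ → ‖y‖ < 1 / 3 →
      ∫ x, (f (x + proj y) - f x) ^ 2 ≤ C * Real.log (1 / ‖y‖) ^ (-r')) :
    MemHlog r f := by
  refine ⟨hf, ENNReal.add_lt_top.2 ⟨ENNReal.pow_lt_top hf.2, ?_⟩⟩
  have hi := (integrableOn_norm_rpow_mul_log hd (sub_pos.2 hr)).const_mul C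
  refine lt_of_le_of_lt ?_ hi.lintegral_lt_top
  refine setLIntegral_mono_ae' Metric.isOpen_ball.measurableSet ?_
  have : Nonempty (Fin d) := ⟨⟨0, hd⟩⟩
  have h0 : ∀ᵐ y : Euc d, y ≠ 0 := by
    simp [ae_iff]
  filter_upwards [h0] with y hy0 hy
  have hy1 : ‖y‖ < 1 / 3 := by simpa using hy
  have hy2 : 0 < ‖y‖ := norm_pos_iff.2 hy0
  have hlog : 0 < Real.log (1 / ‖y‖) := by
    refine Real.log_pos ?_
    rw [lt_div_iff₀ hy2]
    linarith
  have hfs : MemLp (fun x => f (x + proj y) - f x) 2 :=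
    (hf.comp_measurePreserving (measurePreserving_add_right volume (proj y))).sub hf
  have e : ∀ x, |f (x + proj y) - f x| ^ 2 / ‖y‖ ^ d * (1 / Real.log (1 / ‖y‖) ^ (1 - r)) =
      (f (x + proj y) - f x) ^ 2 * (1 / ‖y‖ ^ d * (1 / Real.log (1 / ‖y‖) ^ (1 - r))) := by
    intro x
    rw [sq_abs]
    ring
  simp only [e]
  rw [← ofReal_integral_eq_lintegral_ofReal (hfs.integrable_sq.mul_const _)
    (Eventually.of_forall fun x => by positivity), integral_mul_const]
  refine ENNReal.ofReal_le_ofReal ?_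
  calc _ ≤ C * Real.log (1 / ‖y‖) ^ (-r') *
        (1 / ‖y‖ ^ d * (1 / Real.log (1 / ‖y‖) ^ (1 - r))) := by
        gcongr
        exact h y hy2 hy1
    _ = C * (1 / ‖y‖ ^ d * Real.log (1 / ‖y‖) ^ (-(r' - r) - 1)) := by
        rw [show -(r' - r) - 1 = -r' + -(1 - r) by ring, Real.rpow_add hlog,
          Real.rpow_neg hlog.le (1 - r)]
        ring

theorem LogDissipation.memHlog {d : ℕ} (hd : 0 < d) {K τ M p B q M₁ ν₀ r : ℝ} (hτ : 0 < τ)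
    (hν₀ : 0 < ν₀) (hp : 2 < p) (hB : 0 ≤ B) (hM0 : 0 ≤ M) (hq : 0 < q) (hM₁ : 0 < M₁)
    {R : ℕ → Torus d → ℝ}
    (h : ∀ n, 1 ≤ n → IsKernel n K (R n)) {b : ℝ → Torus d → Euc d} (hb : IsTimeDrift τ p B b)
    {u : ℝ → ℝ → Torus d → ℝ} {v : ℝ → Torus d → ℝ} (hu : LogDissipation τ M q M₁ ν₀ b u (v 0))
    (hv : WeakSol τ b 0 M v) (hr : r < q * ((p - 2) / (p - 1))) : MemHlog r (v τ) := by
  have hτm : τ ∈ Set.Icc 0 τ := ⟨hτ.le, le_rfl⟩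
  have hv2 := memLp_two_of_bound (hv.smeas τ hτm) (hv.bdd τ hτm)
  obtain ⟨C, hC0, hC⟩ := hu.exists_integral_shift_le hd hp hB hM0 hq hM₁ h hb hv
  set r' := q * ((p - 2) / (p - 1)) with hr'
  have hr'0 : 0 ≤ r' := mul_nonneg hq.le (div_nonneg (by linarith) (by linarith))
  obtain ⟨l₀, hl₀1, hl₀ν, hl₀τ⟩ : ∃ l₀ : ℝ, 1 ≤ l₀ ∧ Real.exp (-l₀) < ν₀ ∧ Real.exp (-l₀) ≤ τ := by
    have ht := Real.tendsto_exp_neg_atTop_nhds_zero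
    obtain ⟨l₀, h1, h2, h3⟩ := ((eventually_ge_atTop (1 : ℝ)).and
      ((ht.eventually_lt_const hν₀).and (ht.eventually_le_const hτ))).exists
    exact ⟨l₀, h1, h2, h3⟩
  refine memHlog_of_shift_le hd hv2 hr
    (C := C * 4 ^ r' + (2 * M) ^ 2 * (4 * l₀) ^ r') fun y hy0 hy1 => ?_
  set L := Real.log (1 / ‖y‖) with hL
  have hL0 : 0 < L := by
    refine Real.log_pos ?_
    rw [lt_div_iff₀ hy0]
    linarith
  -- The scale estimate is applied with l = L/4, so that ‖y‖ = exp(-4l). For larger increments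
  -- L^(-r') is bounded below and the L^∞ bound is enough.
  rcases le_total (4 * l₀) L with hl | hl
  · have hexp : Real.exp (-(L / 4)) ≤ Real.exp (-l₀) := Real.exp_le_exp.2 (by linarith)
    have hy : ‖y‖ = Real.exp (-(L / 4)) ^ 4 := by
      rw [← Real.exp_nat_mul, hL, one_div, Real.log_inv]
      push_cast
      rw [show 4 * -(-Real.log ‖y‖ / 4) = Real.log ‖y‖ by ring, Real.exp_log hy0]
    have h1 := hC (L / 4) (by linarith) (hexp.trans_lt hl₀ν) (hexp.trans hl₀τ) y hy
    have h2 : (L / 4) ^ (-r') = 4 ^ r' * L ^ (-r') := by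
      rw [Real.div_rpow hL0.le (by norm_num), Real.rpow_neg (by norm_num : (0 : ℝ) ≤ 4),
        div_inv_eq_mul, mul_comm]
    rw [h2] at h1
    have : 0 ≤ (2 * M) ^ 2 * (4 * l₀) ^ r' * L ^ (-r') := by positivity
    linarith
  · have h1 : ∫ x, (v τ (x + proj y) - v τ x) ^ 2 ≤ (2 * M) ^ 2 := by
      have hb1 : ∀ᵐ x, |v τ (x + proj y) - v τ x| ≤ 2 * M := by
        filter_upwards [hv.bdd τ hτm, (measurePreserving_add_right volume
          (proj y)).quasiMeasurePreserving.ae (hv.bdd τ hτm)] with x hx hx'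
        exact (abs_sub _ _).trans (by linarith)
      have hfs : MemLp (fun x => v τ (x + proj y) - v τ x) 2 :=
        (hv2.comp_measurePreserving (measurePreserving_add_right volume (proj y))).sub hv2
      have := integral_mono_ae hfs.integrable_sq (integrable_const ((2 * M) ^ 2)) (by
        filter_upwards [hb1] with x hx
        exact sq_le_sq' (neg_le_of_abs_le hx) (le_of_abs_le hx))
      simpa using this
    have h2 : 1 ≤ (4 * l₀) ^ r' * L ^ (-r') := by
      rw [Real.rpow_neg hL0.le, ← div_eq_mul_inv, ← Real.div_rpow (by linarith) hL0.le]
      exact Real.one_le_rpow ((one_le_div hL0).2 hl) hr'0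
    have h3 : 0 ≤ C * 4 ^ r' * L ^ (-r') := by positivity
    have h4 := mul_le_mul_of_nonneg_left h2 (sq_nonneg (2 * M))
    linarith

end AdvDiff

end

/-! ### From distributional solutions to the form integrated in time. -/

noncomputable section

namespace AdvDiff

lemma tendsto_integral_mul_conv {d : ℕ} {K M : ℝ} {R : ℕ → Torus d → ℝ}
    (h : ∀ n, 1 ≤ n → IsKernel n K (R n)) {f g : Torus d → ℝ} (hf : AEStronglyMeasurable f)
    (hM : ∀ᵐ x, |f x| ≤ M) (hg : Integrable g) :
    Tendsto (fun n => ∫ x, f x * conv (R (n + 1)) g x) atTop (𝓝 (∫ x, f x * g x)) := by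
  have hF : ∀ n, SmoothOnTorus (conv (R (n + 1)) g) := fun n =>
    (h (n + 1) (by omega)).finiteRank.smooth_conv hg
  have hfi : Integrable f := (memLp_top_of_bound hf M hM).integrable le_top
  have h1 := (tendsto_lintegral_conv_sub h (p := 1) le_rfl
    (by simpa using memLp_one_iff_integrable.2 hg)).comp (tendsto_add_atTop_nat 1)
  simp only [ENNReal.rpow_one] at h1
  refine tendsto_integral_of_L1 _ (integrable_bdd_mul_shift hf hM hg).aestronglyMeasurable
    (Eventually.of_forall fun n => integrable_mul_continuous (hF n).continuous hfi) ?_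
  have h2 : Tendsto (fun n => ENNReal.ofReal M *
      ∫⁻ x, ‖conv (R (n + 1)) g x - g x‖ₑ) atTop (𝓝 0) := by
    have := ENNReal.Tendsto.const_mul (a := ENNReal.ofReal M) h1 (Or.inr ENNReal.ofReal_ne_top)
    rwa [mul_zero] at this
  refine tendsto_of_tendsto_of_tendsto_of_le_of_le tendsto_const_nhds h2 (fun _ => zero_le)
    fun n => ?_
  rw [← lintegral_const_mul' _ _ ENNReal.ofReal_ne_top]
  refine lintegral_mono_ae ?_
  filter_upwards [hM] with x hx
  rw [← mul_sub, enorm_mul]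
  refine mul_le_mul_left ?_ _
  rw [Real.enorm_eq_ofReal_abs]
  exact ENNReal.ofReal_le_ofReal hx

/-- The solution is known to be measurable in space and weakly continuous in time, without joint
measurability. Mollifying the other factor makes the pairing a finite sum of products of measurable
functions of time, and these converge to the rate. -/
theorem aestronglyMeasurable_rate {d : ℕ} {K τ ν M p B : ℝ} {R : ℕ → Torus d → ℝ}
    (h : ∀ n, 1 ≤ n → IsKernel n K (R n)) {b : ℝ → Torus d → Euc d} (hb : IsTimeDrift τ p B b)
    {w : ℝ → Torus d → ℝ} (hs : ∀ s ∈ Set.Icc 0 τ, AEStronglyMeasurable (w s))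
    (hM : ∀ s ∈ Set.Icc 0 τ, ∀ᵐ x, |w s x| ≤ M)
    (hc : ∀ φ : Torus d → ℝ, SmoothOnTorus φ →
      ContinuousOn (fun s => ∫ x, w s x * φ x) (Set.Icc 0 τ))
    {φ : Torus d → ℝ} (hφ : SmoothOnTorus φ) :
    AEStronglyMeasurable (rate b ν w φ) (volume.restrict (Set.Icc 0 τ)) := by
  set F : ℝ → Torus d → ℝ := fun σ x => (∑ i, b σ x i * pderiv i φ x) + ν * laplace φ x with hF
  have hFm : AEStronglyMeasurable (fun q : ℝ × Torus d => F q.1 q.2)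
      ((volume.restrict (Set.Icc 0 τ)).prod volume) := by
    refine AEStronglyMeasurable.add ?_ ?_
    · refine Finset.aestronglyMeasurable_fun_sum _ fun i _ => (hb.meas i).mul ?_
      exact ((hφ.pderiv i).continuous.comp continuous_snd).aestronglyMeasurable
    · exact ((hφ.laplace.continuous.comp continuous_snd).const_mul ν).aestronglyMeasurable
  have hFi : ∀ σ, IsDrift p B (b σ) → Integrable (F σ) := fun σ hd =>
    (integrable_finsetSum _ fun i _ => integrable_mul_continuous (hφ.pderiv i).continuous
      (hd.integrable i)).add (hφ.laplace.integrable.const_mul ν)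
  refine aestronglyMeasurable_of_tendsto_ae atTop
    (f := fun n σ => ∫ x, w σ x * conv (R (n + 1)) (F σ) x) (fun n => ?_) ?_
  · obtain ⟨ι, _, a, ha, hR⟩ := (h (n + 1) (by omega)).finiteRank
    have hm : AEStronglyMeasurable (fun σ => ∑ j, (∫ x, w σ x * a j x) * ∫ x, F σ x * a j x)
        (volume.restrict (Set.Icc 0 τ)) := by
      refine Finset.aestronglyMeasurable_fun_sum _ fun j _ =>
        ((hc _ (ha j)).aestronglyMeasurable measurableSet_Icc).mul ?_
      exact (hFm.mul ((ha j).continuous.comp continuous_snd).aestronglyMeasurable).integral_prod_right'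
    refine hm.congr ?_
    filter_upwards [hb.drift, ae_restrict_mem measurableSet_Icc] with σ hd hσ
    have hwi : Integrable (w σ) := (memLp_top_of_bound (hs σ hσ) M (hM σ hσ)).integrable le_top
    simp only [conv_eq_sum ha hR (hFi σ hd), Finset.mul_sum]
    rw [integral_finsetSum _ fun j _ => integrable_mul_continuous
      ((ha j).continuous.const_mul _) hwi]
    refine Finset.sum_congr rfl fun j _ => ?_
    rw [mul_comm, ← integral_const_mul]
    exact integral_congr_ae (Eventually.of_forall fun x => by simp only; ring)
  · filter_upwards [hb.drift, ae_restrict_mem measurableSet_Icc] with σ hd hσ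
    exact tendsto_integral_mul_conv h (hs σ hσ) (hM σ hσ) (hFi σ hd)

lemma exists_Icc_of_isCompact {K : Set ℝ} {τ : ℝ} (hτ : 0 < τ) (hK : IsCompact K)
    (h : K ⊆ Set.Ioo 0 τ) : ∃ a c : ℝ, 0 < a ∧ c < τ ∧ K ⊆ Set.Icc a c := by
  rcases K.eq_empty_or_nonempty with rfl | hne
  · exact ⟨τ / 2, τ / 2, by linarith, by linarith, Set.empty_subset _⟩
  · obtain ⟨a, ha, ha'⟩ := hK.exists_isLeast hne
    obtain ⟨c, hc, hc'⟩ := hK.exists_isGreatest hne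
    exact ⟨a, c, (h ha).1, (h hc).2, fun x hx => ⟨ha' hx, hc' hx⟩⟩

/-- A continuous function with an integrable distributional derivative is its primitive. -/
theorem eq_add_integral_of_forall_test {τ : ℝ} (hτ : 0 < τ) {A α : ℝ → ℝ}
    (hA : ContinuousOn A (Set.Icc 0 τ)) (hα : IntegrableOn α (Set.Icc 0 τ))
    (h : ∀ χ : ℝ → ℝ, ContDiff ℝ ∞ χ →
      (∃ a c : ℝ, 0 < a ∧ c < τ ∧ ∀ s, s ∉ Set.Icc a c → χ s = 0) →
      ∫ s in Set.Icc 0 τ, (deriv χ s * A s + χ s * α s) = 0) :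
    ∀ s ∈ Set.Icc 0 τ, A s = A 0 + ∫ σ in (0 : ℝ)..s, α σ := by
  have hα' : Integrable ((Set.Icc 0 τ).indicator α) :=
    (integrable_indicator_iff measurableSet_Icc).2 hα
  set P : ℝ → ℝ := fun s => 0 + ∫ σ in (0 : ℝ)..s, (Set.Icc 0 τ).indicator α σ with hP
  have hPc : Continuous P := continuous_primitive hα' 0
  have hgc : ContinuousOn (fun s => A s - P s) (Set.Icc 0 τ) := hA.sub hPc.continuousOn
  have hgi : ∀ θ : ℝ → ℝ, Continuous θ → IntegrableOn (fun s => θ s * (A s - P s)) (Set.Icc 0 τ) :=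
    fun θ hθ => (hθ.continuousOn.mul hgc).integrableOn_Icc
  -- The argument of du Bois-Reymond: a test function of zero mean is the derivative of a test
  -- function, so A - P is orthogonal to all of them.
  have claim : ∀ θ : ℝ → ℝ, ContDiff ℝ ∞ θ →
      (∃ a c : ℝ, 0 < a ∧ c < τ ∧ ∀ s, s ∉ Set.Icc a c → θ s = 0) → ∫ s, θ s = 0 →
      ∫ s in Set.Icc 0 τ, θ s * (A s - P s) = 0 := by
    rintro θ hθ ⟨a, c, ha, hc, hac⟩ hint
    have hθc := hθ.continuous
    have hθi : Integrable θ := hθc.integrable_of_hasCompactSupport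
      (HasCompactSupport.intro isCompact_Icc hac)
    set χ : ℝ → ℝ := fun s => 0 + ∫ σ in (0 : ℝ)..s, θ σ with hχ
    have hder : ∀ s, HasDerivAt χ (θ s) s := fun s =>
      (hθc.integral_hasStrictDerivAt 0 s).hasDerivAt.const_add 0
    have hder' : deriv χ = θ := funext fun s => (hder s).deriv
    have hχs : ContDiff ℝ ∞ χ := contDiff_infty_iff_deriv.2
      ⟨fun s => (hder s).differentiableAt, by rwa [hder']⟩
    have hχ0 : ∀ s, s ∉ Set.Icc a c → χ s = 0 := by
      intro s hs
      rw [hχ]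
      simp only [zero_add]
      rcases lt_or_ge s a with hsa | hsa
      · rw [intervalIntegral.integral_congr (g := fun _ => (0 : ℝ)) fun σ hσ => ?_,
          intervalIntegral.integral_zero]
        refine hac σ fun hm => ?_
        have := hσ.2
        rcases le_total 0 s with h0 | h0
        · rw [max_eq_right h0] at this
          linarith [hm.1]
        · rw [max_eq_left h0] at this
          linarith [hm.1]
      · have hsc : c < s := by
          by_contra hcon
          exact hs ⟨hsa, not_lt.1 hcon⟩
        rw [intervalIntegral.integral_eq_integral_of_support_subset, hint]
        intro σ hσ
        have : σ ∈ Set.Icc a c := by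
          by_contra hcon
          exact hσ (hac σ hcon)
        exact ⟨ha.trans_le this.1, this.2.trans hsc.le⟩
    have h1 := h χ hχs ⟨a, c, ha, hc, hχ0⟩
    rw [hder'] at h1
    have h2 := primitive_mul hθi hα' 0 0 τ
    have h3 : χ τ = 0 := hχ0 τ fun hm => absurd hm.2 (not_le.2 hc)
    change χ τ * P τ = 0 * 0 + ∫ σ in (0 : ℝ)..τ, (θ σ * P σ +
      χ σ * (Set.Icc 0 τ).indicator α σ) at h2
    rw [h3, zero_mul, zero_mul, zero_add, intervalIntegral.integral_of_le hτ.le,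
      ← integral_Icc_eq_integral_Ioc] at h2
    have h4 : ∫ σ in Set.Icc 0 τ, (θ σ * P σ + χ σ * α σ) = 0 := by
      refine Eq.trans ?_ h2.symm
      exact setIntegral_congr_fun measurableSet_Icc fun σ hσ => by
        simp only [Set.indicator_of_mem hσ]
    have hχα : IntegrableOn (fun s => χ s * α s) (Set.Icc 0 τ) :=
      hα.continuousOn_mul hχs.continuous.continuousOn isCompact_Icc
    have hi1 : IntegrableOn (fun s => θ s * A s + χ s * α s) (Set.Icc 0 τ) :=
      (hθc.continuousOn.mul hA).integrableOn_Icc.add hχα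
    have hi2 : IntegrableOn (fun s => θ s * P s + χ s * α s) (Set.Icc 0 τ) :=
      (hθc.mul hPc).continuousOn.integrableOn_Icc.add hχα
    have h5 := integral_sub hi1 hi2
    rw [h1, h4, sub_zero] at h5
    refine Eq.trans ?_ h5
    exact integral_congr_ae (Eventually.of_forall fun s => by simp only; ring)
  -- Subtracting a multiple of a fixed bump of unit mass gives any test function zero mean; hence A
  -- - P equals the constant c₀ almost everywhere, then everywhere by continuity.
  let η : ContDiffBump (τ / 2) := ⟨τ / 8, τ / 4, by linarith, by linarith⟩
  have hηs : ContDiff ℝ ∞ (η.normed volume) := η.contDiff_normed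
  have hηt : tsupport (η.normed volume) ⊆ Set.Ioo 0 τ := by
    rw [η.tsupport_normed_eq, Real.closedBall_eq_Icc]
    intro x hx
    have h1 : τ / 2 - τ / 4 ≤ x := hx.1
    have h2 : x ≤ τ / 2 + τ / 4 := hx.2
    exact ⟨by linarith, by linarith⟩
  set c₀ : ℝ := ∫ s in Set.Icc 0 τ, η.normed volume s * (A s - P s) with hc₀
  have hsub : ∀ ψ : ℝ → ℝ, tsupport ψ ⊆ Set.Ioo 0 τ → ∀ g : ℝ → ℝ,
      ∫ s in Set.Icc 0 τ, ψ s * g s = ∫ s, ψ s * g s := by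
    intro ψ hψ g
    refine setIntegral_eq_integral_of_forall_compl_eq_zero fun s hs => ?_
    rw [image_eq_zero_of_notMem_tsupport fun hm => hs (Set.Ioo_subset_Icc_self (hψ hm)), zero_mul]
  have hzero : ∀ ψ : ℝ → ℝ, ContDiff ℝ ∞ ψ → HasCompactSupport ψ → tsupport ψ ⊆ Set.Ioo 0 τ →
      ∫ s, ψ s • (A s - P s - c₀) = 0 := by
    intro ψ hψ hψc hψt
    have hηc : HasCompactSupport (η.normed volume) := η.hasCompactSupport_normed
    have hψi := hψ.continuous.integrable_of_hasCompactSupport hψc (μ := volume)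
    have hηi := hηs.continuous.integrable_of_hasCompactSupport hηc (μ := volume)
    obtain ⟨a, c, ha, hc, hac⟩ := exists_Icc_of_isCompact hτ
      (hψc.isCompact.union hηc.isCompact) (Set.union_subset hψt hηt)
    have h1 := claim (fun s => ψ s - (∫ σ, ψ σ) * η.normed volume s)
      (hψ.sub (contDiff_const.mul hηs)) ⟨a, c, ha, hc, fun s hs => by
        have h2 : s ∉ tsupport ψ := fun hm => hs (hac (Or.inl hm))
        have h3 : s ∉ tsupport (η.normed volume) := fun hm => hs (hac (Or.inr hm))
        simp only [image_eq_zero_of_notMem_tsupport h2, image_eq_zero_of_notMem_tsupport h3,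
          mul_zero, sub_zero]⟩ (by
        rw [integral_sub hψi (hηi.const_mul _), integral_const_mul, η.integral_normed, mul_one,
          sub_self])
    have h2 : ∫ s in Set.Icc 0 τ, ψ s = ∫ s, ψ s := by
      simpa using hsub ψ hψt fun _ => 1
    simp only [smul_eq_mul]
    rw [← hsub ψ hψt]
    have e1 : ∫ s in Set.Icc 0 τ, ψ s * (A s - P s - c₀) =
        (∫ s in Set.Icc 0 τ, ψ s * (A s - P s)) - c₀ * ∫ s, ψ s := by
      rw [← h2, ← integral_const_mul, ← integral_sub (hgi ψ hψ.continuous)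
        (hψi.integrableOn.const_mul _)]
      exact integral_congr_ae (Eventually.of_forall fun s => by simp only; ring)
    have e2 : ∫ s in Set.Icc 0 τ, (ψ s - (∫ σ, ψ σ) * η.normed volume s) * (A s - P s) =
        (∫ s in Set.Icc 0 τ, ψ s * (A s - P s)) - (∫ σ, ψ σ) * c₀ := by
      rw [hc₀, ← integral_const_mul, ← integral_sub (hgi ψ hψ.continuous)
        ((hgi _ hηs.continuous).const_mul _)]
      exact integral_congr_ae (Eventually.of_forall fun s => by simp only; ring)
    rw [e1, mul_comm c₀, ← e2, h1]
  have hae := isOpen_Ioo.ae_eq_zero_of_integral_contDiff_smul_eq_zero (μ := volume)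
    (((hgc.sub continuousOn_const).mono Set.Ioo_subset_Icc_self).locallyIntegrableOn
      measurableSet_Ioo) hzero
  have hae' : (fun s => A s - P s) =ᵐ[volume.restrict (Set.Icc 0 τ)] fun _ => c₀ := by
    rw [Filter.EventuallyEq, ← restrict_Ioo_eq_restrict_Icc, ae_restrict_iff' measurableSet_Ioo]
    filter_upwards [hae] with s hs hm
    exact sub_eq_zero.1 (hs hm)
  have heq := Measure.eqOn_Icc_of_ae_eq volume hτ.ne hae' hgc continuousOn_const
  intro s hs
  have h1 : A s - P s = c₀ := heq hs
  have h2 : A 0 - P 0 = c₀ := heq ⟨le_rfl, hτ.le⟩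
  have h3 : P 0 = 0 := by simp [hP]
  have h4 : P s = ∫ σ in (0 : ℝ)..s, α σ := by
    rw [hP, ← integral_indicator_primitive hs]
    simp
  linarith

/-- Product test functions χ(s)φ(x) reduce the equation to a scalar distributional derivative in
time, for each fixed φ. -/
theorem weakSol_of_solvesCauchy {d : ℕ} {K τ ν M p B : ℝ} {T : ℝ≥0∞} (hτ : 0 < τ)
    (hτT : ENNReal.ofReal τ ≤ T) {R : ℕ → Torus d → ℝ}
    (h : ∀ n, 1 ≤ n → IsKernel n K (R n)) {b : ℝ → Torus d → Euc d} (hb : IsTimeDrift τ p B b)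
    {u₀ : Torus d → ℝ} {w : ℝ → Torus d → ℝ}
    (hs : ∀ s ∈ Set.Icc 0 τ, AEStronglyMeasurable (w s))
    (hM : ∀ s ∈ Set.Icc 0 τ, ∀ᵐ x, |w s x| ≤ M)
    (hc : ∀ φ : Torus d → ℝ, SmoothOnTorus φ →
      ContinuousOn (fun s => ∫ x, w s x * φ x) (Set.Icc 0 τ))
    (hw : SolvesCauchy T b ν u₀ w) : WeakSol τ b ν M w where
  rate_meas φ hφ := aestronglyMeasurable_rate h hb hs hM hc hφ
  smeas := hs
  bdd := hM
  eqn φ hφ := by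
    have hrm := aestronglyMeasurable_rate (ν := ν) h hb hs hM hc hφ
    refine eq_add_integral_of_forall_test hτ (hc φ hφ) (integrableOn_rate hM hb hφ hrm) ?_
    rintro χ hχ ⟨a, c, ha, hcτ, hac⟩
    have hsub : Set.Icc 0 τ ⊆ timeInterval T := fun s hs =>
      ⟨hs.1, (ENNReal.ofReal_le_ofReal hs.2).trans hτT⟩
    have htest : IsTestFunction T fun s x => χ s * φ x := by
      refine ⟨(hχ.comp contDiff_fst).mul (ContDiff.comp (g := fun y : Euc d => φ (proj y)) hφ
        contDiff_snd), a, c, ha, ?_, fun s hs x => by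
        change χ s * φ x = 0
        rw [hac s hs, zero_mul]⟩
      exact ((ENNReal.ofReal_lt_ofReal_iff hτ).2 hcτ).trans_le hτT
    have hd0 : ∀ s, s ∉ Set.Icc 0 τ → χ s = 0 ∧ deriv χ s = 0 := by
      intro s hs
      have h1 : s ∈ (Set.Icc a c)ᶜ := fun hm => hs ⟨ha.le.trans hm.1, hm.2.trans hcτ.le⟩
      refine ⟨hac s h1, ?_⟩
      have : χ =ᶠ[𝓝 s] fun _ => 0 :=
        Filter.mem_of_superset (isClosed_Icc.isOpen_compl.mem_nhds h1) hac
      rw [this.deriv_eq, deriv_const]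
    have key := hw.1 _ htest
    have hpt : ∀ s x, w s x * (deriv (fun σ => χ σ * φ x) s +
        (∑ i, b s x i * pderiv i (fun x => χ s * φ x) x) + ν * laplace (fun x => χ s * φ x) x) =
        deriv χ s * (w s x * φ x) +
          χ s * (w s x * ((∑ i, b s x i * pderiv i φ x) + ν * laplace φ x)) := by
      intro s x
      have h1 : ∀ i, pderiv i (fun x => χ s * φ x) = fun x => χ s * pderiv i φ x := fun i =>
        funext fun x => pderiv_const_mul hφ _ i x
      have h2 : laplace (fun x => χ s * φ x) x = χ s * laplace φ x := by
        simp only [laplace, h1, Finset.mul_sum]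
        exact Finset.sum_congr rfl fun i _ => pderiv_const_mul (hφ.pderiv i) _ i x
      have h3 : ∑ i, b s x i * pderiv i (fun x => χ s * φ x) x =
          χ s * ∑ i, b s x i * pderiv i φ x := by
        simp only [h1, Finset.mul_sum]
        exact Finset.sum_congr rfl fun i _ => by ring
      rw [h2, h3, deriv_mul_const (hχ.differentiable (by simp) s)]
      ring
    simp only [hpt] at key
    rw [setIntegral_eq_of_subset_of_forall_sdiff_eq_zero (s := Set.Icc 0 τ)] at key
    · refine Eq.trans (integral_congr_ae ?_) key
      filter_upwards [hb.drift, ae_restrict_mem measurableSet_Icc] with s hd hs'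
      have hwi : Integrable (w s) := (memLp_top_of_bound (hs s hs') M (hM s hs')).integrable le_top
      have hi : Integrable fun x => w s x * ((∑ i, b s x i * pderiv i φ x) + ν * laplace φ x) := by
        simp only [mul_add]
        exact (integrable_drift_mul hd (hs s hs') (hM s hs')
          fun i => (hφ.pderiv i).continuous).add
          (integrable_mul_continuous (hφ.laplace.continuous.const_mul _) hwi)
      rw [integral_add ((integrable_mul_continuous hφ.continuous hwi).const_mul _)
        (hi.const_mul _), integral_const_mul, integral_const_mul]
      rfl
    · exact (measurableSet_le measurable_const measurable_id).inter
        (measurableSet_le ENNReal.measurable_ofReal measurable_const)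
    · exact hsub
    · intro s hs'
      obtain ⟨h1, h2⟩ := hd0 s hs'.2
      simp [h1, h2]

end AdvDiff

end

/-! ### The hypotheses on the velocity and continuity of the diffusive solutions. -/

noncomputable section

namespace AdvDiff

lemma Icc_subset_timeInterval {τ : ℝ} {T : ℝ≥0∞} (hτT : ENNReal.ofReal τ ≤ T) :
    Set.Icc 0 τ ⊆ timeInterval T :=
  fun _ hs => ⟨hs.1, (ENNReal.ofReal_le_ofReal hs.2).trans hτT⟩

lemma prod_restrict_Icc_le {d : ℕ} {τ : ℝ} {T : ℝ≥0∞} (hτT : ENNReal.ofReal τ ≤ T) :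
    (volume.restrict (Set.Icc 0 τ)).prod (volume : Measure (Torus d)) ≤ spacetime d T := by
  have e : ∀ S : Set ℝ, ((volume : Measure ℝ).restrict S).prod (volume : Measure (Torus d)) =
      (volume.prod volume).restrict (S ×ˢ Set.univ) := fun S => by
    rw [← Measure.prod_restrict, Measure.restrict_univ]
  rw [spacetime, e, e]
  exact Measure.restrict_mono (Set.prod_mono (Icc_subset_timeInterval hτT) le_rfl) le_rfl

lemma ae_Icc_of_ae_timeInterval {τ : ℝ} {T : ℝ≥0∞} (hτT : ENNReal.ofReal τ ≤ T) {P : ℝ → Prop}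
    (h : ∀ᵐ s ∂volume.restrict (timeInterval T), P s) :
    ∀ᵐ s ∂volume.restrict (Set.Icc 0 τ), P s :=
  ae_restrict_of_ae_restrict_of_subset (Icc_subset_timeInterval hτT) h

lemma lintegral_rpow_le_of_eLpNorm_le {d : ℕ} {F : Type*} [NormedAddCommGroup F]
    {f : Torus d → F} {p N : ℝ} (hp : 0 < p) (h : eLpNorm f (ENNReal.ofReal p) volume ≤ ENNReal.ofReal N) :
    ∫⁻ x, ‖f x‖ₑ ^ p ≤ ENNReal.ofReal N ^ p := by
  rw [eLpNorm_eq_lintegral_rpow_enorm_toReal (by simpa using hp) ENNReal.ofReal_ne_top,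
    ENNReal.toReal_ofReal hp.le] at h
  have := ENNReal.rpow_le_rpow h hp.le
  rwa [← ENNReal.rpow_mul, one_div, inv_mul_cancel₀ hp.ne', ENNReal.rpow_one] at this

theorem isTimeDrift_of_memLpTimeW1p {d : ℕ} (hd : 0 < d) {τ p : ℝ} {T : ℝ≥0∞} (hp : 1 ≤ p)
    (hτT : ENNReal.ofReal τ ≤ T) {b : ℝ → Torus d → Euc d}
    (hb : MemLpTimeW1p (⊤ : ℝ≥0∞) (ENNReal.ofReal p) T b) (hdiv : DivFree T b) :
    ∃ B : ℝ, 0 ≤ B ∧ IsTimeDrift τ p B b := by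
  obtain ⟨hbm, G, hGm, hG, hN⟩ := hb
  have hp0 : 0 < p := by linarith
  have hd1 : (1 : ℝ) ≤ d := by exact_mod_cast hd
  rw [eLpNorm_exponent_top] at hN
  set N := (eLpNormEssSup (fun t => eLpNorm (b t) (ENNReal.ofReal p) volume +
    ∑ i, eLpNorm (G t i) (ENNReal.ofReal p) volume) (volume.restrict (timeInterval T))).toReal with hN'
  have hN0 : 0 ≤ N := ENNReal.toReal_nonneg
  have hae : ∀ᵐ t ∂volume.restrict (timeInterval T), eLpNorm (b t) (ENNReal.ofReal p) volume +
      ∑ i, eLpNorm (G t i) (ENNReal.ofReal p) volume ≤ ENNReal.ofReal N := by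
    rw [hN', ENNReal.ofReal_toReal hN.ne]
    filter_upwards [ae_le_eLpNormEssSup (f := fun t => eLpNorm (b t) (ENNReal.ofReal p) volume +
      ∑ i, eLpNorm (G t i) (ENNReal.ofReal p) volume)
      (μ := volume.restrict (timeInterval T))] with t ht
    simpa only [enorm_eq_self] using ht
  have hcoord : ∀ (x : Euc d) (i : Fin d), ‖x i‖ₑ ≤ ‖x‖ₑ := fun x i => by
    rw [enorm_le_iff_norm_le]
    exact PiLp.norm_apply_le x i
  refine ⟨d * N, by positivity, ?_, ?_, ?_⟩
  · intro i
    exact ((EuclideanSpace.proj i : Euc d →L[ℝ] ℝ).continuous.comp_aestronglyMeasurable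
      (hbm.mono_measure (prod_restrict_Icc_le hτT)))
  · refine ae_Icc_of_ae_timeInterval hτT ?_
    filter_upwards [hG, hae, hdiv] with t hGt ht hdt
    refine ⟨fun i => (hGt.coord i).1, fun i z => ?_, hdt⟩
    refine ((hGt.coord i).lintegral_shift_le hd hp z).trans ?_
    have h1 : ∀ j, ∫⁻ x, ‖G t j x i‖ₑ ^ p ≤ ENNReal.ofReal N ^ p := by
      intro j
      refine le_trans ?_ (lintegral_rpow_le_of_eLpNorm_le (f := G t j) hp0 ?_)
      · exact lintegral_mono fun x => ENNReal.rpow_le_rpow (hcoord _ _) hp0.le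
      · exact (Finset.single_le_sum (f := fun j => eLpNorm (G t j) (ENNReal.ofReal p) volume)
          (fun _ _ => zero_le) (Finset.mem_univ j)).trans (le_add_self.trans ht)
    calc ‖z‖ₑ ^ p * ((d : ℝ≥0∞) ^ (p - 1) * ∑ j, ∫⁻ x, ‖G t j x i‖ₑ ^ p)
        ≤ ‖z‖ₑ ^ p * ((d : ℝ≥0∞) ^ (p - 1) * ∑ _j : Fin d, ENNReal.ofReal N ^ p) := by
          gcongr with j
          exact h1 j
      _ = ENNReal.ofReal (d * N * ‖z‖) ^ p := by
          rw [Finset.sum_const, Finset.card_univ, Fintype.card_fin, nsmul_eq_mul, ← mul_assoc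
            ((d : ℝ≥0∞) ^ (p - 1))]
          have h2 : (d : ℝ≥0∞) ^ (p - 1) * d = (d : ℝ≥0∞) ^ p := by
            nth_rewrite 2 [← ENNReal.rpow_one (d : ℝ≥0∞)]
            rw [← ENNReal.rpow_add _ _ (by simpa using hd.ne') (ENNReal.natCast_ne_top d),
              sub_add_cancel]
          rw [h2, ← ENNReal.mul_rpow_of_nonneg _ _ hp0.le, ← ENNReal.mul_rpow_of_nonneg _ _ hp0.le,
            ENNReal.ofReal_mul (by positivity), ENNReal.ofReal_mul (by positivity),
            ENNReal.ofReal_natCast, ← enorm_norm z, Real.enorm_of_nonneg (norm_nonneg z), mul_comm]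
  · refine ae_Icc_of_ae_timeInterval hτT ?_
    filter_upwards [hG, hae] with t hGt ht i
    have h1 : ∫⁻ x, ‖b t x i‖ₑ ≤ ENNReal.ofReal N := by
      calc ∫⁻ x, ‖b t x i‖ₑ ≤ ∫⁻ x, ‖b t x‖ₑ := lintegral_mono fun x => hcoord _ _
        _ = eLpNorm (b t) 1 volume := eLpNorm_one_eq_lintegral_enorm.symm
        _ ≤ eLpNorm (b t) (ENNReal.ofReal p) volume :=
            eLpNorm_le_eLpNorm_of_exponent_le (by simpa using hp) hGt.1.1
        _ ≤ ENNReal.ofReal N := le_self_add.trans ht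
    have h2 : ∫ x, |b t x i| ≤ N := by
      have := integral_norm_eq_lintegral_enorm (hGt.coord i).1.1
      simp only [Real.norm_eq_abs] at this
      rw [this]
      exact ENNReal.toReal_le_of_le_ofReal hN0 h1
    nlinarith

/-- The essential bound in space-time holds only for almost every time; L² continuity extends it to
every time, including 0. -/
lemma ae_abs_le_of_tendsto {d : ℕ} {τ M : ℝ} {T : ℝ≥0∞} (hτ : 0 < τ) (hτT : ENNReal.ofReal τ ≤ T)
    {u : ℝ → Torus d → ℝ} (hu : ContTimeL2 T u)
    (hM : ∀ᵐ s ∂volume.restrict (Set.Icc 0 τ), ∀ᵐ x, |u s x| ≤ M) :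
    ∀ s ∈ Set.Icc 0 τ, ∀ᵐ x, |u s x| ≤ M := by
  intro s hs
  have hsub := Icc_subset_timeInterval hτT
  have hum : ∀ σ ∈ Set.Icc 0 τ, AEStronglyMeasurable (u σ) := fun σ hσ => (hu.1 σ (hsub hσ)).1
  have hfreq : ∀ ε : ℝ≥0∞, 0 < ε → ∫⁻ x, ENNReal.ofReal (|u s x| - M) ≤ ε := by
    intro ε hε
    have h1 : ∀ᶠ σ in 𝓝[Set.Icc 0 τ] s, eLpNorm (fun x => u σ x - u s x) 2 volume < ε :=
      ((hu.2 s (hsub hs)).mono_left (nhdsWithin_mono _ hsub)).eventually_lt_const hε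
    obtain ⟨U, hUo, hsU, hU⟩ := mem_nhdsWithin.1 h1
    have hne : (U ∩ Set.Ioo 0 τ).Nonempty := by
      have : s ∈ closure (Set.Ioo 0 τ) := by rwa [closure_Ioo hτ.ne]
      exact mem_closure_iff.1 this U hUo hsU
    -- A nonempty open set of times has positive measure and so contains a time at which the bound
    -- holds.
    have hpos := (hUo.inter isOpen_Ioo).measure_pos (volume : Measure ℝ) hne
    have hM' := (ae_restrict_iff' measurableSet_Icc).1 hM
    obtain ⟨σ, hσU, hσ⟩ : ∃ σ ∈ U ∩ Set.Ioo 0 τ, σ ∈ Set.Icc 0 τ → ∀ᵐ x, |u σ x| ≤ M := by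
      by_contra hcon
      push Not at hcon
      refine hpos.ne' (measure_mono_null (fun σ hσ => ?_) (ae_iff.1 hM'))
      exact fun hh => absurd hh (by
        intro hh
        exact (hcon σ hσ).2 ((hh (hcon σ hσ).1).mono fun x hx => not_lt.2 hx))
    have hσI : σ ∈ Set.Icc 0 τ := Set.Ioo_subset_Icc_self hσU.2
    have hlt : eLpNorm (fun x => u σ x - u s x) 2 volume < ε := hU ⟨hσU.1, hσI⟩
    calc ∫⁻ x, ENNReal.ofReal (|u s x| - M) ≤ ∫⁻ x, ‖u σ x - u s x‖ₑ := by
          refine lintegral_mono_ae ?_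
          filter_upwards [hσ hσI] with x hx
          rw [Real.enorm_eq_ofReal_abs]
          refine ENNReal.ofReal_le_ofReal ?_
          have := abs_sub_abs_le_abs_sub (u s x) (u σ x)
          rw [abs_sub_comm] at this
          linarith
      _ = eLpNorm (fun x => u σ x - u s x) 1 volume := eLpNorm_one_eq_lintegral_enorm.symm
      _ ≤ eLpNorm (fun x => u σ x - u s x) 2 volume :=
          eLpNorm_le_eLpNorm_of_exponent_le (by norm_num) ((hum σ hσI).sub (hum s hs))
      _ ≤ ε := hlt.le
  have h0 : ∫⁻ x, ENNReal.ofReal (|u s x| - M) = 0 :=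
    le_antisymm (le_of_forall_pos_le_add fun ε hε => by simpa using hfreq ε hε) zero_le
  have hm : AEMeasurable (fun x => ENNReal.ofReal (|u s x| - M)) :=
    ((hum s hs).aemeasurable.abs.sub_const M).ennreal_ofReal
  rw [lintegral_eq_zero_iff' hm] at h0
  filter_upwards [h0] with x hx
  have := ENNReal.ofReal_eq_zero.1 hx
  linarith

lemma ContTimeL2.continuousOn_integral_mul {d : ℕ} {τ : ℝ} {T : ℝ≥0∞}
    (hτT : ENNReal.ofReal τ ≤ T) {u : ℝ → Torus d → ℝ} (hu : ContTimeL2 T u) {φ : Torus d → ℝ}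
    (hφ : SmoothOnTorus φ) : ContinuousOn (fun s => ∫ x, u s x * φ x) (Set.Icc 0 τ) := by
  intro s hs
  have hsub := Icc_subset_timeInterval hτT
  have hui : ∀ σ ∈ Set.Icc 0 τ, Integrable (u σ) := fun σ hσ =>
    (hu.1 σ (hsub hσ)).integrable (by norm_num)
  obtain ⟨C, hC0, hC⟩ := hφ.bounded
  have h1 : Tendsto (fun σ => eLpNorm (fun x => u σ x - u s x) 2 volume) (𝓝[Set.Icc 0 τ] s) (𝓝 0) :=
    (hu.2 s (hsub hs)).mono_left (nhdsWithin_mono _ hsub)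
  have h2 : Tendsto (fun σ => ENNReal.ofReal C * eLpNorm (fun x => u σ x - u s x) 2 volume)
      (𝓝[Set.Icc 0 τ] s) (𝓝 0) := by
    have := ENNReal.Tendsto.const_mul (a := ENNReal.ofReal C) h1 (Or.inr ENNReal.ofReal_ne_top)
    rwa [mul_zero] at this
  refine tendsto_integral_of_L1 _ (integrable_mul_continuous hφ.continuous (hui s hs)).aestronglyMeasurable ?_ ?_
  · filter_upwards [self_mem_nhdsWithin] with σ hσ
    exact integrable_mul_continuous hφ.continuous (hui σ hσ)
  · refine tendsto_of_tendsto_of_tendsto_of_le_of_le' tendsto_const_nhds h2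
      (Eventually.of_forall fun _ => zero_le) ?_
    filter_upwards [self_mem_nhdsWithin] with σ hσ
    calc ∫⁻ x, ‖u σ x * φ x - u s x * φ x‖ₑ ≤ ∫⁻ x, ENNReal.ofReal C * ‖u σ x - u s x‖ₑ := by
          refine lintegral_mono fun x => ?_
          rw [← sub_mul, enorm_mul, mul_comm]
          refine mul_le_mul_left ?_ _
          rw [Real.enorm_eq_ofReal_abs]
          exact ENNReal.ofReal_le_ofReal (hC x)
      _ = ENNReal.ofReal C * eLpNorm (fun x => u σ x - u s x) 1 volume := by
          rw [lintegral_const_mul' _ _ ENNReal.ofReal_ne_top, eLpNorm_one_eq_lintegral_enorm]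
      _ ≤ _ := by
          gcongr
          exact eLpNorm_le_eLpNorm_of_exponent_le (by norm_num)
            ((hui σ hσ).1.sub (hui s hs).1)

end AdvDiff

end

/-! ### Uniform bounds, and dissipation in terms of gradients. -/

noncomputable section

namespace AdvDiff

lemma ae_abs_le_eLpNorm_top {Ω : Type*} [MeasurableSpace Ω] {μ : Measure Ω} {f : Ω → ℝ}
    (hf : MemLp f (⊤ : ℝ≥0∞) μ) : ∀ᵐ x ∂μ, |f x| ≤ (eLpNorm f (⊤ : ℝ≥0∞) μ).toReal := by
  have h2 := hf.2.ne
  rw [eLpNorm_exponent_top] at h2 ⊢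
  filter_upwards [ae_le_eLpNormEssSup (f := f) (μ := μ)] with x hx
  rw [← Real.norm_eq_abs, ← toReal_enorm]
  exact ENNReal.toReal_mono h2 hx

/-- Integration against an essentially bounded function as a functional on `L¹`. -/
def pairingL1 {d : ℕ} (f : Torus d → ℝ) (hf : MemLp f (⊤ : ℝ≥0∞) volume) :
    Lp ℝ 1 (volume : Measure (Torus d)) →L[ℝ] ℝ :=
  LinearMap.mkContinuous
    { toFun := fun g => ∫ x, f x * g x
      map_add' := fun g₁ g₂ => by
        rw [← integral_add (integrable_bdd_mul_shift hf.1 (ae_abs_le_eLpNorm_top hf)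
          (L1.integrable_coeFn g₁)) (integrable_bdd_mul_shift hf.1 (ae_abs_le_eLpNorm_top hf)
          (L1.integrable_coeFn g₂))]
        refine integral_congr_ae ?_
        filter_upwards [Lp.coeFn_add g₁ g₂] with x hx
        rw [hx, Pi.add_apply, mul_add]
      map_smul' := fun c g => by
        rw [RingHom.id_apply, smul_eq_mul, ← integral_const_mul]
        refine integral_congr_ae ?_
        filter_upwards [Lp.coeFn_smul c g] with x hx
        rw [hx, Pi.smul_apply, smul_eq_mul]
        ring }
    (eLpNorm f (⊤ : ℝ≥0∞) volume).toReal (fun g => by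
      rw [L1.norm_eq_integral_norm, ← integral_const_mul]
      refine norm_integral_le_of_norm_le ((L1.integrable_coeFn g).norm.const_mul _) ?_
      filter_upwards [ae_abs_le_eLpNorm_top hf] with x hx
      rw [norm_mul]
      exact mul_le_mul_of_nonneg_right hx (norm_nonneg _))

lemma pairingL1_apply {d : ℕ} (f : Torus d → ℝ) (hf : MemLp f (⊤ : ℝ≥0∞) volume)
    (g : Lp ℝ 1 (volume : Measure (Torus d))) : pairingL1 f hf g = ∫ x, f x * g x := rfl

/-- Testing with indicators bounds every average of f by C in absolute value, which forces the
pointwise bound. -/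
lemma ae_abs_le_of_norm_pairingL1_le {d : ℕ} {f : Torus d → ℝ} (hf : MemLp f (⊤ : ℝ≥0∞) volume)
    {C : ℝ} (hC : ‖pairingL1 f hf‖ ≤ C) : ∀ᵐ x, |f x| ≤ C := by
  have hfi : Integrable f := hf.integrable le_top
  have key : ∀ S : Set (Torus d), MeasurableSet S → |∫ x in S, f x| ≤ ∫ _x in S, C := by
    intro S hS
    have hS' : (volume : Measure (Torus d)) S ≠ ⊤ := measure_ne_top _ _
    have h1 := (pairingL1 f hf).le_of_opNorm_le hC (indicatorConstLp 1 hS hS' (1 : ℝ))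
    rw [norm_indicatorConstLp one_ne_zero ENNReal.one_ne_top, pairingL1_apply] at h1
    have h2 : ∫ x, f x * indicatorConstLp 1 hS hS' (1 : ℝ) x = ∫ x in S, f x := by
      rw [← integral_indicator hS]
      refine integral_congr_ae ?_
      filter_upwards [indicatorConstLp_coeFn (p := 1) (hs := hS) (hμs := hS') (c := (1 : ℝ))] with x hx
      rw [hx]
      by_cases hxS : x ∈ S <;> simp [hxS]
    rw [h2] at h1
    simpa [mul_comm] using h1
  have h1 : f ≤ᵐ[volume] fun _ => C := ae_le_of_forall_setIntegral_le hfi (integrable_const C)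
    fun S hS _ => (le_abs_self _).trans (key S hS)
  have h2 : (fun x => -f x) ≤ᵐ[volume] fun _ => C := ae_le_of_forall_setIntegral_le hfi.neg
    (integrable_const C) fun S hS _ => by
      rw [integral_neg]
      exact (neg_le_abs _).trans (key S hS)
  filter_upwards [h1, h2] with x hx hx'
  exact abs_le.2 ⟨by linarith, hx⟩

/-- Weak-* continuous functions of time are bounded on compact time intervals. -/
lemma ContTimeWeakStar.exists_bound {d : ℕ} {τ : ℝ} {T : ℝ≥0∞} (hτT : ENNReal.ofReal τ ≤ T)
    {v : ℝ → Torus d → ℝ} (hv : ContTimeWeakStar T v) :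
    ∃ M : ℝ, ∀ s ∈ Set.Icc 0 τ, ∀ᵐ x, |v s x| ≤ M := by
  have hsub := Icc_subset_timeInterval hτT
  -- Pointwise boundedness on L¹ holds because a continuous function of time is bounded on the
  -- compact interval.
  obtain ⟨C, hC⟩ := banach_steinhaus
    (g := fun s : Set.Icc (0 : ℝ) τ => pairingL1 (v s) (hv.1 s (hsub s.2))) fun g => by
      obtain ⟨C, hC⟩ := (isCompact_Icc (a := (0 : ℝ)) (b := τ)).exists_bound_of_continuousOn
        ((hv.2 g (L1.integrable_coeFn g)).mono hsub)
      exact ⟨C, fun s => hC s s.2⟩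
  exact ⟨C, fun s hs => ae_abs_le_of_norm_pairingL1_le (hv.1 s (hsub hs)) (hC ⟨s, hs⟩)⟩

lemma exists_hasGradBound {d : ℕ} (hd : 0 < d) {τ Γ : ℝ} {T : ℝ≥0∞} (hτT : ENNReal.ofReal τ ≤ T)
    (hΓ : 0 ≤ Γ) {u : ℝ → Torus d → ℝ} (hu : MemLpTimeW1p 1 2 T u)
    (h : ∫⁻ s in Set.Icc 0 τ, gradL2Sq (u s) ≤ ENNReal.ofReal Γ) :
    ∃ γ, HasGradBound τ u γ ∧ ∫ s in Set.Icc 0 τ, γ s ≤ Γ := by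
  obtain ⟨-, G, hGm, hG, -⟩ := hu
  have hG' := ae_Icc_of_ae_timeInterval hτT hG
  -- Built from the jointly measurable gradient, this is measurable in time; uniqueness of weak
  -- gradients identifies it with `gradL2Sq` almost everywhere.
  set g : ℝ → ℝ≥0∞ := fun s => ∫⁻ x, ∑ i, ‖G s i x‖ₑ ^ 2 with hg
  have hgm : AEMeasurable g (volume.restrict (Set.Icc 0 τ)) :=
    AEMeasurable.lintegral_prod_right' (f := fun q : ℝ × Torus d => ∑ i, ‖G q.1 i q.2‖ₑ ^ 2)
      (Finset.aemeasurable_fun_sum _ fun i _ =>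
        ((hGm i).mono_measure (prod_restrict_Icc_le hτT)).enorm.pow_const 2)
  have hge : ∫⁻ s in Set.Icc 0 τ, g s ≤ ENNReal.ofReal Γ := by
    refine le_of_eq_of_le (lintegral_congr_ae ?_) h
    filter_upwards [hG'] with s hs
    exact (hs.gradL2Sq_eq hd).symm
  have hne : ∫⁻ s in Set.Icc 0 τ, g s ≠ ⊤ := (hge.trans_lt ENNReal.ofReal_lt_top).ne
  have hfin := ae_lt_top' hgm hne
  refine ⟨fun s => (g s).toReal, ⟨integrable_toReal_of_lintegral_ne_top hgm hne,
    fun _ => ENNReal.toReal_nonneg, ?_⟩, ?_⟩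
  · filter_upwards [hG', hfin] with s hs hs'
    refine ⟨G s, hs, ?_⟩
    rw [ENNReal.ofReal_toReal hs'.ne, hg]
    simp only [ENNReal.rpow_two]
    rw [lintegral_finsetSum' _ fun i _ => (hs.2.1 i).1.enorm.pow_const 2]
  · rw [integral_toReal hgm hfin]
    exact ENNReal.toReal_le_of_le_ofReal hΓ hge

lemma exists_hasGradBound_of_limsup {d : ℕ} (hd : 0 < d) {τ q : ℝ} {T : ℝ≥0∞}
    (hτT : ENNReal.ofReal τ ≤ T) {u : ℝ → ℝ → Torus d → ℝ}
    (hu : ∀ ν : ℝ, 0 < ν → MemLpTimeW1p 1 2 T (u ν))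
    (hlim : limsup (fun ν : ℝ => ENNReal.ofReal (Real.log (1 / ν) ^ q * ν) *
      ∫⁻ s in Set.Icc 0 τ, gradL2Sq (u ν s)) (𝓝[>] 0) < (⊤ : ℝ≥0∞)) :
    ∃ M₁ ν₀ : ℝ, 0 < M₁ ∧ 0 < ν₀ ∧ ∀ ν, 0 < ν → ν < ν₀ → ∃ γ, HasGradBound τ (u ν) γ ∧
      ∫ s in Set.Icc 0 τ, γ s ≤ M₁ * Real.log (1 / ν) ^ (-q) / ν := by
  obtain ⟨c, hc, -⟩ := ENNReal.lt_iff_exists_nnreal_btwn.1 hlim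
  obtain ⟨ν₁, hν₁, hsub⟩ := mem_nhdsGT_iff_exists_Ioo_subset.1 (eventually_lt_of_limsup_lt hc)
  -- Viscosities below 1 keep the logarithm positive; the added 1 makes the constant positive.
  refine ⟨c + 1, min ν₁ 1, by positivity, lt_min hν₁ one_pos, fun ν hν hν' => ?_⟩
  have hlt := hsub ⟨hν, hν'.trans_le (min_le_left _ _)⟩
  have hL : 0 < Real.log (1 / ν) := by
    refine Real.log_pos ?_
    rw [lt_div_iff₀ hν]
    linarith [min_le_right ν₁ 1]
  refine exists_hasGradBound hd hτT (by positivity) (hu ν hν) ?_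
  have ha : 0 < Real.log (1 / ν) ^ q * ν := by positivity
  have e : (c + 1 : ℝ) * Real.log (1 / ν) ^ (-q) / ν = (c + 1) / (Real.log (1 / ν) ^ q * ν) := by
    rw [Real.rpow_neg hL.le]
    field_simp
  rw [e, ENNReal.ofReal_div_of_pos ha, ENNReal.le_div_iff_mul_le
    (Or.inl (ENNReal.ofReal_pos.2 ha).ne') (Or.inl ENNReal.ofReal_ne_top), mul_comm]
  refine (le_of_lt hlt).trans ?_
  rw [← ENNReal.ofReal_coe_nnreal]
  exact ENNReal.ofReal_le_ofReal (by linarith)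

lemma IsAdvDiffSolution.exists_weakSol {d : ℕ} {K τ ν p B : ℝ} {T : ℝ≥0∞} (hτ : 0 < τ)
    (hτT : ENNReal.ofReal τ ≤ T) {R : ℕ → Torus d → ℝ}
    (h : ∀ n, 1 ≤ n → IsKernel n K (R n)) {b : ℝ → Torus d → Euc d} (hb : IsTimeDrift τ p B b)
    {u₀ : Torus d → ℝ} {u : ℝ → Torus d → ℝ} (hu : IsAdvDiffSolution T b ν u₀ u) :
    ∃ M, WeakSol τ b ν M u := by
  have hbd := Measure.ae_ae_of_ae_prod (ae_abs_le_eLpNorm_top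
    (hu.bounded.mono_measure (prod_restrict_Icc_le hτT)))
  exact ⟨_, weakSol_of_solvesCauchy hτ hτT h hb
    (fun s hs => (hu.cont.1 s (Icc_subset_timeInterval hτT hs)).1)
    (ae_abs_le_of_tendsto hτ hτT hu.cont hbd)
    (fun _ hφ => hu.cont.continuousOn_integral_mul hτT hφ) hu.solves⟩

lemma IsTransportSolution.exists_weakSol {d : ℕ} {K τ p B : ℝ} {T : ℝ≥0∞} (hτ : 0 < τ)
    (hτT : ENNReal.ofReal τ ≤ T) {R : ℕ → Torus d → ℝ}
    (h : ∀ n, 1 ≤ n → IsKernel n K (R n)) {b : ℝ → Torus d → Euc d} (hb : IsTimeDrift τ p B b)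
    {u₀ : Torus d → ℝ} {v : ℝ → Torus d → ℝ} (hv : IsTransportSolution T b u₀ v) :
    ∃ M, WeakSol τ b 0 M v := by
  obtain ⟨M, hM⟩ := hv.cont.exists_bound hτT
  exact ⟨M, weakSol_of_solvesCauchy hτ hτT h hb
    (fun s hs => (hv.cont.1 s (Icc_subset_timeInterval hτT hs)).1) hM
    (fun φ hφ => (hv.cont.2 φ hφ.integrable).mono (Icc_subset_timeInterval hτT)) hv.solves⟩

end AdvDiff

end

/-! ### Conclusion. -/

theorem mainTheorem6 (d : ℕ) (hd : 2 ≤ d) (T : ℝ≥0∞) (p : ℝ) (hp : 2 < p)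
    (b : ℝ → AdvDiff.Torus d → AdvDiff.Euc d)
    (hb : AdvDiff.MemLpTimeW1p (⊤ : ℝ≥0∞) (ENNReal.ofReal p) T b) (hdiv : AdvDiff.DivFree T b)
    (u₀ : AdvDiff.Torus d → ℝ) (hu₀ : MemLp u₀ (⊤ : ℝ≥0∞) volume)
    (u : ℝ → ℝ → AdvDiff.Torus d → ℝ)
    (hu : ∀ ν : ℝ, 0 < ν → AdvDiff.IsAdvDiffSolution T b ν u₀ (u ν))
    (v : ℝ → AdvDiff.Torus d → ℝ) (hv : AdvDiff.IsTransportSolution T b u₀ v)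
    (t : ℝ) (ht : 0 < t) (htT : ENNReal.ofReal t ≤ T) (q : ℝ) (hq : 0 < q)
    (hlim : limsup (fun ν : ℝ => ENNReal.ofReal (Real.log (1 / ν) ^ q * ν) *
      ∫⁻ s in Set.Icc 0 t, AdvDiff.gradL2Sq (u ν s)) (𝓝[>] 0) < (⊤ : ℝ≥0∞))
    (r : ℝ) (hr : 0 < r) (hrq : r < q * ((p - 2) / (p - 1))) :
    AdvDiff.MemHlog r (v t) := by
  have hd0 : 0 < d := by omega
  have hK : ∀ n, 1 ≤ n → AdvDiff.IsKernel (d := d) n (d * (24 * 1440)) (AdvDiff.torusKernel n) :=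
    fun n hn => AdvDiff.isKernel_torusKernel hd0 hn
  obtain ⟨B, hB, hbt⟩ := AdvDiff.isTimeDrift_of_memLpTimeW1p hd0 (by linarith) htT hb hdiv
  obtain ⟨M₁, ν₀, hM₁, hν₀, hgrad⟩ :=
    AdvDiff.exists_hasGradBound_of_limsup hd0 htT (fun ν hν => (hu ν hν).sobolev) hlim
  have hA := AdvDiff.ae_abs_le_eLpNorm_top hu₀
  obtain ⟨Mv, hMv⟩ := hv.exists_weakSol ht htT hK hbt
  -- The bounds obtained so far may depend on the viscosity. The maximum principle replaces all of
  -- them by the norm of u₀, so the constants are uniform in ν.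
  have hv' := hMv.mono_bound hp hB le_rfl hK hbt
    (by filter_upwards [hA, hv.solves.2] with x hx hx'; rwa [hx'])
  have hu' : AdvDiff.LogDissipation t _ q M₁ ν₀ b u (v 0) :=
    { weakSol := fun ν hν => by
        obtain ⟨M, hM⟩ := (hu ν hν).exists_weakSol ht htT hK hbt
        exact hM.mono_bound hp hB hν.le hK hbt
          (by filter_upwards [hA, (hu ν hν).solves.2] with x hx hx'; rwa [hx'])
      initial := fun ν hν => (hu ν hν).solves.2.trans hv.solves.2.symm
      grad := hgrad }
  exact hu'.memHlog hd0 ht hν₀ hp hB ENNReal.toReal_nonneg hq hM₁ hK hbt hv' hrq
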